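/- Let $\mathcal P=\langle \mathcal A\mid\mathcal R\rangle$ be a finite presentation of a group. A \emph{diagram} is a finite, planar, contractible combinatorial 2-complex $\Delta$, i.e. $\Delta=S^2\smallsetminus e_\infty$ for an open 2-cell $e_\infty$ of a combinatorial cellulation of the 2-sphere (a single vertex is allowed). A \emph{van Kampen diagram} for a word $w$ in $\mathcal A^{\pm1}$ is a diagram with a base vertex $\star\in\partial\Delta$ and with directed edges labelled by $\mathcal A$ such that one reads $w$ around $\partial\Delta$ starting from $\star$, and a cyclic conjugate of a word in $\mathcal R^{\pm1}$ around each 2-cell. The \emph{shelling moves} on a diagram are: \emph{1-cell collapse} (remove a 1-cell $e^1$ together with an end vertex $e^0$, where $e^1$ is attached to the rest of the diagram only by its other end vertex); \emph{1-cell expansion} (cut along a 1-cell $e^1$ that has an end vertex $e^0$ in the boundary of the diagram, so that $e^0$ and $e^1$ are doubled); \emph{2-cell collapse} (remove a 2-cell together with one of its edges that lies on the boundary of the diagram). A \emph{full shelling} of $\Delta$ is a finite sequence of diagrams starting with $\Delta$ and ending with a single vertex, each obtained from the previous one by a shelling move; it is a full shelling \emph{to $\star$} if the base vertex $\star$ is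 preserved throughout (when an expansion doubles $\star$, one of the two copies is chosen as the new $\star$). In a \emph{full fragmenting shelling} the terms are finite disjoint unions of diagrams, the last one is a set of vertices, and one may also apply a \emph{fragmentation} to a component: replace a component which is the union of two subdiagrams meeting in a single vertex, its boundary circuit being the concatenation of theirs, by the disjoint union of the two. The length of a shelling is the maximum over its terms of the sum of the lengths of the boundary circuits of the components. For a word $w$ representing $1$, let $\mathrm{Area}(w)$ be the minimal number of 2-cells of a van Kampen diagram for $w$, and let $\mathrm{FL}(w)$, $\mathrm{FFL}(w)$, $\mathrm{FFFL}(w)$ be the minimal length, over all van Kampen diagrams for $w$, of a full shelling to $\star$, of a full shelling, and of a full fragmenting shelling, respectively. For $\mathrm M=\mathrm{Area},\mathrm{FL},\mathrm{FFL},\mathrm{FFFL}$ and $n\in\mathbb N$ put $\mathrm M(n)=\max\{\mathrm M(w)\mid w \text{ represents } 1,\ \ell(w)\le n\}$. \textbf{Theorem.} These are well-defined functions $\mathbb N\to\mathbb N$, and there is a constant $C$, depending only on $\mathcal P$, such that for all $n\in\mathbb N$ $$\mathrm{Area}(n)\le C^{\mathrm{FFFL}(n)},\qquad \mathrm{FFFL}(n)\le\mathrm{FFL}(n)\le\mathrm{FL}(n)\le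 C\,\mathrm{Area}(n)+n .$$ -/

import Mathlib

/-- A *diagram*: a finite, contractible, planar combinatorial 2-complex, presented as the complement
`S² ∖ e_∞` of one open 2-cell in a cellulation of the 2-sphere.  `V`, `D`, `F` are its vertices,
directed edges (two for each 1-cell) and 2-cells.  On the sphere, `next` sends a directed edge to the
one that follows it around the 2-cell on its left, and `face` names that 2-cell, with `none` standing
for `e_∞`.  Consequently `rev` followed by `next` rotates the directed edges around their common
initial vertex.  A connected such surface is the sphere exactly when its Euler characteristic
`|V| - |D| / 2 + (|F| + 1)` is `2`.  A single vertex (`D` and `F` empty) is a diagram. -/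
structure Diagram where
  V : Type
  D : Type
  F : Type
  [finV : Finite V]
  [finD : Finite D]
  [finF : Finite F]
  /-- the initial vertex of a directed edge -/
  src : D → V
  /-- the same 1-cell with the opposite direction -/
  rev : Equiv.Perm D
  /-- the successor around the 2-cell on the left -/
  next : Equiv.Perm D
  /-- the 2-cell on the left, `none` being the exterior cell -/
  face : D → Option F
  rev_rev : ∀ x, rev (rev x) = x
  rev_ne : ∀ x, rev x ≠ x
  /-- vertices are the orbits of the rotation -/
  src_eq_iff : ∀ x y, src x = src y ↔ (next * rev).SameCycle x y
  /-- 2-cells are the orbits of `next` -/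
  face_eq_iff : ∀ x y, face x = face y ↔ next.SameCycle x y
  exists_face_eq : ∀ f : F, ∃ x, face x = some f
  /-- unless the diagram is a single vertex, the exterior cell has a boundary edge -/
  exists_outer : Nonempty D → ∃ x, face x = none
  connected : ∀ u v, Relation.ReflTransGen (fun a b => ∃ x, src x = a ∧ src (rev x) = b) u v
  euler : 2 * Nat.card V + 2 * (Nat.card F + 1) = Nat.card D + 4

namespace Diagram

/-- The number of 2-cells. -/
noncomputable def area (Δ : Diagram) : ℕ := Nat.card Δ.F

/-- The length of the boundary circuit of a diagram. -/
noncomputable def perimeter (Δ : Diagram) : ℕ := Nat.card {x : Δ.D // Δ.face x = none}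

/-- The diagram is a single vertex (without edges, connectedness leaves one vertex, and there is no
2-cell because each has a boundary edge). -/
def IsPoint (Δ : Diagram) : Prop := IsEmpty Δ.D

/-- The circuit around the 2-cell (or the exterior cell) on the left of `x`, starting with `x`. -/
noncomputable def circuit (Δ : Diagram) (x : Δ.D) : List Δ.D :=
  List.iterate Δ.next x (Function.minimalPeriod Δ.next x)

/-! ### Shelling moves

A move from `Δ` to `Δ'` comes with a map `ρ : Δ'.V → Δ.V` on vertices, which records what becomes of
a vertex; it is an inclusion for collapses, and identifies the two copies of the doubled vertex for
an expansion. -/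

open Classical in
/-- Passing over the 1-cell `d` in the rotation around a vertex: `y` itself unless `y` is one of the
two directions of the 1-cell, in which case the next directed edge around the initial vertex of `y`. -/
noncomputable def skip (Δ : Diagram) (d y : Δ.D) : Δ.D :=
  if y = d ∨ y = Δ.rev d then Δ.next (Δ.rev y) else y

/-- `Δ'` has the edges of `Δ` other than the 1-cell `d`, with the induced planar structure. -/
structure DeletesEdge (Δ Δ' : Diagram) (d : Δ.D) (ρ : Δ'.V → Δ.V) (ι : Δ'.D → Δ.D) : Prop where
  inj_vertex : Function.Injective ρ
  inj_edge : Function.Injective ι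
  range_edge : Set.range ι = {d, Δ.rev d}ᶜ
  src_eq : ∀ x, Δ.src (ι x) = ρ (Δ'.src x)
  rev_eq : ∀ x, Δ.rev (ι x) = ι (Δ'.rev x)
  next_eq : ∀ x, ι (Δ'.next x) = Δ.skip d (Δ.skip d (Δ.next (ι x)))

/-- *1-cell collapse*: remove the exterior 1-cell `d` together with its terminal vertex, where no
other edge ends at that vertex (the 1-cell is a spike). -/
def Collapse₁ (Δ Δ' : Diagram) (ρ : Δ'.V → Δ.V) : Prop :=
  ∃ (d : Δ.D) (ι : Δ'.D → Δ.D) (φ : Δ'.F ≃ Δ.F),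
    Δ.face d = none ∧ Δ.next d = Δ.rev d ∧
    DeletesEdge Δ Δ' d ρ ι ∧
    Set.range ρ = {Δ.src (Δ.rev d)}ᶜ ∧
    ∀ x, Δ.face (ι x) = (Δ'.face x).map φ

open Classical in
/-- *2-cell collapse*: remove a 2-cell `f` together with a 1-cell `d` that lies both on the boundary
of `f` and on the boundary of the diagram; the other edges of `f` become exterior. -/
def Collapse₂ (Δ Δ' : Diagram) (ρ : Δ'.V → Δ.V) : Prop :=
  ∃ (d : Δ.D) (f : Δ.F) (ι : Δ'.D → Δ.D) (φ : Δ'.F → Δ.F),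
    Δ.face d = none ∧ Δ.face (Δ.rev d) = some f ∧
    DeletesEdge Δ Δ' d ρ ι ∧
    Function.Surjective ρ ∧
    Function.Injective φ ∧ Set.range φ = {f}ᶜ ∧
    ∀ x, (Δ'.face x).map φ = if Δ.face (ι x) = some f then none else Δ.face (ι x)

open Classical in
/-- *1-cell expansion*: cut along the 1-cell `d`, whose initial vertex is on the boundary, starting
from the exterior corner before the boundary edge `y` at that vertex.  The 1-cell `{d, rev d}`
is doubled into `{d, p}` and `{q, rev d}`, the initial vertex is doubled, and the boundary circuit
gains the two edges `q`, `p` before `y`. -/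
def Expansion₁ (Δ Δ' : Diagram) (ρ : Δ'.V → Δ.V) : Prop :=
  ∃ (y d : Δ.D) (ι : Δ.D → Δ'.D) (p q : Δ'.D) (φ : Δ.F ≃ Δ'.F),
    Δ.face y = none ∧ Δ.src d = Δ.src y ∧
    Function.Injective ι ∧ p ≠ q ∧ Set.range ι = {p, q}ᶜ ∧
    -- edges
    Δ'.rev (ι d) = p ∧ Δ'.rev q = ι (Δ.rev d) ∧
    (∀ x, x ≠ d → x ≠ Δ.rev d → Δ'.rev (ι x) = ι (Δ.rev x)) ∧
    -- planar structure
    (∀ x, Δ'.next (ι x) = if Δ.next x = y then q else ι (Δ.next x)) ∧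
    Δ'.next q = p ∧ Δ'.next p = ι y ∧
    -- 2-cells
    (∀ x, Δ'.face (ι x) = (Δ.face x).map φ) ∧
    Δ'.face q = none ∧ Δ'.face p = none ∧
    -- vertices
    (∀ x, ρ (Δ'.src (ι x)) = Δ.src x) ∧
    ρ (Δ'.src q) = Δ.src d ∧ ρ (Δ'.src p) = Δ.src (Δ.rev d)

/-- One of the three shelling moves. -/
def Move (Δ Δ' : Diagram) (ρ : Δ'.V → Δ.V) : Prop :=
  Collapse₁ Δ Δ' ρ ∨ Collapse₂ Δ Δ' ρ ∨ Expansion₁ Δ Δ' ρ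

/-- `Δ'` is a subcomplex of `Δ` through the inclusions `ρ`, `ι`, `φ` of its vertices, edges and
2-cells, and the boundary circuit of `Δ` runs through the edges of `Δ'` in a single stretch, as in
the boundary circuit of `Δ'`. -/
structure IsPiece (Δ' Δ : Diagram) (ρ : Δ'.V → Δ.V) (ι : Δ'.D → Δ.D) (φ : Δ'.F → Δ.F) :
    Prop where
  inj_vertex : Function.Injective ρ
  inj_edge : Function.Injective ι
  inj_face : Function.Injective φ
  src_eq : ∀ x, Δ.src (ι x) = ρ (Δ'.src x)
  rev_eq : ∀ x, Δ.rev (ι x) = ι (Δ'.rev x)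
  face_eq : ∀ x, Δ.face (ι x) = (Δ'.face x).map φ
  next_eq : ∀ x z, Δ.next (ι x) = ι z → Δ'.next x = z
  leave_once : ∀ x z, Δ.next (ι x) ∉ Set.range ι → Δ.next (ι z) ∉ Set.range ι → x = z

/-- *Fragmentation*: `Δ` is the union of `Δ₁` and `Δ₂`, which meet in a single vertex (so that the
boundary circuit of `Δ` is a boundary circuit of `Δ₁` followed by one of `Δ₂`); replace `Δ` by the
disjoint union of `Δ₁` and `Δ₂`. -/
def Fragments (Δ Δ₁ Δ₂ : Diagram) : Prop :=
  ∃ (ρ₁ : Δ₁.V → Δ.V) (ι₁ : Δ₁.D → Δ.D) (φ₁ : Δ₁.F → Δ.F)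
    (ρ₂ : Δ₂.V → Δ.V) (ι₂ : Δ₂.D → Δ.D) (φ₂ : Δ₂.F → Δ.F),
    IsPiece Δ₁ Δ ρ₁ ι₁ φ₁ ∧ IsPiece Δ₂ Δ ρ₂ ι₂ φ₂ ∧
    Set.range ρ₁ ∪ Set.range ρ₂ = Set.univ ∧ (∃ v, Set.range ρ₁ ∩ Set.range ρ₂ = {v}) ∧
    IsCompl (Set.range ι₁) (Set.range ι₂) ∧ IsCompl (Set.range φ₁) (Set.range φ₂)

end Diagram

/-- The minimum of `max_i len (s i)` over all finite sequences `s 0, …, s m` that start at `x`, end in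
a state that is `done`, and advance by `step`; it is `⊤` if there is no such sequence. -/
noncomputable def minMaxLength {X : Type*} (step : X → X → Prop) (done : X → Prop) (len : X → ℕ)
    (x : X) : ℕ∞ :=
  ⨅ (L : ℕ) (_ : ∃ (m : ℕ) (s : ℕ → X), s 0 = x ∧ done (s m) ∧
    (∀ i < m, step (s i) (s (i + 1))) ∧ ∀ i ≤ m, len (s i) ≤ L), (L : ℕ∞)

/-- A diagram with a base vertex. -/
structure PointedDiagram where
  diag : Diagram
  base : diag.V

/-- A shelling move that preserves the base vertex (in an expansion that doubles the base vertex,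
either copy may be the new one). -/
def PointedDiagram.Step (Δ Δ' : PointedDiagram) : Prop :=
  ∃ ρ : Δ'.diag.V → Δ.diag.V, Diagram.Move Δ.diag Δ'.diag ρ ∧ ρ Δ'.base = Δ.base

namespace Diagram

/-- A move of a (free) shelling. -/
def FreeStep (Δ Δ' : Diagram) : Prop := ∃ ρ : Δ'.V → Δ.V, Move Δ Δ' ρ

/-- A move of a fragmenting free shelling, on a finite disjoint union of diagrams. -/
def FragStep (S T : List Diagram) : Prop :=
  ∃ (l r : List Diagram) (Δ : Diagram), S = l ++ Δ :: r ∧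
    ((∃ Δ', FreeStep Δ Δ' ∧ T = l ++ Δ' :: r) ∨
      ∃ Δ₁ Δ₂, Fragments Δ Δ₁ Δ₂ ∧ T = l ++ Δ₁ :: Δ₂ :: r)

/-- The filling length `FL(Δ, ⋆)`: the minimum over full shellings of `Δ` to `⋆`. -/
noncomputable def fillingLength (Δ : PointedDiagram) : ℕ∞ :=
  minMaxLength PointedDiagram.Step (fun Θ => Θ.diag.IsPoint) (fun Θ => Θ.diag.perimeter) Δ

/-- The free filling length `FFL(Δ)`: the minimum over full shellings of `Δ`. -/
noncomputable def freeFillingLength (Δ : Diagram) : ℕ∞ :=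
  minMaxLength FreeStep IsPoint perimeter Δ

/-- The fragmenting free filling length `FFFL(Δ)`: the minimum over full fragmenting free shellings
of `Δ`, the length of a disjoint union being the sum of the lengths of the boundary circuits. -/
noncomputable def fragFreeFillingLength (Δ : Diagram) : ℕ∞ :=
  minMaxLength FragStep (fun S => ∀ Θ ∈ S, Θ.IsPoint) (fun S => (S.map perimeter).sum) [Δ]

end Diagram

/-- A finite presentation `⟨A ∣ R⟩` on a finite alphabet `A`: finitely many words, not necessarily
reduced, in the letters `a = (a, true)` and their formal inverses `a⁻¹ = (a, false)`. -/
structure FinPresentation (A : Type*) where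
  rels : Finset (List (A × Bool))

namespace FinPresentation

variable {A : Type*} (P : FinPresentation A)

/-- The word `w` represents `1` in the group presented by `P`. -/
def NullHomotopic (w : List (A × Bool)) : Prop :=
  PresentedGroup.mk (FreeGroup.mk '' (P.rels : Set (List (A × Bool)))) (FreeGroup.mk w) = 1

/-- A *van Kampen diagram* for the word `w`: a diagram with a base vertex and labelled directed
edges, such that `w` is read around the boundary circuit from the base vertex, and a cyclic conjugate
of a word in `R^{±1}` is read around each 2-cell.  (All circuits have their cell on the same
side, also that of the exterior cell; replacing a diagram by its mirror image exchanges the two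
conventions for reading `w`.) -/
structure VanKampenDiagram (w : List (A × Bool)) extends PointedDiagram where
  label : diag.D → A × Bool
  label_rev : ∀ x, label (diag.rev x) = ((label x).1, !(label x).2)
  cell_label : ∀ x f, diag.face x = some f → ∃ r ∈ P.rels,
    (diag.circuit x).map label ~r r ∨ (diag.circuit x).map label ~r FreeGroup.invRev r
  boundary_label : (diag.IsPoint ∧ w = []) ∨
    ∃ x, diag.face x = none ∧ diag.src x = base ∧ (diag.circuit x).map label = w

/-- `Area(w)`. -/
noncomputable def wordArea (w : List (A × Bool)) : ℕ∞ :=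
  ⨅ Δ : P.VanKampenDiagram w, (Δ.diag.area : ℕ∞)

/-- `FL(w)`. -/
noncomputable def wordFL (w : List (A × Bool)) : ℕ∞ :=
  ⨅ Δ : P.VanKampenDiagram w, Diagram.fillingLength Δ.toPointedDiagram

/-- `FFL(w)`. -/
noncomputable def wordFFL (w : List (A × Bool)) : ℕ∞ :=
  ⨅ Δ : P.VanKampenDiagram w, Diagram.freeFillingLength Δ.diag

/-- `FFFL(w)`. -/
noncomputable def wordFFFL (w : List (A × Bool)) : ℕ∞ :=
  ⨅ Δ : P.VanKampenDiagram w, Diagram.fragFreeFillingLength Δ.diag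

/-- The filling function `M(n) = max {M(w) ∣ w null-homotopic, ℓ(w) ≤ n}` of an invariant `M` of
words. -/
noncomputable def fillingFunction (M : List (A × Bool) → ℕ∞) (n : ℕ) : ℕ∞ :=
  ⨆ (w : List (A × Bool)) (_ : P.NullHomotopic w ∧ w.length ≤ n), M w

/-- The Dehn function `Area(n)`. -/
noncomputable def Area : ℕ → ℕ∞ := P.fillingFunction P.wordArea

/-- The filling length function `FL(n)`. -/
noncomputable def FL : ℕ → ℕ∞ := P.fillingFunction P.wordFL

/-- The free filling length function `FFL(n)`. -/
noncomputable def FFL : ℕ → ℕ∞ := P.fillingFunction P.wordFFL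

/-- The fragmenting free filling length function `FFFL(n)`. -/
noncomputable def FFFL : ℕ → ℕ∞ := P.fillingFunction P.wordFFFL

end FinPresentation

/-!
The chain `FFFL ≤ FFL ≤ FL` holds because a full shelling to `⋆` is a full shelling, and a full
shelling is a fragmenting one on a single component.

`FL(n) ≤ C Area(n) + n`. Every diagram that is not a single vertex admits a collapse that preserves
`⋆` (`PointedDiagram.exists_step`): if some 1-cell lies between a 2-cell and the exterior, a 2-cell
collapse; otherwise the diagram is a tree, which has a leaf other than `⋆`. Collapses lower the
number of directed edges, which bounds the perimeter. In a diagram for `w` this number is `ℓ(w)`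
plus the sum of the lengths of the boundaries of the 2-cells, hence at most `C Area + ℓ(w)`.

`Area(n) ≤ C ^ FFFL(n)`. Along a fragmenting shelling, consider the configuration of the boundary
words of the components, and let its cost be the sum of the areas of these words. The moves act on
the words by free reductions and expansions, by the replacement of a part of a relator, and by
cutting a word in two; so the cost drops by at most one in each move
(`exists_cost_le_of_fragStep`). It ends at `0`, and therefore takes every value between `0` and
`Area(w)`. Different values belong to different configurations, of total length at most `FFFL(w)`,
and there are at most `C ^ FFFL(w)` of those (`fill_of_hasSequence`).

Both parts need that areas of words behave well under free reduction, rotation and concatenation,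
and that every null-homotopic word has a van Kampen diagram. To avoid planar topology, area is
first treated syntactically. `FinPresentation.Fill w n` says that `w` can be reduced to the empty
word by always treating the first letter: either as a bridge, paired with an inverse letter further
on, or as an edge of a 2-cell that is removed. Free cancellation for this relation (`Fill.cancel`)
is the combinatorial form of gluing two adjacent boundary edges, where spheres may be pinched off;
since only a boundary edge other than the glued ones is ever removed, these spheres never appear.
Conversely, a filling is turned into a diagram by attaching spikes (`Bounds.spike`) and 2-cells
along boundary stretches (`Bounds.chord`), starting from a single vertex. So the syntactic area
bounds the area from above, and it is the syntactic one that is used as the cost.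
-/

/-! ### Fillings of words -/

/-- The formal inverse of a letter. -/
def invLetter {A : Type*} (a : A × Bool) : A × Bool := (a.1, !a.2)

@[simp] theorem invLetter_invLetter {A : Type*} (a : A × Bool) : invLetter (invLetter a) = a := by
  simp [invLetter]

theorem invRev_append_singleton {A : Type*} (s : List (A × Bool)) (a : A × Bool) :
    FreeGroup.invRev (s ++ [a]) = invLetter a :: FreeGroup.invRev s := by
  simp [FreeGroup.invRev, invLetter]

theorem isRotated_invRev {A : Type*} {s t : List (A × Bool)} (h : s ~r t) :
    (FreeGroup.invRev s) ~r (FreeGroup.invRev t) := by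
  unfold FreeGroup.invRev
  exact (h.map _).reverse

/-- The possible shapes of an occurrence of `s` in a word that has a marked letter `b`. -/
theorem append_eq_append_cons {α : Type*} {u s v x y : List α} {b : α}
    (h : u ++ (s ++ v) = x ++ b :: y) :
    (∃ v', x = u ++ (s ++ v') ∧ v = v' ++ b :: y) ∨
    (∃ u', u = x ++ b :: u' ∧ y = u' ++ (s ++ v)) ∨
    (∃ s₁ s₂, s = s₁ ++ b :: s₂ ∧ x = u ++ s₁ ∧ y = s₂ ++ v) := by
  rcases List.append_eq_append_iff.1 h with ⟨t, rfl, ht⟩ | ⟨t, rfl, ht⟩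
  · rcases List.append_eq_append_iff.1 ht with ⟨t', rfl, h'⟩ | ⟨t', rfl, h'⟩
    · exact Or.inl ⟨t', rfl, h'⟩
    · cases t' with
      | nil => exact Or.inl ⟨[], by simp, by simpa using h'.symm⟩
      | cons c t' =>
        simp only [List.cons_append, List.cons.injEq] at h'
        obtain ⟨rfl, h'⟩ := h'
        exact Or.inr (Or.inr ⟨t, t', rfl, rfl, h'⟩)
  · cases t with
    | nil =>
      simp only [List.nil_append] at ht
      cases s with
      | nil => exact Or.inl ⟨[], by simp, by simpa using ht.symm⟩
      | cons c s =>
        simp only [List.cons_append, List.cons.injEq] at ht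
        obtain ⟨rfl, rfl⟩ := ht
        exact Or.inr (Or.inr ⟨[], s, rfl, by simp, rfl⟩)
    | cons c t =>
      simp only [List.cons_append, List.cons.injEq] at ht
      obtain ⟨rfl, rfl⟩ := ht
      exact Or.inr (Or.inl ⟨t, rfl, rfl⟩)

namespace FinPresentation

variable {A : Type*} {P : FinPresentation A}

/-- `l` is a word that may be read around a 2-cell: a cyclic conjugate of a word in `R^{±1}`. -/
def IsCell (P : FinPresentation A) (l : List (A × Bool)) : Prop :=
  ∃ r ∈ P.rels, l ~r r ∨ l ~r FreeGroup.invRev r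

theorem IsCell.rotate {l l' : List (A × Bool)} (h : P.IsCell l) (hl : l ~r l') : P.IsCell l' := by
  obtain ⟨r, hr, h | h⟩ := h
  · exact ⟨r, hr, Or.inl (hl.symm.trans h)⟩
  · exact ⟨r, hr, Or.inr (hl.symm.trans h)⟩

theorem IsCell.invRev {l : List (A × Bool)} (h : P.IsCell l) : P.IsCell (FreeGroup.invRev l) := by
  obtain ⟨r, hr, h | h⟩ := h
  · exact ⟨r, hr, Or.inr (isRotated_invRev h)⟩
  · exact ⟨r, hr, Or.inl (by simpa using isRotated_invRev h)⟩

/-- `P.Fill w n`: the word `w` bounds a diagram with at most `n` 2-cells, expressed as a recipe for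
taking the diagram apart that always removes the first edge `a` of the boundary circuit. If `a` is
a bridge, its removal leaves two diagrams (`bridge`); otherwise a 2-cell lies behind `a`, and its
removal together with `a` puts the rest `s` of its boundary in the place of `a` (`cell`). -/
inductive Fill (P : FinPresentation A) : List (A × Bool) → ℕ → Prop
  | nil (n : ℕ) : Fill P [] n
  | bridge {w₁ w₂ : List (A × Bool)} {n₁ n₂ : ℕ} (a : A × Bool) :
      Fill P w₁ n₁ → Fill P w₂ n₂ → Fill P (a :: (w₁ ++ invLetter a :: w₂)) (n₁ + n₂)
  | cell {s w : List (A × Bool)} {n : ℕ} (a : A × Bool) :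
      P.IsCell (s ++ [invLetter a]) → Fill P (s ++ w) n → Fill P (a :: w) (n + 1)

theorem Fill.mono {w : List (A × Bool)} {n m : ℕ} (h : P.Fill w n) (hnm : n ≤ m) :
    P.Fill w m := by
  induction h generalizing m with
  | nil => exact .nil _
  | @bridge w₁ w₂ n₁ n₂ a _ _ ih₁ ih₂ =>
    obtain ⟨k, rfl⟩ := Nat.exists_eq_add_of_le hnm
    rw [add_assoc]
    exact .bridge a (ih₁ le_rfl) (ih₂ (by omega))
  | @cell s w n a hs _ ih =>
    obtain ⟨k, rfl⟩ := Nat.exists_eq_add_of_le hnm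
    rw [show n + 1 + k = n + k + 1 by omega]
    exact .cell a hs (ih (by omega))

/-- The boundary connected sum of two diagrams at a vertex. -/
theorem Fill.insert {u v w : List (A × Bool)} {n m : ℕ} (hw : P.Fill w n)
    (h : P.Fill (u ++ v) m) : P.Fill (u ++ (w ++ v)) (n + m) := by
  have front : ∀ {w v : List (A × Bool)} {n m : ℕ}, P.Fill w n → P.Fill v m →
      P.Fill (w ++ v) (n + m) := by
    intro w v n m hw hv
    induction hw with
    | nil n => exact hv.mono (by omega)
    | @bridge w₁ w₂ n₁ n₂ a h₁ _ _ ih₂ =>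
      rw [add_assoc]
      simpa using Fill.bridge a h₁ ih₂
    | @cell s w n a hs _ ih =>
      rw [show n + 1 + m = n + m + 1 by omega]
      refine .cell a hs (by simpa using ih)
  generalize hz : u ++ v = z at h
  induction h generalizing u v with
  | nil k =>
    obtain ⟨rfl, rfl⟩ := List.append_eq_nil_iff.1 hz
    simpa using hw.mono (Nat.le_add_right n k)
  | @bridge w₁ w₂ n₁ n₂ a h₁ h₂ ih₁ ih₂ =>
    cases u with
    | nil =>
      simp only [List.nil_append] at hz ⊢
      subst hz
      exact front hw (.bridge a h₁ h₂)
    | cons b u =>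
      simp only [List.cons_append, List.cons.injEq] at hz
      obtain ⟨rfl, hz⟩ := hz
      rcases List.append_eq_append_iff.1 hz with ⟨t, rfl, rfl⟩ | ⟨t, rfl, ht⟩
      · have := Fill.bridge b (ih₁ rfl) h₂
        rw [← add_assoc]
        simpa using this
      · cases t with
        | nil =>
          simp only [List.nil_append] at ht
          subst ht
          have := Fill.bridge b (ih₁ (u := w₁) (v := []) (by simp)) h₂
          rw [← add_assoc]
          simpa using this
        | cons c t =>
          simp only [List.cons_append, List.cons.injEq] at ht
          obtain ⟨rfl, rfl⟩ := ht
          have := Fill.bridge b h₁ (ih₂ rfl)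
          rw [show n + (n₁ + n₂) = n₁ + (n + n₂) by omega]
          simpa using this
  | @cell s z n' a hs h ih =>
    cases u with
    | nil =>
      simp only [List.nil_append] at hz ⊢
      subst hz
      exact front hw (.cell a hs h)
    | cons b u =>
      simp only [List.cons_append, List.cons.injEq] at hz
      obtain ⟨rfl, rfl⟩ := hz
      have := ih (u := s ++ u) (v := v) (by simp)
      exact .cell b hs (by simpa using this)

theorem Fill.append {w v : List (A × Bool)} {n m : ℕ} (hw : P.Fill w n) (hv : P.Fill v m) :
    P.Fill (w ++ v) (n + m) :=
  hw.insert (u := []) hv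

theorem Fill.conj {w : List (A × Bool)} {n : ℕ} (a : A × Bool) (hw : P.Fill w n) :
    P.Fill (a :: (w ++ [invLetter a])) n :=
  .bridge a hw (.nil 0)

/-- Attaching a 2-cell along a stretch `s` of the boundary, given rotations at no larger area. -/
theorem Fill.attach_of_rotate {n : ℕ}
    (rot : ∀ m ≤ n, ∀ u v, P.Fill (u ++ v) m → P.Fill (v ++ u) m)
    (att : ∀ m < n, ∀ u s v a, P.IsCell (s ++ [invLetter a]) → P.Fill (u ++ (s ++ v)) m →
      P.Fill (u ++ a :: v) (m + 1))
    {u s v : List (A × Bool)} {a : A × Bool} (hs : P.IsCell (s ++ [invLetter a]))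
    (h : P.Fill (u ++ (s ++ v)) n) : P.Fill (u ++ a :: v) (n + 1) := by
  generalize hz : u ++ (s ++ v) = z at h
  induction h generalizing u v with
  | nil k =>
    simp only [List.append_eq_nil_iff] at hz
    obtain ⟨rfl, rfl, rfl⟩ := hz
    exact .cell a hs (.nil k)
  | @bridge w₁ w₂ n₁ n₂ b h₁ h₂ ih₁ ih₂ =>
    cases u with
    | nil =>
      simp only [List.nil_append] at hz ⊢
      exact .cell a hs (hz ▸ .bridge b h₁ h₂)
    | cons c u =>
      simp only [List.cons_append, List.cons.injEq] at hz
      obtain ⟨rfl, hz⟩ := hz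
      rcases append_eq_append_cons hz with ⟨v', rfl, rfl⟩ | ⟨u', rfl, rfl⟩ | ⟨s₁, s₂, rfl, rfl, rfl⟩
      · have := Fill.bridge c
          (ih₁ (fun m hm => rot m (by omega)) (fun m hm => att m (by omega)) rfl) h₂
        rw [show n₁ + n₂ + 1 = n₁ + 1 + n₂ by omega]
        simpa using this
      · have := Fill.bridge c h₁
          (ih₂ (fun m hm => rot m (by omega)) (fun m hm => att m (by omega)) rfl)
        rw [show n₁ + n₂ + 1 = n₁ + (n₂ + 1) by omega]
        simpa using this
      · -- The stretch contains `c⁻¹`, so the new 2-cell is the one behind the bridge `c`.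
        have h₁' := rot n₁ (by omega) _ _ h₁
        have h₃ := (h₁'.conj (invLetter a)).insert h₂
        rw [invLetter_invLetter] at h₃
        refine .cell (s := s₂ ++ invLetter a :: s₁) c (hs.rotate ?_) (by simpa using h₃)
        have := List.isRotated_append (l := s₁ ++ [invLetter c]) (l' := s₂ ++ [invLetter a])
        simpa using this
  | @cell t z n b ht h ih =>
    cases u with
    | nil =>
      simp only [List.nil_append] at hz ⊢
      exact .cell a hs (hz ▸ .cell b ht h)
    | cons c u =>
      simp only [List.cons_append, List.cons.injEq] at hz
      obtain ⟨rfl, rfl⟩ := hz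
      have := ih (u := t ++ u) (v := v) (fun m hm => rot m (by omega))
        (fun m hm => att m (by omega)) (by simp)
      exact .cell c ht (by simpa using this)

/-- Rotation of the boundary word and attachment of a 2-cell anywhere on the boundary, by a joint
induction on the area: to move the first letter to the end, the cell behind it is removed,
the remaining word is rotated at smaller area, and the cell is attached again at the end. -/
theorem Fill.rotate_and_attach (n : ℕ) :
    (∀ u v, P.Fill (u ++ v) n → P.Fill (v ++ u) n) ∧
    (∀ u s v a, P.IsCell (s ++ [invLetter a]) → P.Fill (u ++ (s ++ v)) n →
      P.Fill (u ++ a :: v) (n + 1)) := by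
  induction n using Nat.strong_induction_on with
  | _ n ih =>
    have one : ∀ a w, P.Fill (a :: w) n → P.Fill (w ++ [a]) n := by
      intro a w h
      cases h with
      | @bridge w₁ w₂ n₁ n₂ _ h₁ h₂ =>
        have := h₁.append (h₂.conj (invLetter a))
        simpa using this
      | @cell s _ n _ hs h =>
        have h' := (ih n (by omega)).1 _ _ h
        exact (ih n (by omega)).2 w s [] a hs (by simpa using h')
    have rot : ∀ u v, P.Fill (u ++ v) n → P.Fill (v ++ u) n := by
      intro u
      induction u with
      | nil => intro v h; simpa using h
      | cons a u ihu =>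
        intro v h
        have := ihu (v ++ [a]) (by simpa using one _ _ h)
        simpa using this
    refine ⟨rot, fun u s v a hs h =>
      attach_of_rotate (fun m hm => ?_) (fun m hm => (ih m hm).2) hs h⟩
    rcases hm.lt_or_eq with hm | rfl
    · exact (ih m hm).1
    · exact rot

theorem Fill.rotate {u v : List (A × Bool)} {n : ℕ} (h : P.Fill (u ++ v) n) :
    P.Fill (v ++ u) n :=
  (rotate_and_attach n).1 u v h

theorem Fill.of_isRotated {u v : List (A × Bool)} {n : ℕ} (h : P.Fill u n) (huv : u ~r v) :
    P.Fill v n := by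
  obtain ⟨k, hk, rfl⟩ := List.isRotated_iff_mod.1 huv
  rw [List.rotate_eq_drop_append_take hk]
  exact Fill.rotate (by simpa using h)

/-- Gluing two consecutive boundary edges with inverse labels.  If the two edges are the whole
boundary, the glued complex would be a sphere, and a single vertex is taken instead; otherwise there
is another boundary edge `b`, and one recurses into what remains after the removal of `b`, never
meeting the spheres that the gluing may pinch off. -/
theorem Fill.cancel {u v : List (A × Bool)} {a : A × Bool} {n : ℕ}
    (h : P.Fill (u ++ a :: invLetter a :: v) n) : P.Fill (u ++ v) n := by
  suffices key : ∀ n k (u v : List (A × Bool)) a, (u ++ a :: invLetter a :: v).length = k →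
      P.Fill (u ++ a :: invLetter a :: v) n → P.Fill (u ++ v) n from key n _ u v a rfl h
  intro n
  induction n using Nat.strong_induction_on with
  | _ n ihn =>
  intro k
  induction k using Nat.strong_induction_on generalizing n with
  | _ k ihk =>
  have main : ∀ b (u v : List (A × Bool)) a, (b :: u ++ a :: invLetter a :: v).length = k →
      P.Fill (b :: u ++ a :: invLetter a :: v) n → P.Fill (b :: u ++ v) n := by
    intro b u v a hk h
    simp only [List.cons_append] at h
    generalize hz : b :: (u ++ a :: invLetter a :: v) = z at h
    have sub : ∀ m ≤ n, ∀ u' v' : List (A × Bool), (u' ++ a :: invLetter a :: v').length < k →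
        P.Fill (u' ++ a :: invLetter a :: v') m → P.Fill (u' ++ v') m := by
      intro m hm u' v' hl h'
      rcases hm.lt_or_eq with hm | rfl
      · exact ihn m hm _ u' v' a rfl h'
      · exact ihk _ hl m ihn u' v' a rfl h'
    cases h with
    | nil => simp at hz
    | @bridge w₁ w₂ n₁ n₂ c h₁ h₂ =>
      simp only [List.cons.injEq] at hz
      obtain ⟨rfl, hz⟩ := hz
      have hz' : u ++ ([a, invLetter a] ++ v) = w₁ ++ invLetter b :: w₂ := by simpa using hz
      simp only [List.cons_append, List.length_cons, List.length_append] at hk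
      rcases append_eq_append_cons hz' with ⟨v', rfl, rfl⟩ | ⟨u', rfl, rfl⟩ | ⟨s₁, s₂, hs, rfl, rfl⟩
      · have := sub n₁ (by omega) u v' (by simp at hk ⊢; omega) (by simpa using h₁)
        simpa using Fill.bridge b this h₂
      · have := sub n₂ (by omega) u' v (by simp at hk ⊢; omega) (by simpa using h₂)
        simpa using Fill.bridge b h₁ this
      · rcases s₁ with _ | ⟨c, _ | ⟨d, s₁⟩⟩
        · -- the bridge `b` is the mate of the first edge of the pair
          simp only [List.nil_append, List.cons.injEq] at hs
          obtain ⟨rfl, rfl⟩ := hs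
          have := Fill.insert (u := [b]) (v := v) h₁ (by simpa using h₂)
          simpa using this
        · -- the bridge `b` is the mate of the second edge of the pair
          simp only [List.cons_append, List.nil_append, List.cons.injEq] at hs
          obtain ⟨rfl, hs, rfl⟩ := hs
          obtain rfl : a = b := by rw [← invLetter_invLetter a, hs, invLetter_invLetter]
          have h₁' : P.Fill ([a] ++ u) n₁ := h₁.rotate
          simpa using h₁'.append h₂
        · simp at hs
    | @cell s w m c hs h =>
      simp only [List.cons.injEq] at hz
      obtain ⟨rfl, rfl⟩ := hz
      refine .cell b hs ?_
      have := ihn m (by omega) _ (s ++ u) v a rfl (by simpa using h)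
      simpa using this
  intro u v a hk h
  cases u with
  | nil =>
    cases v with
    | nil => exact .nil _
    | cons b v =>
      have h' : P.Fill (b :: v ++ a :: invLetter a :: []) n := by
        simpa using Fill.rotate (u := [a, invLetter a]) (v := b :: v) (by simpa using h)
      simpa using main b v [] a (by simp at hk ⊢; omega) h'
  | cons b u => exact main b u v a hk h

theorem Fill.pair {u v : List (A × Bool)} {n : ℕ} (a : A × Bool) (h : P.Fill (u ++ v) n) :
    P.Fill (u ++ a :: invLetter a :: v) n := by
  simpa using ((Fill.nil 0).conj a).insert h

theorem Fill.of_redStep {w w' : List (A × Bool)} {n : ℕ} (h : FreeGroup.Red.Step w w') :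
    P.Fill w n ↔ P.Fill w' n := by
  cases h with
  | @not u v x b => exact ⟨fun h => Fill.cancel (a := (x, b)) h, fun h => h.pair (x, b)⟩

theorem Fill.of_mk_eq {w w' : List (A × Bool)} {n : ℕ} (h : P.Fill w n)
    (hw : FreeGroup.mk w = FreeGroup.mk w') : P.Fill w' n := by
  have red : ∀ {w w' : List (A × Bool)}, FreeGroup.Red w w' → (P.Fill w n ↔ P.Fill w' n) := by
    intro w w' hr
    induction hr with
    | refl => rfl
    | tail _ h ih => exact ih.trans (Fill.of_redStep h)
  obtain ⟨z, h₁, h₂⟩ := FreeGroup.Red.exact.1 hw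
  exact (red h₂).2 ((red h₁).1 h)

theorem Fill.attach {u s v : List (A × Bool)} {a : A × Bool} {n : ℕ}
    (hs : P.IsCell (s ++ [invLetter a])) (h : P.Fill (u ++ (s ++ v)) n) :
    P.Fill (u ++ a :: v) (n + 1) :=
  (rotate_and_attach n).2 u s v a hs h

theorem Fill.conj_list {w : List (A × Bool)} {n : ℕ} (u : List (A × Bool)) (hw : P.Fill w n) :
    P.Fill (u ++ (w ++ FreeGroup.invRev u)) n := by
  induction u with
  | nil => simpa using hw
  | cons a u ih =>
    have : FreeGroup.invRev (a :: u) = FreeGroup.invRev u ++ [invLetter a] := by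
      simp [FreeGroup.invRev, invLetter]
    rw [this]
    simpa using ih.conj a

theorem Fill.of_isCell {l : List (A × Bool)} (h : P.IsCell l) : P.Fill l 1 := by
  rcases List.eq_nil_or_concat' l with rfl | ⟨s, a, rfl⟩
  · exact .nil 1
  · have h' : P.IsCell (FreeGroup.invRev s ++ [invLetter a]) := by
      refine h.invRev.rotate ?_
      rw [invRev_append_singleton]
      exact List.isRotated_append (l := [_])
    simpa using Fill.attach (u := s) (v := []) h'
      (by simpa using Fill.conj_list s (Fill.nil (P := P) 0))

theorem Fill.invRev {w : List (A × Bool)} {n : ℕ} (h : P.Fill w n) :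
    P.Fill (FreeGroup.invRev w) n := by
  induction h with
  | nil n => exact .nil n
  | @bridge w₁ w₂ n₁ n₂ a _ _ ih₁ ih₂ =>
    have := ih₂.append (ih₁.conj a)
    rw [add_comm]
    simpa [FreeGroup.invRev, invLetter] using this
  | @cell s w n a hs _ ih =>
    have hs' : P.IsCell (FreeGroup.invRev s ++ [a]) := by
      refine hs.invRev.rotate ?_
      rw [invRev_append_singleton, invLetter_invLetter]
      exact List.isRotated_append (l := [_])
    have := Fill.attach (u := FreeGroup.invRev w) (v := []) (a := invLetter a) (n := n)
      (by simpa using hs') (by simpa [FreeGroup.invRev] using ih)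
    simpa [FreeGroup.invRev, invLetter] using this

/-- Every null-homotopic word has a filling. -/
theorem NullHomotopic.exists_fill {w : List (A × Bool)} (h : P.NullHomotopic w) :
    ∃ n, P.Fill w n := by
  have hmem : FreeGroup.mk w ∈ Subgroup.normalClosure
      (FreeGroup.mk '' (P.rels : Set (List (A × Bool)))) :=
    (QuotientGroup.eq_one_iff _).1 h
  suffices key : ∀ g ∈ Subgroup.normalClosure (FreeGroup.mk '' (P.rels : Set (List (A × Bool)))),
      ∃ w n, FreeGroup.mk w = g ∧ P.Fill w n by
    obtain ⟨w', n, hw, hf⟩ := key _ hmem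
    exact ⟨n, hf.of_mk_eq hw⟩
  intro g hg
  induction hg using Subgroup.closure_induction with
  | mem g hg =>
    obtain ⟨_, ⟨r, hr, rfl⟩, hg⟩ := Group.mem_conjugatesOfSet_iff.1 hg
    obtain ⟨c, rfl⟩ := isConj_iff.1 hg
    obtain ⟨u, rfl⟩ : ∃ u, FreeGroup.mk u = c := Quot.exists_rep c
    refine ⟨_, 1, ?_, Fill.conj_list u
      (Fill.of_isCell ⟨r, hr, Or.inl (List.IsRotated.refl r)⟩)⟩
    rw [← FreeGroup.mul_mk, ← FreeGroup.mul_mk, ← FreeGroup.inv_mk, mul_assoc]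
  | one => exact ⟨[], 0, rfl, .nil 0⟩
  | mul x y _ _ hx hy =>
    obtain ⟨u, n, rfl, hu⟩ := hx
    obtain ⟨v, m, rfl, hv⟩ := hy
    exact ⟨u ++ v, n + m, FreeGroup.mul_mk.symm, hu.append hv⟩
  | inv x _ hx =>
    obtain ⟨u, n, rfl, hu⟩ := hx
    exact ⟨_, n, FreeGroup.inv_mk.symm, hu.invRev⟩

/-- `P.Gen w n`: the word `w` is the boundary of a diagram that is built from a single vertex by
attaching spikes and at most `n` 2-cells. -/
inductive Gen (P : FinPresentation A) : List (A × Bool) → ℕ → Prop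
  | nil (n : ℕ) : Gen P [] n
  | spike {u v : List (A × Bool)} {n : ℕ} (a : A × Bool) :
      Gen P (u ++ v) n → Gen P (u ++ a :: invLetter a :: v) n
  | cell {u s v : List (A × Bool)} {n : ℕ} (a : A × Bool) :
      P.IsCell (s ++ [invLetter a]) → Gen P (u ++ (s ++ v)) n → Gen P (u ++ a :: v) (n + 1)

theorem Gen.mono {w : List (A × Bool)} {n m : ℕ} (h : P.Gen w n) (hnm : n ≤ m) : P.Gen w m := by
  induction h generalizing m with
  | nil => exact .nil _
  | spike a _ ih => exact .spike a (ih hnm)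
  | @cell u s v n a hs _ ih =>
    obtain ⟨k, rfl⟩ := Nat.exists_eq_add_of_le hnm
    rw [show n + 1 + k = n + k + 1 by omega]
    exact .cell a hs (ih (by omega))

theorem Gen.insert {u v w : List (A × Bool)} {n m : ℕ} (hw : P.Gen w n)
    (h : P.Gen (u ++ v) m) : P.Gen (u ++ (w ++ v)) (n + m) := by
  induction hw with
  | nil n => exact h.mono (by omega)
  | @spike u' v' n a _ ih =>
    have := Gen.spike (u := u ++ u') (v := v' ++ v) a (by simpa using ih)
    simpa using this
  | @cell u' s v' n a hs _ ih =>
    have := Gen.cell (u := u ++ u') (v := v' ++ v) a hs (by simpa using ih)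
    rw [show n + 1 + m = n + m + 1 by omega]
    simpa using this

/-- Reading a recipe for taking a diagram apart backwards. -/
theorem Fill.gen {w : List (A × Bool)} {n : ℕ} (h : P.Fill w n) : P.Gen w n := by
  induction h with
  | nil n => exact .nil n
  | @bridge w₁ w₂ n₁ n₂ a _ _ ih₁ ih₂ =>
    have := ih₁.insert (u := [a]) (v := invLetter a :: w₂) (Gen.spike (u := []) a ih₂)
    simpa using this
  | cell a hs _ ih => exact Gen.cell (u := []) a hs ih

end FinPresentation

/-! ### Circuits of a permutation -/

/-- A property that passes from `z` to `σ z` spreads over the cycles of `σ`. -/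
theorem Equiv.Perm.SameCycle.induct {α : Type*} [Finite α] {σ : Equiv.Perm α} {x y : α}
    (h : σ.SameCycle x y) {C : α → Prop} (hx : C x) (hC : ∀ z, C z → C (σ z)) : C y := by
  obtain ⟨n, rfl⟩ := h.exists_nat_pow_eq
  clear h
  induction n with
  | zero => exact hx
  | succ n ih => rw [pow_succ', Equiv.Perm.mul_apply]; exact hC _ ih

/-- The list `l` runs once around a cycle of `σ`, or is empty. -/
def IsCircuit {α : Type*} (σ : Equiv.Perm α) (l : List α) : Prop :=
  l.Nodup ∧ l.map σ = l.rotate 1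

namespace IsCircuit

variable {α β : Type*} {σ : Equiv.Perm α} {l : List α}

theorem nil : IsCircuit σ [] := ⟨List.nodup_nil, rfl⟩

theorem map_eq_iff_isChain (f : α → α) (x y : α) (t : List α) :
    (x :: t).map f = t ++ [y] ↔ (x :: (t ++ [y])).IsChain (fun a b => f a = b) := by
  induction t generalizing x with
  | nil => simp
  | cons a t ih =>
    rw [List.cons_append, List.isChain_cons_cons, ← ih, List.map_cons, List.cons.injEq]

/-- A circuit closes up: after its last point comes the first one again. -/
theorem cons_iff {x : α} {t : List α} :
    IsCircuit σ (x :: t) ↔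
      (x :: t).Nodup ∧ (x :: (t ++ [x])).IsChain (fun a b => σ a = b) := by
  rw [IsCircuit, ← map_eq_iff_isChain]
  simp

theorem rotate (h : IsCircuit σ l) (n : ℕ) : IsCircuit σ (l.rotate n) := by
  refine ⟨List.nodup_rotate.2 h.1, ?_⟩
  rw [List.map_rotate, h.2, List.rotate_rotate, List.rotate_rotate, add_comm]

theorem swap {u v : List α} (h : IsCircuit σ (u ++ v)) : IsCircuit σ (v ++ u) := by
  simpa using h.rotate u.length

theorem apply_cons_cons {x y : α} {t : List α} (h : IsCircuit σ (x :: y :: t)) : σ x = y := by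
  have := h.2
  simp at this
  exact this.1

theorem apply_singleton {x : α} (h : IsCircuit σ [x]) : σ x = x := by
  simpa using h.2

theorem apply_last {x y : α} {t : List α} (h : IsCircuit σ (x :: (t ++ [y]))) : σ y = x :=
  apply_cons_cons (t := t) (IsCircuit.swap (u := x :: t) (v := [y]) h)

/-- The successor of the last point of a nonempty initial stretch `s` of a circuit. -/
theorem apply_of_append {x z : α} {s w : List α} (h : IsCircuit σ (s ++ [z] ++ w))
    (hx : x ∈ (w ++ s ++ [z]).head?) : σ z = x := by
  cases w with
  | nil =>
    cases s with
    | nil =>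
      simp only [List.append_nil, List.nil_append, List.head?_cons, Option.mem_def,
        Option.some.injEq] at hx h
      exact hx ▸ h.apply_singleton
    | cons b s =>
      simp only [List.nil_append, List.cons_append, List.head?_cons, Option.mem_def,
        Option.some.injEq, List.append_nil] at hx h
      exact hx ▸ h.apply_last
  | cons b w =>
    simp only [List.cons_append, List.head?_cons, Option.mem_def, Option.some.injEq] at hx
    subst hx
    have h' := IsCircuit.swap (u := s) (v := [z] ++ b :: w) (by simpa using h)
    exact apply_cons_cons (by simpa using h')

theorem apply_mem (h : IsCircuit σ l) {x : α} (hx : x ∈ l) : σ x ∈ l := by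
  have : σ x ∈ l.map σ := List.mem_map_of_mem hx
  rw [h.2] at this
  exact List.mem_rotate.1 this

theorem exists_cons (h : IsCircuit σ l) {x : α} (hx : x ∈ l) :
    ∃ t, IsCircuit σ (x :: t) ∧ l ~r (x :: t) := by
  obtain ⟨u, v, rfl⟩ := List.append_of_mem hx
  exact ⟨v ++ u, h.swap, by simpa using List.isRotated_append (l := u) (l' := x :: v)⟩

theorem sameCycle_of_mem_tail {f : Equiv.Perm α} {x y : α} {t : List α}
    (h : (x :: t).IsChain (fun a b => f a = b)) (hy : y ∈ t) : f.SameCycle x y := by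
  induction t generalizing x with
  | nil => simp at hy
  | cons a t ih =>
    rw [List.isChain_cons_cons] at h
    obtain ⟨rfl, h⟩ := h
    rw [← Equiv.Perm.sameCycle_apply_left]
    rcases List.mem_cons.1 hy with rfl | hy
    · exact Equiv.Perm.SameCycle.refl _ _
    · exact ih h hy

theorem mem_iff [Finite α] (h : IsCircuit σ l) {x y : α} (hx : x ∈ l) :
    y ∈ l ↔ σ.SameCycle x y := by
  constructor
  · intro hy
    obtain ⟨t, ht, hr⟩ := h.exists_cons hx
    have hy' : y ∈ x :: t := hr.mem_iff.1 hy
    have hc := (cons_iff.1 ht).2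
    exact sameCycle_of_mem_tail hc (by simpa [or_comm] using hy')
  · exact fun hxy => hxy.induct hx fun z hz => h.apply_mem hz

theorem eq_of_cons [Finite α] {x : α} {t t' : List α} (h : IsCircuit σ (x :: t))
    (h' : IsCircuit σ (x :: t')) : t = t' := by
  have hlen : (x :: t).length = (x :: t').length := by
    refine List.Perm.length_eq ((List.perm_ext_iff_of_nodup h.1 h'.1).2 fun y => ?_)
    rw [h.mem_iff (x := x) (by simp), h'.mem_iff (x := x) (by simp)]
  have h₁ := (cons_iff.1 h).2
  have h₂ := (cons_iff.1 h').2
  simp only [List.length_cons, add_left_inj] at hlen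
  clear h h'
  have key : ∀ (t t' : List α) (y : α), t.length = t'.length →
      (y :: (t ++ [x])).IsChain (fun a b => σ a = b) →
      (y :: (t' ++ [x])).IsChain (fun a b => σ a = b) → t = t' := by
    intro t
    induction t with
    | nil => intro t' y hl _ _; exact (List.length_eq_zero_iff.1 hl.symm).symm
    | cons a t ih =>
      intro t' y hl h₁ h₂
      cases t' with
      | nil => simp at hl
      | cons b t' =>
        simp only [List.cons_append, List.isChain_cons_cons] at h₁ h₂
        obtain ⟨rfl, h₁⟩ := h₁
        obtain ⟨rfl, h₂⟩ := h₂
        rw [ih t' _ (by simpa using hl) h₁ h₂]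
  exact key t t' x hlen h₁ h₂

theorem isRotated [Finite α] {l' : List α} {x : α} (h : IsCircuit σ l) (h' : IsCircuit σ l')
    (hx : x ∈ l) (hx' : x ∈ l') : l ~r l' := by
  obtain ⟨t, ht, hr⟩ := h.exists_cons hx
  obtain ⟨t', ht', hr'⟩ := h'.exists_cons hx'
  rw [ht.eq_of_cons ht'] at hr
  exact hr.trans hr'.symm

theorem map {τ : Equiv.Perm β} {γ : α → β} (hγ : Function.Injective γ) (h : IsCircuit σ l)
    (hc : ∀ x ∈ l, τ (γ x) = γ (σ x)) : IsCircuit τ (l.map γ) := by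
  refine ⟨h.1.map hγ, ?_⟩
  rw [← List.map_rotate, ← h.2, List.map_map, List.map_map]
  exact List.map_congr_left fun x hx => hc x hx

theorem of_map {τ : Equiv.Perm β} {γ : α → β} (hγ : Function.Injective γ)
    (h : IsCircuit τ (l.map γ)) (hc : ∀ x ∈ l, τ (γ x) = γ (σ x)) : IsCircuit σ l := by
  refine ⟨List.Nodup.of_map _ h.1, ?_⟩
  apply List.map_injective_iff.2 hγ
  rw [List.map_rotate, ← h.2, List.map_map, List.map_map]
  exact List.map_congr_left fun x hx => (hc x hx).symm

end IsCircuit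

theorem isCircuit_iterate {α : Type*} [Finite α] (σ : Equiv.Perm α) (x : α) :
    IsCircuit σ (List.iterate σ x (Function.minimalPeriod σ x)) := by
  have hpos : 0 < Function.minimalPeriod σ x :=
    Function.minimalPeriod_pos_of_mem_periodicPts (σ.injective.mem_periodicPts x)
  constructor
  · rw [List.nodup_iff_injective_get]
    intro i j hij
    have hi := i.2.trans_eq (List.length_iterate _ _ _)
    have hj := j.2.trans_eq (List.length_iterate _ _ _)
    simp only [List.get_eq_getElem, List.getElem_iterate] at hij
    exact Fin.ext (Function.iterate_injOn_Iio_minimalPeriod hi hj hij)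
  · have hp : σ^[Function.minimalPeriod σ x] x = x := Function.iterate_minimalPeriod
    have hmap : ∀ (n : ℕ) (y : α), (List.iterate σ y n).map σ = List.iterate σ (σ y) n := by
      intro n
      induction n with
      | zero => intro y; rfl
      | succ n ih => intro y; simp [List.iterate, ih]
    obtain ⟨n, hn⟩ := Nat.exists_eq_add_of_lt hpos
    rw [zero_add] at hn
    rw [hmap]
    rw [hn] at hp ⊢
    rw [List.iterate_add σ (σ x) n 1]
    simp only [List.iterate, List.rotate_cons_succ, List.rotate_zero]
    rw [← Function.iterate_succ_apply, hp]

theorem self_mem_iterate {α : Type*} [Finite α] (σ : Equiv.Perm α) (x : α) :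
    ∃ t, List.iterate σ x (Function.minimalPeriod σ x) = x :: t := by
  have hpos : 0 < Function.minimalPeriod σ x :=
    Function.minimalPeriod_pos_of_mem_periodicPts (σ.injective.mem_periodicPts x)
  obtain ⟨n, hn⟩ := Nat.exists_eq_add_of_lt hpos
  rw [zero_add] at hn
  rw [hn]
  exact ⟨_, rfl⟩

theorem IsCircuit.iterate_eq {α : Type*} [Finite α] {σ : Equiv.Perm α} {x : α} {t : List α}
    (h : IsCircuit σ (x :: t)) :
    List.iterate σ x (Function.minimalPeriod σ x) = x :: t := by
  obtain ⟨t', ht'⟩ := self_mem_iterate σ x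
  have h' := isCircuit_iterate σ x
  rw [ht'] at h' ⊢
  rw [h.eq_of_cons h']

open Classical in
theorem isCircuit_formPerm {α : Type*} {l : List α} (h : l.Nodup) :
    IsCircuit l.formPerm l := by
  refine ⟨h, List.ext_getElem (by simp) fun i h₁ h₂ => ?_⟩
  rw [List.getElem_map, List.formPerm_apply_getElem _ h, List.getElem_rotate]

open Classical in
/-- Surgery on a circuit `l` of a permutation: it is replaced by two circuits `c₁`, `c₂`, made of
points of `l` and new points. -/
theorem exists_perm_of_circuits {α β : Type*} {γ : α → β} (hγ : Function.Injective γ)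
    {σ : Equiv.Perm α} {l : List α} (hl : IsCircuit σ l) {c₁ c₂ : List β}
    (hc : (c₁ ++ c₂).Nodup) (hmem : ∀ x, γ x ∈ c₁ ++ c₂ → x ∈ l) :
    ∃ τ : Equiv.Perm β, IsCircuit τ c₁ ∧ IsCircuit τ c₂ ∧
      (∀ x, x ∉ l → τ (γ x) = γ (σ x)) := by
  let σ' : Equiv.Perm α := σ * l.formPerm⁻¹
  have hσ' : ∀ x ∈ l, σ' x = x := by
    intro x hx
    have hx' : x ∈ l.map l.formPerm := by
      rw [(isCircuit_formPerm hl.1).2]; exact List.mem_rotate.2 hx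
    obtain ⟨y, hy, rfl⟩ := List.mem_map.1 hx'
    have : l.map σ = l.map l.formPerm := by rw [(isCircuit_formPerm hl.1).2, hl.2]
    have hy' := List.map_inj_left.1 this y hy
    simp [σ', hy']
  let lift : Equiv.Perm β := σ'.viaEmbedding ⟨γ, hγ⟩
  have hlift : ∀ x, lift (γ x) = γ (σ' x) := fun x =>
    Equiv.Perm.viaEmbedding_apply σ' ⟨γ, hγ⟩ x
  have hfix : ∀ b ∈ c₁ ++ c₂, lift b = b := by
    intro b hb
    by_cases hr : b ∈ Set.range γ
    · obtain ⟨x, rfl⟩ := hr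
      rw [hlift, hσ' x (hmem x hb)]
    · exact Equiv.Perm.viaEmbedding_apply_of_notMem σ' ⟨γ, hγ⟩ b hr
  have hn₁ : c₁.Nodup := (List.nodup_append.1 hc).1
  have hn₂ : c₂.Nodup := (List.nodup_append.1 hc).2.1
  have hd : ∀ b, b ∈ c₁ → b ∉ c₂ := fun b h₁ h₂ => (List.nodup_append.1 hc).2.2 b h₁ b h₂ rfl
  refine ⟨lift * c₁.formPerm * c₂.formPerm, ⟨hn₁, ?_⟩, ⟨hn₂, ?_⟩, ?_⟩
  · rw [← (isCircuit_formPerm hn₁).2]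
    refine List.map_congr_left fun b hb => ?_
    rw [Equiv.Perm.mul_apply, Equiv.Perm.mul_apply, List.formPerm_apply_of_notMem (hd b hb)]
    exact hfix _ (List.mem_append_left _ (List.formPerm_apply_mem_of_mem hb))
  · rw [← (isCircuit_formPerm hn₂).2]
    refine List.map_congr_left fun b hb => ?_
    have hb' := List.formPerm_apply_mem_of_mem hb
    rw [Equiv.Perm.mul_apply, Equiv.Perm.mul_apply,
      List.formPerm_apply_of_notMem (fun h => hd _ h hb')]
    exact hfix _ (List.mem_append_right _ hb')
  · intro x hx
    have hx' : γ x ∉ c₁ ++ c₂ := fun h => hx (hmem x h)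
    rw [List.mem_append, not_or] at hx'
    rw [Equiv.Perm.mul_apply, Equiv.Perm.mul_apply, List.formPerm_apply_of_notMem hx'.2,
      List.formPerm_apply_of_notMem hx'.1, hlift]
    congr 1
    have : l.formPerm⁻¹ x = x := by
      rw [Equiv.Perm.inv_eq_iff_eq, List.formPerm_apply_of_notMem hx]
    change σ (l.formPerm⁻¹ x) = σ x
    rw [this]

theorem Equiv.Perm.SameCycle.map_of_step {α β : Type*} [Finite α] {σ : Equiv.Perm α}
    {τ : Equiv.Perm β} {γ : α → β} {x y : α} (h : σ.SameCycle x y)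
    (hstep : ∀ z, σ.SameCycle x z → τ.SameCycle (γ z) (γ (σ z))) : τ.SameCycle (γ x) (γ y) :=
  (h.induct (C := fun z => σ.SameCycle x z ∧ τ.SameCycle (γ x) (γ z))
    ⟨.refl _ _, .refl _ _⟩ fun z hz =>
      ⟨Equiv.Perm.sameCycle_apply_right.2 hz.1, hz.2.trans (hstep z hz.1)⟩).2

/-- Two circuits with a common stretch `s`: the permutations agree on the stretch except possibly
at its last point, where each continues with its own remainder (and closes up if that is empty). -/
theorem IsCircuit.apply_stretch {α β : Type*} {σ : Equiv.Perm α} {τ : Equiv.Perm β} {γ : α → β}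
    {s w : List α} {c : List β} (h : IsCircuit σ (s ++ w)) (h' : IsCircuit τ (s.map γ ++ c))
    {z : α} (hz : z ∈ s) :
    τ (γ z) = γ (σ z) ∨
      ((∀ x ∈ (w ++ s).head?, σ z = x) ∧ ∀ y ∈ (c ++ s.map γ).head?, τ (γ z) = y) := by
  obtain ⟨s₀, s₁, rfl⟩ := List.append_of_mem hz
  cases s₁ with
  | nil =>
    right
    constructor
    · intro x hx
      exact h.apply_of_append (by simpa using hx)
    · intro y hy
      refine IsCircuit.apply_of_append (s := s₀.map γ) (w := c) (by simpa using h') ?_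
      simpa using hy
  | cons b s₁ =>
    left
    have e₁ : σ z = b := IsCircuit.apply_of_append (s := s₀) (w := b :: (s₁ ++ w))
      (by simpa using h) (by simp)
    have e₂ : τ (γ z) = γ b := IsCircuit.apply_of_append (s := s₀.map γ)
      (w := γ b :: (s₁.map γ ++ c)) (by simpa using h') (by simp)
    rw [e₁, e₂]

/-! ### Diagrams: boundary circuits and labellings -/

namespace Diagram

attribute [instance] Diagram.finV Diagram.finD Diagram.finF

variable (Δ : Diagram)

theorem face_next (x : Δ.D) : Δ.face (Δ.next x) = Δ.face x :=
  (Δ.face_eq_iff _ _).2 (Equiv.Perm.sameCycle_apply_left.2 (.refl _ _))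

theorem src_next (x : Δ.D) : Δ.src (Δ.next x) = Δ.src (Δ.rev x) := by
  refine (Δ.src_eq_iff _ _).2 ?_
  have : Δ.next x = (Δ.next * Δ.rev) (Δ.rev x) := by simp [Δ.rev_rev]
  rw [this, Equiv.Perm.sameCycle_apply_left]

theorem src_rotate (x : Δ.D) : Δ.src (Δ.next (Δ.rev x)) = Δ.src x := by
  rw [src_next, Δ.rev_rev]

variable {Δ}

theorem mem_circuit {x : Δ.D} {l : List Δ.D} (h : IsCircuit Δ.next l) (hx : x ∈ l) {y : Δ.D} :
    y ∈ l ↔ Δ.face x = Δ.face y := by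
  rw [h.mem_iff hx, Δ.face_eq_iff]

theorem exists_circuit (x : Δ.D) : ∃ t, IsCircuit Δ.next (x :: t) := by
  obtain ⟨t, ht⟩ := self_mem_iterate Δ.next x
  exact ⟨t, ht ▸ isCircuit_iterate Δ.next x⟩

theorem circuit_isRotated {x : Δ.D} {l : List Δ.D} (h : IsCircuit Δ.next l) (hx : x ∈ l) :
    l ~r (Δ.circuit x) := by
  obtain ⟨t, ht, hr⟩ := h.exists_cons hx
  rw [circuit, ht.iterate_eq]
  exact hr

/-- The list `l` is the boundary circuit of the diagram, read from the base vertex `v` on.  It is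
empty for a single vertex. -/
def IsBoundary (Δ : Diagram) (v : Δ.V) (l : List Δ.D) : Prop :=
  IsCircuit Δ.next l ∧ (∀ x, x ∈ l ↔ Δ.face x = none) ∧ ∀ x ∈ l.head?, Δ.src x = v

theorem IsBoundary.isPoint {v : Δ.V} (h : Δ.IsBoundary v []) : Δ.IsPoint := by
  refine ⟨fun x => ?_⟩
  obtain ⟨y, hy⟩ := Δ.exists_outer ⟨x⟩
  exact absurd ((h.2.1 y).2 hy) (by simp)

/-- `lab` labels the directed edges by letters so that the boundary of each 2-cell reads a relator.
-/
structure IsLabelling {A : Type*} (P : FinPresentation A) (Δ : Diagram) (lab : Δ.D → A × Bool) :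
    Prop where
  rev_eq : ∀ x, lab (Δ.rev x) = invLetter (lab x)
  cell : ∀ (x : Δ.D) (f : Δ.F), Δ.face x = some f →
    ∃ c, x ∈ c ∧ IsCircuit Δ.next c ∧ P.IsCell (c.map lab)

theorem IsLabelling.isCell {A : Type*} {P : FinPresentation A} {lab : Δ.D → A × Bool}
    (h : IsLabelling P Δ lab) {x : Δ.D} {f : Δ.F} (hf : Δ.face x = some f) {c : List Δ.D}
    (hx : x ∈ c) (hc : IsCircuit Δ.next c) : P.IsCell (c.map lab) := by
  obtain ⟨c', hx', hc', hcell⟩ := h.cell x f hf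
  exact hcell.rotate ((hc'.isRotated hc hx' hx).map lab)

/-- There is a van Kampen diagram for `w` with at most `n` 2-cells. -/
def Bounds {A : Type*} (P : FinPresentation A) (w : List (A × Bool)) (n : ℕ) : Prop :=
  ∃ (Δ : Diagram) (v : Δ.V) (lab : Δ.D → A × Bool) (l : List Δ.D),
    IsLabelling P Δ lab ∧ Δ.IsBoundary v l ∧ l.map lab = w ∧ Δ.area ≤ n

variable {A : Type*} {P : FinPresentation A}

/-- The diagram with a single vertex. -/
def point : Diagram where
  V := Unit
  D := Empty
  F := Empty
  src := Empty.elim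
  rev := 1
  next := 1
  face := Empty.elim
  rev_rev := fun x => x.elim
  rev_ne := fun x => x.elim
  src_eq_iff := fun x => x.elim
  face_eq_iff := fun x => x.elim
  exists_face_eq := fun x => x.elim
  exists_outer := fun ⟨x⟩ => x.elim
  connected := fun _ _ => .refl
  euler := by simp

theorem Bounds.nil (n : ℕ) : Bounds P [] n :=
  ⟨point, (), Empty.elim, [], ⟨fun x => x.elim, fun x => x.elim⟩,
    ⟨IsCircuit.nil, fun x => x.elim, by simp⟩, rfl, by simp [area, point]⟩

/-- Moving the base vertex along the boundary. -/
theorem Bounds.rotate {u w : List (A × Bool)} {n : ℕ} (h : Bounds P (u ++ w) n) :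
    Bounds P (w ++ u) n := by
  obtain ⟨Δ, v, lab, l, h₁, h₂, h₃, h₄⟩ := h
  obtain ⟨lu, lw, rfl, rfl, rfl⟩ := List.map_eq_append_iff.1 h₃
  refine ⟨Δ, ((lw ++ lu).head?.map Δ.src).getD v, lab, lw ++ lu, h₁,
    ⟨h₂.1.swap, fun x => ?_, fun x hx => ?_⟩, by simp, h₄⟩
  · rw [← h₂.2.1, List.mem_append, List.mem_append, or_comm]
  · rw [Option.mem_def] at hx
    rw [hx]; rfl

/-- The reversal of directed edges after the addition of a 1-cell. -/
def addRev (Δ : Diagram) : Equiv.Perm (Δ.D ⊕ Bool) := Equiv.sumCongr Δ.rev Equiv.boolNot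

theorem card_add_edge (Δ : Diagram) : Nat.card (Δ.D ⊕ Bool) = Nat.card Δ.D + 2 := by
  rw [Nat.card_sum]; simp

/-- A function that is invariant under `σ`, and each of whose fibres lies in a single cycle, has
exactly the cycles of `σ` as its fibres.  All orbit conditions of the diagrams that are constructed
below are checked in this form. -/
theorem eq_iff_sameCycle {α β : Type*} [Finite α] {σ : Equiv.Perm α} {f : α → β}
    (hinv : ∀ z, f (σ z) = f z) (h : ∀ x y, f x = f y → σ.SameCycle x y) (x y : α) :
    f x = f y ↔ σ.SameCycle x y :=
  ⟨h x y, fun hxy => hxy.induct (C := fun z => f x = f z) rfl fun z hz => by rw [hinv, hz]⟩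

/-- Circuits of old 2-cells persist when the permutation changes only on the exterior circuit. -/
theorem isCircuit_map_of_face {β : Type*} {γ : Δ.D → β} (hγ : Function.Injective γ)
    {τ : Equiv.Perm β} {l c : List Δ.D} (hout : ∀ x, x ∈ l ↔ Δ.face x = none)
    (hτ : ∀ x, x ∉ l → τ (γ x) = γ (Δ.next x)) (hc : IsCircuit Δ.next c) {x : Δ.D} (hx : x ∈ c)
    {f : Δ.F} (hf : Δ.face x = some f) : IsCircuit τ (c.map γ) := by
  refine hc.map hγ fun z hz => hτ z fun hzl => ?_
  rw [hout, ← (mem_circuit hc hx).1 hz, hf] at hzl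
  simp at hzl

/-- Attaching a 1-cell at the base vertex `v`: the new directed edges `d`, `e` are read first in the
exterior circuit, and the new end vertex is `none : Option Δ.V`. -/
theorem Bounds.spike {w : List (A × Bool)} {n : ℕ} (a : A × Bool) (h : Bounds P w n) :
    Bounds P (a :: invLetter a :: w) n := by
  obtain ⟨Δ, v, lab, l, hlab, ⟨hl, hout, hv⟩, rfl, hn⟩ := h
  let γ : Δ.D → Δ.D ⊕ Bool := Sum.inl
  have hγ : Function.Injective γ := Sum.inl_injective
  set d : Δ.D ⊕ Bool := Sum.inr true with hd
  set e : Δ.D ⊕ Bool := Sum.inr false with he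
  obtain ⟨τ, hc, -, hτ⟩ := exists_perm_of_circuits hγ hl (c₁ := d :: e :: l.map γ) (c₂ := [])
    (by simp [hd, he, γ, List.nodup_map_iff hγ, hl.1]) (by intro x; simp [hd, he, γ])
  have hτd : τ d = e := hc.apply_cons_cons
  have hc' : IsCircuit τ (l.map γ ++ [d, e]) := IsCircuit.swap (u := [d, e]) hc
  have hτe : ∀ y ∈ (l.map γ ++ [d]).head?, τ e = y := fun y hy =>
    IsCircuit.apply_of_append (s := [d]) (z := e) (w := l.map γ) (by simpa using hc)
      (by cases l <;> simpa using hy)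
  have hτl : ∀ z ∈ l, τ (γ z) = γ (Δ.next z) ∨
      ((∀ x ∈ l.head?, Δ.next z = x) ∧ τ (γ z) = d) := by
    intro z hz
    rcases IsCircuit.apply_stretch (w := []) (by simpa using hl) hc' hz with h | ⟨h₁, h₂⟩
    · exact Or.inl h
    · exact Or.inr ⟨by simpa using h₁, h₂ d (by simp)⟩
  have hτ' : ∀ z, τ (γ z) = γ (Δ.next z) ∨
      ((∀ x ∈ l.head?, Δ.next z = x) ∧ τ (γ z) = d) := fun z => by
    by_cases hz : z ∈ l
    · exact hτl z hz
    · exact Or.inl (hτ z hz)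
  let src' : Δ.D ⊕ Bool → Option Δ.V :=
    Sum.elim (fun z => some (Δ.src z)) (fun b => if b then some v else none)
  let face' : Δ.D ⊕ Bool → Option Δ.F := Sum.elim Δ.face (fun _ => none)
  have hne : ∀ z : Δ.D, ∃ x, x ∈ l.head? := fun z => by
    cases hl' : l with
    | nil => exact ((IsBoundary.isPoint (v := v) ⟨hl' ▸ hl, hl' ▸ hout, by simp⟩).false z).elim
    | cons x t => exact ⟨x, by simp⟩
  have hdx : ∀ x ∈ l.head?, (τ * Δ.addRev).SameCycle d (γ x) := fun x hx => by
    have : (τ * Δ.addRev) d = γ x := hτe (γ x) (by cases l <;> simp_all)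
    rw [← this, Equiv.Perm.sameCycle_apply_right]
  have hstep : ∀ z, (τ * Δ.addRev).SameCycle (γ z) (γ ((Δ.next * Δ.rev) z)) := fun z => by
    have hz : (τ * Δ.addRev) (γ z) = τ (γ (Δ.rev z)) := rfl
    rw [← Equiv.Perm.sameCycle_apply_left, hz]
    rcases hτ' (Δ.rev z) with h | ⟨h₁, h₂⟩
    · rw [h]; exact .refl _ _
    · obtain ⟨x, hx⟩ := hne z
      rw [h₂, Equiv.Perm.mul_apply, h₁ x hx]
      exact hdx x hx
  have hsrc := eq_iff_sameCycle (σ := τ * Δ.addRev) (f := src')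
    (by
      rintro (z | _ | _)
      · change src' (τ (γ (Δ.rev z))) = some (Δ.src z)
        rcases hτ' (Δ.rev z) with h | ⟨h₁, h₂⟩
        · rw [h]; exact congrArg some (Δ.src_rotate z)
        · obtain ⟨x, hx⟩ := hne z
          rw [h₂, ← Δ.src_rotate z, h₁ x hx, hv x hx]; rfl
      · change src' (τ d) = none
        rw [hτd]; rfl
      · change src' (τ e) = some v
        cases l with
        | nil => rw [hτe d (by simp)]; rfl
        | cons x t => rw [hτe (γ x) (by simp)]; exact congrArg some (hv x (by simp)))
    (by
      have inl_inl : ∀ z z', Δ.src z = Δ.src z' → (τ * Δ.addRev).SameCycle (γ z) (γ z') :=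
        fun z z' h => ((Δ.src_eq_iff z z').1 h).map_of_step fun y _ => hstep y
      have inl_d : ∀ z, Δ.src z = v → (τ * Δ.addRev).SameCycle (γ z) d := fun z h => by
        obtain ⟨x, hx⟩ := hne z
        exact (inl_inl z x (h.trans (hv x hx).symm)).trans (hdx x hx).symm
      rintro (z | _ | _) (z' | _ | _) h
      · exact inl_inl z z' (by simpa [src'] using h)
      · simp [src'] at h
      · exact inl_d z (by simpa [src'] using h)
      · simp [src'] at h
      · exact .refl _ _
      · simp [src'] at h
      · exact (inl_d z' (by simpa [src'] using h.symm)).symm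
      · simp [src'] at h
      · exact .refl _ _)
  have hmem : ∀ b, b ∈ d :: e :: l.map γ ↔ face' b = none := by
    rintro (z | _ | _)
    · simp [hd, he, γ, face', hout]
    · simp [he, face']
    · simp [hd, face']
  have hface := eq_iff_sameCycle (σ := τ) (f := face')
    (by
      intro b
      by_cases hb : b ∈ d :: e :: l.map γ
      · rw [(hmem b).1 hb, (hmem _).1 (hc.apply_mem hb)]
      · rcases b with z | _ | _
        · have hz : z ∉ l := by simpa [hd, he, γ] using hb
          change face' (τ (γ z)) = _
          rw [hτ z hz]; exact Δ.face_next z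
        · simp [he] at hb
        · simp [hd] at hb)
    (by
      intro b b' h
      by_cases hb : b ∈ d :: e :: l.map γ
      · exact (hc.mem_iff hb).1 ((hmem _).2 (h ▸ (hmem b).1 hb))
      · have hb' : b' ∉ d :: e :: l.map γ := by rwa [hmem, ← h, ← hmem]
        rcases b with z | _ | _
        · rcases b' with z' | _ | _
          · refine ((Δ.face_eq_iff z z').1 h).map_of_step fun y hy => ?_
            have hy' : y ∉ l := by
              rw [hout, ← (Δ.face_eq_iff z y).2 hy, ← hout]; simpa [hd, he, γ] using hb
            change τ.SameCycle (γ y) (γ (Δ.next y))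
            rw [← hτ y hy', Equiv.Perm.sameCycle_apply_right]
          · simp [he] at hb'
          · simp [hd] at hb'
        · simp [he] at hb
        · simp [hd] at hb)
  let lab' : Δ.D ⊕ Bool → A × Bool := Sum.elim lab (fun b => if b then a else invLetter a)
  have hstep₁ : ∃ x, src' x = some v ∧ src' (Δ.addRev x) = none := ⟨d, rfl, rfl⟩
  have hstep₂ : ∃ x, src' x = none ∧ src' (Δ.addRev x) = some v := ⟨e, rfl, rfl⟩
  have hlift : ∀ u u', Relation.ReflTransGen (fun a b => ∃ x, src' x = a ∧ src' (Δ.addRev x) = b)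
      (some u) (some u') := fun u u' =>
    (Δ.connected u u').lift some fun a b ⟨x, h₁, h₂⟩ =>
      ⟨γ x, congrArg some h₁, congrArg some h₂⟩
  refine ⟨{ V := Option Δ.V, D := Δ.D ⊕ Bool, F := Δ.F, src := src', rev := Δ.addRev, next := τ,
            face := face', rev_rev := ?_, rev_ne := ?_, src_eq_iff := hsrc, face_eq_iff := hface,
            exists_face_eq := ?_, exists_outer := fun _ => ⟨d, rfl⟩, connected := ?_, euler := ?_ },
    some v, lab', d :: e :: l.map γ, ⟨?_, ?_⟩, ⟨hc, hmem, ?_⟩, ?_, hn⟩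
  · rintro (z | _ | _)
    · exact congrArg γ (Δ.rev_rev z)
    · rfl
    · rfl
  · rintro (z | _ | _)
    · exact fun h => Δ.rev_ne z (hγ h)
    · simp [addRev]
    · simp [addRev]
  · intro f
    obtain ⟨x, hx⟩ := Δ.exists_face_eq f
    exact ⟨γ x, hx⟩
  · rintro (_ | u) (_ | u')
    · exact .refl
    · exact .head hstep₂ (hlift v u')
    · exact .tail (hlift u v) hstep₁
    · exact hlift u u'
  · have := Δ.euler
    rw [card_add_edge, Finite.card_option]
    omega
  · rintro (z | _ | _)
    · exact hlab.rev_eq z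
    · exact (invLetter_invLetter a).symm
    · rfl
  · rintro (z | _ | _) f hf
    · obtain ⟨c, hz, hcc, hcell⟩ := hlab.cell z f hf
      exact ⟨c.map γ, List.mem_map_of_mem hz, isCircuit_map_of_face hγ hout hτ hcc hz hf,
        by rw [List.map_map]; exact hcell⟩
    · exact absurd hf (by simp [face'])
    · exact absurd hf (by simp [face'])
  · intro x hx
    simp only [List.head?_cons, Option.mem_def, Option.some.injEq] at hx
    subst hx; rfl
  · simp [lab', hd, he, γ]

open Classical in
/-- Attaching a 2-cell along the initial stretch `s` of the boundary: a new 1-cell is drawn through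
the exterior from the start to the end of `s`. It cuts the exterior circuit `s ++ w` into the new
exterior circuit `d :: w` and the circuit `s ++ [e]` of the new 2-cell, which is `some none` as a
value of the new `face`. -/
theorem Bounds.chord {s w : List (A × Bool)} {n : ℕ} (a : A × Bool)
    (ha : P.IsCell (s ++ [invLetter a])) (h : Bounds P (s ++ w) n) : Bounds P (a :: w) (n + 1) := by
  obtain ⟨Δ, v, lab, l, hlab, ⟨hl, hout, hv⟩, hlw, hn⟩ := h
  obtain ⟨s, w, rfl, rfl, rfl⟩ := List.map_eq_append_iff.1 hlw
  clear hlw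
  let γ : Δ.D → Δ.D ⊕ Bool := Sum.inl
  have hγ : Function.Injective γ := Sum.inl_injective
  set d : Δ.D ⊕ Bool := Sum.inr true with hd
  set e : Δ.D ⊕ Bool := Sum.inr false with he
  obtain ⟨hns, hnw, hsw⟩ := List.nodup_append.1 hl.1
  obtain ⟨τ, hc, hc₂, hτ⟩ := exists_perm_of_circuits hγ hl (c₁ := d :: w.map γ)
    (c₂ := s.map γ ++ [e])
    (by
      simp only [List.cons_append, List.nodup_cons, List.nodup_append, List.nodup_map_iff hγ]
      refine ⟨by simp [hd, he, γ], hnw, ⟨hns, by simp, by simp [he, γ]⟩, ?_⟩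
      simp only [List.mem_map, List.mem_append, List.mem_singleton]
      rintro _ ⟨x, hx, rfl⟩ _ (⟨y, hy, rfl⟩ | rfl) h
      · exact hsw y hy x hx (hγ h).symm
      · simp [he, γ] at h)
    (by intro x; simp [hd, he, γ, or_comm])
  have hc' : IsCircuit τ (w.map γ ++ [d]) := IsCircuit.swap (u := [d]) hc
  have hτd : ∀ y ∈ (w.map γ ++ [d]).head?, τ d = y := fun y hy =>
    IsCircuit.apply_of_append (s := []) (z := d) (w := w.map γ) (by simpa using hc)
      (by cases w <;> simpa using hy)
  have hτe : ∀ y ∈ (s.map γ ++ [e]).head?, τ e = y := fun y hy =>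
    IsCircuit.apply_of_append (s := s.map γ) (z := e) (w := []) (by simpa using hc₂)
      (by simpa using hy)
  have hτ' : ∀ z, τ (γ z) = γ (Δ.next z) ∨
      ((∀ x ∈ (s ++ w).head?, Δ.next z = x) ∧ τ (γ z) = d) ∨
      ((∀ x ∈ (w ++ s).head?, Δ.next z = x) ∧ τ (γ z) = e) := fun z => by
    by_cases hz : z ∈ s
    · rcases IsCircuit.apply_stretch hl hc₂ hz with h | ⟨h₁, h₂⟩
      · exact Or.inl h
      · exact Or.inr (Or.inr ⟨h₁, h₂ e (by simp)⟩)
    by_cases hz' : z ∈ w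
    · rcases IsCircuit.apply_stretch hl.swap hc' hz' with h | ⟨h₁, h₂⟩
      · exact Or.inl h
      · exact Or.inr (Or.inl ⟨h₁, h₂ d (by simp)⟩)
    · exact Or.inl (hτ z (by simp [hz, hz']))
  let u : Δ.V := ((w ++ s).head?.map Δ.src).getD v
  have hu : ∀ y ∈ (w ++ s).head?, Δ.src y = u := fun y hy => by
    rw [Option.mem_def] at hy
    simp only [u, hy]; rfl
  let src' : Δ.D ⊕ Bool → Δ.V := Sum.elim Δ.src (fun b => if b then v else u)
  let face' : Δ.D ⊕ Bool → Option (Option Δ.F) :=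
    Sum.elim (fun z => if z ∈ s then some none else (Δ.face z).map some)
      (fun b => if b then none else some none)
  have hne : ∀ z : Δ.D, s ++ w ≠ [] := fun z hnil =>
    (IsBoundary.isPoint (v := v) ⟨hnil ▸ hl, hnil ▸ hout, by simp⟩).false z
  have hhead : ∀ z : Δ.D, (∃ x, x ∈ (s ++ w).head?) ∧ ∃ y, y ∈ (w ++ s).head? := fun z => by
    have := hne z
    cases s <;> cases w <;> simp at this ⊢
  -- the corners of the new directed edges `d` and `e`
  have hρd : (τ * Δ.addRev) d = τ e := rfl
  have hρe : (τ * Δ.addRev) e = τ d := rfl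
  have hdx : ∀ x ∈ (s ++ w).head?, (τ * Δ.addRev).SameCycle d (γ x) := fun x hx => by
    cases s with
    | nil =>
      rw [← Equiv.Perm.sameCycle_apply_left, hρd, hτe e (by simp),
        ← Equiv.Perm.sameCycle_apply_left, hρe, hτd (γ x) (by cases w <;> simp_all)]
    | cons y s =>
      rw [← Equiv.Perm.sameCycle_apply_left, hρd,
        hτe (γ x) (by simpa using congrArg γ (by simpa using hx))]
  have hey : ∀ y ∈ (w ++ s).head?, (τ * Δ.addRev).SameCycle e (γ y) := fun y hy => by
    cases w with
    | nil =>
      rw [← Equiv.Perm.sameCycle_apply_left, hρe, hτd d (by simp),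
        ← Equiv.Perm.sameCycle_apply_left, hρd, hτe (γ y) (by cases s <;> simp_all)]
    | cons x w =>
      rw [← Equiv.Perm.sameCycle_apply_left, hρe,
        hτd (γ y) (by simpa using congrArg γ (by simpa using hy))]
  have hstep : ∀ z, (τ * Δ.addRev).SameCycle (γ z) (γ ((Δ.next * Δ.rev) z)) := fun z => by
    have hz : (τ * Δ.addRev) (γ z) = τ (γ (Δ.rev z)) := rfl
    obtain ⟨⟨x, hx⟩, y, hy⟩ := hhead z
    rw [← Equiv.Perm.sameCycle_apply_left, hz]
    rcases hτ' (Δ.rev z) with h | ⟨h₁, h₂⟩ | ⟨h₁, h₂⟩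
    · rw [h]; exact .refl _ _
    · rw [h₂, Equiv.Perm.mul_apply, h₁ x hx]
      exact hdx x hx
    · rw [h₂, Equiv.Perm.mul_apply, h₁ y hy]
      exact hey y hy
  have hinv : ∀ b, src' ((τ * Δ.addRev) b) = src' b := by
    rintro (z | _ | _)
    · change src' (τ (γ (Δ.rev z))) = Δ.src z
      obtain ⟨⟨x, hx⟩, y, hy⟩ := hhead z
      rcases hτ' (Δ.rev z) with h | ⟨h₁, h₂⟩ | ⟨h₁, h₂⟩
      · rw [h]; exact Δ.src_rotate z
      · rw [h₂, ← Δ.src_rotate z, h₁ x hx, hv x hx]; rfl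
      · rw [h₂, ← Δ.src_rotate z, h₁ y hy, hu y hy]; rfl
    · change src' (τ d) = u
      cases w with
      | nil =>
        rw [hτd d (by simp)]
        cases s with
        | nil => rfl
        | cons x s =>
          change v = u
          rw [← hu x (by simp), hv x (by simp)]
      | cons y w => rw [hτd (γ y) (by simp)]; exact hu y (by simp)
    · change src' (τ e) = v
      cases s with
      | nil =>
        rw [hτe e (by simp)]
        cases w with
        | nil => rfl
        | cons x s =>
          change u = v
          rw [← hu x (by simp), hv x (by simp)]
      | cons y w => rw [hτe (γ y) (by simp)]; exact hv y (by simp)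
  have hsrc := eq_iff_sameCycle (σ := τ * Δ.addRev) (f := src') hinv
    (by
      by_cases hD : Nonempty Δ.D
      · obtain ⟨z₀⟩ := hD
        obtain ⟨⟨x, hx⟩, y, hy⟩ := hhead z₀
        have rep : ∀ b, ∃ z, (τ * Δ.addRev).SameCycle b (γ z) ∧ src' b = Δ.src z := by
          rintro (z | _ | _)
          · exact ⟨z, .refl _ _, rfl⟩
          · exact ⟨y, hey y hy, (hu y hy).symm⟩
          · exact ⟨x, hdx x hx, (hv x hx).symm⟩
        intro b b' h
        obtain ⟨z, hz, hz'⟩ := rep b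
        obtain ⟨z', hbz, hbz'⟩ := rep b'
        rw [hz', hbz'] at h
        exact (hz.trans (((Δ.src_eq_iff z z').1 h).map_of_step fun y _ => hstep y)).trans hbz.symm
      · have hs : s = [] := List.eq_nil_iff_forall_not_mem.2 fun z => (hD ⟨z⟩).elim
        have hde : (τ * Δ.addRev).SameCycle d e := by
          rw [← Equiv.Perm.sameCycle_apply_left, hρd, hτe e (by simp [hs])]
        rintro (z | _ | _) (z' | _ | _) -
        · exact (hD ⟨z⟩).elim
        · exact (hD ⟨z⟩).elim
        · exact (hD ⟨z⟩).elim
        · exact (hD ⟨z'⟩).elim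
        · exact .refl _ _
        · exact hde.symm
        · exact (hD ⟨z'⟩).elim
        · exact hde
        · exact .refl _ _)
  have hmem : ∀ b, b ∈ d :: w.map γ ↔ face' b = none := by
    rintro (z | _ | _)
    · have h₁ := hout z
      have h₂ : z ∈ w → z ∉ s := fun h₁ h₂ => hsw z h₂ z h₁ rfl
      rw [List.mem_append] at h₁
      by_cases hz : z ∈ s
      · simp [hd, γ, face', hz]
        exact fun h => h₂ h hz
      · simp [hd, γ, face', hz] at h₁ ⊢
        exact h₁
    · simp [hd, γ, face']
    · simp [hd, face']
  have hmem₂ : ∀ b, b ∈ s.map γ ++ [e] ↔ face' b = some none := by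
    rintro (z | _ | _)
    · by_cases hz : z ∈ s
      · simp [γ, face', hz]
      · simp [he, γ, face', hz]
    · simp [he, face']
    · simp [he, γ, face']
  have hold : ∀ b, b ∉ d :: w.map γ → b ∉ s.map γ ++ [e] → ∃ z, b = γ z ∧ z ∉ s ++ w := by
    rintro (z | _ | _) h₁ h₂
    · refine ⟨z, rfl, ?_⟩
      simp [hd, he, γ] at h₁ h₂
      simp [h₁, h₂]
    · simp [he] at h₂
    · simp [hd] at h₁
  have hface := eq_iff_sameCycle (σ := τ) (f := face')
    (by
      intro b
      by_cases hb : b ∈ d :: w.map γ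
      · rw [(hmem b).1 hb, (hmem _).1 (hc.apply_mem hb)]
      by_cases hb₂ : b ∈ s.map γ ++ [e]
      · rw [(hmem₂ b).1 hb₂, (hmem₂ _).1 (hc₂.apply_mem hb₂)]
      obtain ⟨z, rfl, hz⟩ := hold b hb hb₂
      have hz' : Δ.next z ∉ s := fun h => hz ((hout z).2
        (Δ.face_next z ▸ (hout _).1 (List.mem_append_left _ h)))
      rw [hτ z hz]
      simp only [List.mem_append, not_or] at hz
      simp [face', γ, hz', hz.1, Δ.face_next])
    (by
      intro b b' h
      by_cases hb : b ∈ d :: w.map γ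
      · exact (hc.mem_iff hb).1 ((hmem _).2 (h ▸ (hmem b).1 hb))
      by_cases hb₂ : b ∈ s.map γ ++ [e]
      · exact (hc₂.mem_iff hb₂).1 ((hmem₂ _).2 (h ▸ (hmem₂ b).1 hb₂))
      obtain ⟨z', rfl, hz'⟩ := hold b' (by rwa [hmem, ← h, ← hmem]) (by rwa [hmem₂, ← h, ← hmem₂])
      obtain ⟨z, rfl, hz⟩ := hold b hb hb₂
      have hzz : Δ.face z = Δ.face z' := by
        simp only [List.mem_append, not_or] at hz hz'
        simpa [face', γ, hz.1, hz'.1, (Option.map_injective (Option.some_injective _)).eq_iff]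
          using h
      refine ((Δ.face_eq_iff z z').1 hzz).map_of_step fun y hy => ?_
      have hy' : y ∉ s ++ w := by
        rwa [hout, ← (Δ.face_eq_iff z y).2 hy, ← hout]
      rw [← hτ y hy', Equiv.Perm.sameCycle_apply_right])
  let lab' : Δ.D ⊕ Bool → A × Bool := Sum.elim lab (fun b => if b then a else invLetter a)
  have hcell₂ : P.IsCell ((s.map γ ++ [e]).map lab') := by
    simpa [lab', he, γ, Function.comp_def] using ha
  refine ⟨{ V := Δ.V, D := Δ.D ⊕ Bool, F := Option Δ.F, src := src', rev := Δ.addRev, next := τ,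
            face := face', rev_rev := ?_, rev_ne := ?_, src_eq_iff := hsrc, face_eq_iff := hface,
            exists_face_eq := ?_, exists_outer := fun _ => ⟨d, rfl⟩, connected := ?_, euler := ?_ },
    v, lab', d :: w.map γ, ⟨?_, ?_⟩, ⟨hc, hmem, ?_⟩, ?_, ?_⟩
  · rintro (z | _ | _)
    · exact congrArg γ (Δ.rev_rev z)
    · rfl
    · rfl
  · rintro (z | _ | _)
    · exact fun h => Δ.rev_ne z (hγ h)
    · simp [addRev]
    · simp [addRev]
  · rintro (_ | f)
    · exact ⟨e, rfl⟩
    · obtain ⟨x, hx⟩ := Δ.exists_face_eq f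
      have hx' : x ∉ s := fun h => by
        have := (hout x).1 (List.mem_append_left _ h)
        simp [hx] at this
      exact ⟨γ x, by simp [face', γ, hx', hx]⟩
  · exact fun u u' => Relation.ReflTransGen.mono (fun a b ⟨x, h₁, h₂⟩ => ⟨γ x, h₁, h₂⟩) _ _
      (Δ.connected u u')
  · have := Δ.euler
    rw [card_add_edge, Finite.card_option]
    omega
  · rintro (z | _ | _)
    · exact hlab.rev_eq z
    · exact (invLetter_invLetter a).symm
    · rfl
  · intro b f hf
    by_cases hb₂ : b ∈ s.map γ ++ [e]
    · exact ⟨_, hb₂, hc₂, hcell₂⟩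
    · have hf' : face' b = some f := hf
      obtain ⟨z, rfl, hz⟩ := hold b (by rw [hmem, hf']; simp) hb₂
      obtain ⟨g, hg⟩ := Option.ne_none_iff_exists'.1 (mt (hout z).2 hz)
      obtain ⟨c, hzc, hcc, hcell⟩ := hlab.cell z g hg
      exact ⟨c.map γ, List.mem_map_of_mem hzc, isCircuit_map_of_face hγ hout hτ hcc hzc hg,
        by rw [List.map_map]; exact hcell⟩
  · intro x hx
    simp only [List.head?_cons, Option.mem_def, Option.some.injEq] at hx
    subst hx; rfl
  · simp [lab', hd, γ]
  · change Nat.card (Option Δ.F) ≤ _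
    rw [Finite.card_option]
    exact Nat.succ_le_succ hn

/-- A word that bounds a diagram in the combinatorial sense bounds a van Kampen diagram. -/
theorem _root_.FinPresentation.Gen.bounds {w : List (A × Bool)} {n : ℕ} (h : P.Gen w n) :
    Bounds P w n := by
  induction h with
  | nil n => exact .nil n
  | @spike u v n a _ ih =>
    have := (ih.rotate.spike a).rotate (u := a :: invLetter a :: v) (w := u)
    simpa using this
  | @cell u s v n a hs _ ih =>
    have h' : Bounds P (s ++ (v ++ u)) n := by simpa using ih.rotate
    simpa using (h'.chord a hs).rotate (u := a :: v) (w := u)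

/-- A labelled diagram as a van Kampen diagram for its boundary word. -/
theorem Bounds.exists_vanKampen {w : List (A × Bool)} {n : ℕ} (h : Bounds P w n) :
    ∃ Δ : P.VanKampenDiagram w, Δ.diag.area ≤ n := by
  obtain ⟨Δ, v, lab, l, h₁, h₂, h₃, h₄⟩ := h
  refine ⟨{ diag := Δ, base := v, label := lab, label_rev := h₁.rev_eq, cell_label := ?_,
            boundary_label := ?_ }, h₄⟩
  · intro x f hf
    obtain ⟨c, hx, hc, hcell⟩ := h₁.cell x f hf
    exact hcell.rotate ((circuit_isRotated hc hx).map lab)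
  · cases l with
    | nil => exact Or.inl ⟨h₂.isPoint, h₃.symm⟩
    | cons x t =>
      refine Or.inr ⟨x, (h₂.2.1 x).1 (by simp), h₂.2.2 x (by simp), ?_⟩
      rw [circuit, h₂.1.iterate_eq, h₃]

end Diagram

/-! ### Deleting an edge -/

/-- The first-return permutation of `τ` to the complement of two points. -/
theorem exists_firstReturn {α : Type*} [Finite α] (τ : Equiv.Perm α) (d e : α) (skp : α → α)
    (hde : ∀ y, y = d ∨ y = e → skp y = τ y) (hskp : ∀ y, ¬ (y = d ∨ y = e) → skp y = y) :
    ∃ ρ : Equiv.Perm {x // x ≠ d ∧ x ≠ e},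
      (∀ x, (ρ x : α) = skp (skp (τ x))) ∧
      ∀ x y : {x // x ≠ d ∧ x ≠ e}, τ.SameCycle (x : α) y → ρ.SameCycle x y := by
  have tri : ∀ x, x ≠ d ∧ x ≠ e →
      (τ x ≠ d ∧ τ x ≠ e) ∧ skp (skp (τ x)) = τ x ∨
      (τ x = d ∨ τ x = e) ∧ (τ (τ x) ≠ d ∧ τ (τ x) ≠ e) ∧ skp (skp (τ x)) = τ (τ x) ∨
      (τ x = d ∨ τ x = e) ∧ (τ (τ x) = d ∨ τ (τ x) = e) ∧
        (τ (τ (τ x)) ≠ d ∧ τ (τ (τ x)) ≠ e) ∧ skp (skp (τ x)) = τ (τ (τ x)) := by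
    intro x hx
    by_cases h₁ : τ x = d ∨ τ x = e
    · by_cases h₂ : τ (τ x) = d ∨ τ (τ x) = e
      · have h₃ : τ x ≠ τ (τ x) := fun h => by
          have := τ.injective h
          rw [← this] at h₁
          tauto
        have h₄ : τ (τ (τ x)) ≠ τ (τ x) := fun h => h₃ (τ.injective h).symm
        have h₅ : τ (τ (τ x)) ≠ τ x := fun h => by
          have := τ.injective h
          rw [this] at h₂
          tauto
        refine Or.inr (Or.inr ⟨h₁, h₂, ?_, by rw [hde _ h₁, hde _ h₂]⟩)
        grind
      · exact Or.inr (Or.inl ⟨h₁, by tauto, by rw [hde _ h₁, hskp _ h₂]⟩)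
    · exact Or.inl ⟨by tauto, by rw [hskp _ h₁, hskp _ h₁]⟩
  have hkeep : ∀ x, x ≠ d ∧ x ≠ e → skp (skp (τ x)) ≠ d ∧ skp (skp (τ x)) ≠ e := by
    intro x hx
    rcases tri x hx with ⟨h, e₁⟩ | ⟨-, h, e₁⟩ | ⟨-, -, h, e₁⟩ <;> rw [e₁] <;> exact h
  have hinj' : ∀ x y, x ≠ d ∧ x ≠ e → y ≠ d ∧ y ≠ e →
      skp (skp (τ x)) = skp (skp (τ y)) → x = y := by
    intro x y hx hy h
    rcases tri x hx with ⟨-, e₁⟩ | ⟨h₁, -, e₁⟩ | ⟨h₁, h₁', -, e₁⟩ <;>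
    rcases tri y hy with ⟨-, e₂⟩ | ⟨h₂, -, e₂⟩ | ⟨h₂, h₂', -, e₂⟩ <;>
    rw [e₁, e₂] at h <;> simp only [EmbeddingLike.apply_eq_iff_eq] at h <;> subst h <;>
    first | rfl | tauto
  let f : {x // x ≠ d ∧ x ≠ e} → {x // x ≠ d ∧ x ≠ e} := fun x => ⟨skp (skp (τ x)), hkeep x x.2⟩
  have hf : Function.Injective f := fun x y h =>
    Subtype.ext (hinj' x y x.2 y.2 (congrArg Subtype.val h))
  let ρ : Equiv.Perm {x // x ≠ d ∧ x ≠ e} :=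
    Equiv.ofBijective f (Finite.injective_iff_bijective.1 hf)
  refine ⟨ρ, fun x => rfl, fun x y hxy => ?_⟩
  have hρ : ∀ z : {x // x ≠ d ∧ x ≠ e}, (ρ z : α) = skp (skp (τ z)) := fun _ => rfl
  -- a deleted point of the cycle is represented by the next point that is kept
  have key := hxy.induct (C := fun b => ∃ z : {x // x ≠ d ∧ x ≠ e}, ρ.SameCycle x z ∧
      (b = z ∨ ((b = d ∨ b = e) ∧ skp (skp b) = ρ z))) ⟨x, .refl _ _, Or.inl rfl⟩
    (by
      rintro b ⟨z, hz, rfl | ⟨hb, hbz⟩⟩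
      · by_cases h : τ z = d ∨ τ z = e
        · exact ⟨z, hz, Or.inr ⟨h, (hρ z).symm⟩⟩
        · refine ⟨ρ z, Equiv.Perm.sameCycle_apply_right.2 hz, Or.inl ?_⟩
          rw [hρ, hskp _ h, hskp _ h]
      · rw [hde b hb] at hbz
        by_cases h : τ b = d ∨ τ b = e
        · refine ⟨z, hz, Or.inr ⟨h, ?_⟩⟩
          rw [hbz]
          exact hskp _ (by have := (ρ z).2; tauto)
        · refine ⟨ρ z, Equiv.Perm.sameCycle_apply_right.2 hz, Or.inl ?_⟩
          rw [← hbz, hskp _ h])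
  obtain ⟨z, hz, h | ⟨h, -⟩⟩ := key
  · exact (Subtype.ext h : y = z) ▸ hz
  · exact absurd h (by have := y.2; tauto)

theorem exists_map_val_eq {α : Type*} {p : α → Prop} {l : List α} (h : ∀ x ∈ l, p x) :
    ∃ m : List {x // p x}, m.map Subtype.val = l :=
  (Set.range_list_map_coe {x | p x}).ge h

namespace Diagram

variable {Δ : Diagram}

theorem skip_of_eq {d y : Δ.D} (h : y = d ∨ y = Δ.rev d) : Δ.skip d y = Δ.next (Δ.rev y) :=
  if_pos h

theorem skip_of_ne {d y : Δ.D} (h : ¬ (y = d ∨ y = Δ.rev d)) : Δ.skip d y = y :=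
  if_neg h

/-- Succession after a deletion, along a stretch of a circuit whose interior avoids the deleted
1-cell. -/
theorem map_skip_of_circuit {d c : Δ.D} {y : Δ.D} {t : List Δ.D}
    (h : (y :: t).map Δ.next = t ++ [c]) (ht : ∀ x ∈ t, ¬ (x = d ∨ x = Δ.rev d)) :
    (y :: t).map (fun x => Δ.skip d (Δ.skip d (Δ.next x))) =
      t ++ [Δ.skip d (Δ.skip d c)] := by
  have : (y :: t).map (fun x => Δ.skip d (Δ.skip d (Δ.next x))) =
      ((y :: t).map Δ.next).map (fun x => Δ.skip d (Δ.skip d x)) := by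
    rw [List.map_map]; rfl
  rw [this, h, List.map_append]
  congr 1
  conv_rhs => rw [← List.map_id t]
  refine List.map_congr_left fun x hx => ?_
  rw [skip_of_ne (ht x hx), skip_of_ne (ht x hx), id]

section

variable {β : Type*} {ι : β → Δ.D} {τ : Equiv.Perm β} {d : Δ.D}

/-- The deletion of a 1-cell between two faces joins the rests of their boundary circuits. -/
theorem isCircuit_merge (hι : Function.Injective ι)
    (hτ : ∀ x, ι (τ x) = Δ.skip d (Δ.skip d (Δ.next (ι x)))) {s t : List Δ.D} {m : List β}
    (ht : IsCircuit Δ.next (d :: t)) (hs : IsCircuit Δ.next (Δ.rev d :: s))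
    (hm : m.map ι = s ++ t) (hr : ∀ x, ι x ≠ d ∧ ι x ≠ Δ.rev d) (hst : (s ++ t).Nodup) :
    IsCircuit τ m := by
  refine ⟨List.Nodup.of_map ι (hm ▸ hst), List.map_injective_iff.2 hι ?_⟩
  have hmem : ∀ x ∈ s ++ t, ¬ (x = d ∨ x = Δ.rev d) := by
    intro x hx
    rw [← hm] at hx
    obtain ⟨b, -, rfl⟩ := List.mem_map.1 hx
    have := hr b
    tauto
  have h₁ : (m.map τ).map ι = (s ++ t).map (fun x => Δ.skip d (Δ.skip d (Δ.next x))) := by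
    rw [← hm, List.map_map, List.map_map]
    exact List.map_congr_left fun x _ => hτ x
  rw [h₁, List.map_rotate, hm]
  have hd : Δ.skip d d = Δ.next (Δ.rev d) := skip_of_eq (Or.inl rfl)
  have he : Δ.skip d (Δ.rev d) = Δ.next d := by
    rw [skip_of_eq (Or.inr rfl), Δ.rev_rev]
  have ht' := ht.2
  have hs' := hs.2
  rw [List.rotate_cons_succ, List.rotate_zero] at ht' hs'
  cases s with
  | nil =>
    cases t with
    | nil => rfl
    | cons y t =>
      simp only [List.nil_append] at hmem ⊢
      simp only [List.cons_append, List.map_cons, List.cons.injEq, List.nil_append, List.map_nil,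
        and_true] at ht' hs'
      rw [map_skip_of_circuit (by simpa using ht'.2) fun x hx => hmem x (by simp [hx])]
      simp [hd, hs', he, ht'.1]
  | cons z s =>
    cases t with
    | nil =>
      simp only [List.append_nil] at hmem ⊢
      simp only [List.cons_append, List.map_cons, List.cons.injEq, List.nil_append, List.map_nil,
        and_true] at ht' hs'
      rw [map_skip_of_circuit (by simpa using hs'.2) fun x hx => hmem x (by simp [hx])]
      simp [hd, hs'.1, he, ht']
    | cons y t =>
      simp only [List.cons_append, List.map_cons, List.cons.injEq] at ht' hs'
      rw [List.map_append,
        map_skip_of_circuit (by simpa using hs'.2) fun x hx => hmem x (by simp [hx]),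
        map_skip_of_circuit (by simpa using ht'.2) fun x hx => hmem x (by simp [hx])]
      rw [hd, he, hs'.1, ht'.1, skip_of_ne (hmem z (by simp)), skip_of_ne (hmem y (by simp))]
      simp

/-- The deletion of a spike. -/
theorem isCircuit_spike (hι : Function.Injective ι)
    (hτ : ∀ x, ι (τ x) = Δ.skip d (Δ.skip d (Δ.next (ι x)))) {t : List Δ.D} {m : List β}
    (ht : IsCircuit Δ.next (d :: Δ.rev d :: t)) (hm : m.map ι = t) : IsCircuit τ m := by
  have hnd := ht.1
  refine ⟨List.Nodup.of_map ι (hm ▸ (List.nodup_cons.1 (List.nodup_cons.1 hnd).2).2),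
    List.map_injective_iff.2 hι ?_⟩
  have hmem : ∀ x ∈ t, ¬ (x = d ∨ x = Δ.rev d) := by
    rintro x hx (rfl | rfl)
    · simp [hx] at hnd
    · simp [hx] at hnd
  have h₁ : (m.map τ).map ι = t.map (fun x => Δ.skip d (Δ.skip d (Δ.next x))) := by
    rw [← hm, List.map_map, List.map_map]
    exact List.map_congr_left fun x _ => hτ x
  rw [h₁, List.map_rotate, hm]
  have hd : Δ.skip d d = Δ.next (Δ.rev d) := skip_of_eq (Or.inl rfl)
  have ht' := ht.2
  rw [List.rotate_cons_succ, List.rotate_zero] at ht'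
  cases t with
  | nil => rfl
  | cons y t =>
    simp only [List.cons_append, List.map_cons, List.cons.injEq] at ht'
    rw [map_skip_of_circuit (by simpa using ht'.2.2) fun x hx => hmem x (by simp [hx]), hd, ht'.2.1,
      skip_of_ne (hmem y (by simp))]
    simp

/-- Circuits that avoid the deleted 1-cell persist. -/
theorem isCircuit_keep (hι : Function.Injective ι)
    (hτ : ∀ x, ι (τ x) = Δ.skip d (Δ.skip d (Δ.next (ι x)))) {c : List Δ.D} {m : List β}
    (hc : IsCircuit Δ.next c) (hm : m.map ι = c) (hr : ∀ x, ι x ≠ d ∧ ι x ≠ Δ.rev d) :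
    IsCircuit τ m := by
  subst hm
  have hstep : ∀ x ∈ m, Δ.next (ι x) = ι (τ x) := by
    intro x hx
    have h := hc.apply_mem (List.mem_map_of_mem hx)
    obtain ⟨y, -, hy⟩ := List.mem_map.1 h
    have hn : ¬ (Δ.next (ι x) = d ∨ Δ.next (ι x) = Δ.rev d) := by
      rw [← hy]; have := hr y; tauto
    rw [hτ, skip_of_ne hn, skip_of_ne hn]
  exact hc.of_map hι hstep

end

/-- A nonempty set of directed edges that is closed under reversal and succession is everything. -/
theorem forall_of_closed {S : Δ.D → Prop} {x : Δ.D} (hx : S x) (hrev : ∀ y, S y → S (Δ.rev y))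
    (hnext : ∀ y, S y → S (Δ.next y)) (y : Δ.D) : S y := by
  have hrot : ∀ y z, S y → Δ.src y = Δ.src z → S z := fun y z hy hyz =>
    ((Δ.src_eq_iff y z).1 hyz).induct hy fun w hw => hnext _ (hrev _ hw)
  have key : ∀ v, Relation.ReflTransGen (fun a b => ∃ x, Δ.src x = a ∧ Δ.src (Δ.rev x) = b)
      (Δ.src x) v → ∀ z, Δ.src z = v → S z := by
    intro v hv
    induction hv with
    | refl => exact fun z hz => hrot x z hx hz.symm
    | tail _ hab ih =>
      obtain ⟨w, hwa, hwb⟩ := hab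
      exact fun z hz => hrot (Δ.rev w) z (hrev _ (ih w hwa)) (hwb.trans hz.symm)
  exact key _ (Δ.connected _ _) y rfl

/-- The directed edges that remain when the 1-cell `d` is deleted. -/
abbrev Kept (Δ : Diagram) (d : Δ.D) : Type := {x : Δ.D // x ≠ d ∧ x ≠ Δ.rev d}

theorem card_kept (Δ : Diagram) (d : Δ.D) : Nat.card (Δ.Kept d) + 2 = Nat.card Δ.D := by
  classical
  have h₁ : Nat.card (Δ.Kept d) = ({d, Δ.rev d}ᶜ : Set Δ.D).ncard := by
    rw [← Nat.card_coe_set_eq]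
    exact Nat.card_congr (Equiv.subtypeEquivRight fun x => by simp)
  have h₂ := Set.ncard_add_ncard_compl ({d, Δ.rev d} : Set Δ.D)
  rw [Set.ncard_pair (Δ.rev_ne d).symm] at h₂
  omega

/-- The directed edges left after the deletion of a 1-cell, with the induced reversal and
succession. The orbits of the rotation remain the sets of directed edges with a common initial
vertex, whatever the 1-cell; the faces have to be treated case by case. -/
theorem exists_deletion (Δ : Diagram) (d : Δ.D) : ∃ rev' next' : Equiv.Perm (Δ.Kept d),
    (∀ x, (rev' x : Δ.D) = Δ.rev x) ∧
    (∀ x, (next' x : Δ.D) = Δ.skip d (Δ.skip d (Δ.next x))) ∧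
    (∀ x, Δ.src ((next' * rev') x : Δ.Kept d) = Δ.src x) ∧
    ∀ x y : Δ.Kept d, Δ.src x = Δ.src y → (next' * rev').SameCycle x y := by
  obtain ⟨ρ, hρ, hρ'⟩ := exists_firstReturn (Δ.next * Δ.rev) d (Δ.rev d) (Δ.skip d)
    (fun y hy => skip_of_eq hy) (fun y hy => skip_of_ne hy)
  have hrev : ∀ x, (x ≠ d ∧ x ≠ Δ.rev d) ↔ (Δ.rev x ≠ d ∧ Δ.rev x ≠ Δ.rev d) := by
    intro x
    have : Δ.rev x = d ↔ x = Δ.rev d := by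
      constructor
      · rintro rfl; rw [Δ.rev_rev]
      · rintro rfl; rw [Δ.rev_rev]
    simp [this, and_comm]
  let rev' : Equiv.Perm (Δ.Kept d) := Δ.rev.subtypePerm (fun x => (hrev x).symm)
  have hrr : rev' * rev' = 1 := Equiv.ext fun x => Subtype.ext (Δ.rev_rev x)
  have hmul : (ρ * rev') * rev' = ρ := by rw [mul_assoc, hrr, mul_one]
  refine ⟨rev', ρ * rev', fun x => rfl, fun x => ?_, fun x => ?_, fun x y h => ?_⟩
  · rw [Equiv.Perm.mul_apply, hρ, Equiv.Perm.mul_apply]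
    change Δ.skip d (Δ.skip d (Δ.next (Δ.rev (Δ.rev x)))) = _
    rw [Δ.rev_rev]
  · have hs : ∀ y, Δ.src (Δ.skip d y) = Δ.src y := by
      intro y
      by_cases h : y = d ∨ y = Δ.rev d
      · rw [skip_of_eq h, src_rotate]
      · rw [skip_of_ne h]
    rw [hmul, hρ, hs, hs]
    exact Δ.src_rotate x
  · rw [hmul]
    exact hρ' x y ((Δ.src_eq_iff _ _).1 h)

theorem Kept.not_eq {d : Δ.D} (x : Δ.Kept d) : ¬ ((x : Δ.D) = d ∨ (x : Δ.D) = Δ.rev d) := by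
  have := x.2
  tauto

theorem nodup_of_circuits {d : Δ.D} {s t : List Δ.D} (ht : IsCircuit Δ.next (d :: t))
    (hs : IsCircuit Δ.next (Δ.rev d :: s)) (hf : Δ.face d ≠ Δ.face (Δ.rev d)) :
    (s ++ t).Nodup ∧ ∀ x ∈ s ++ t, x ≠ d ∧ x ≠ Δ.rev d := by
  have hmt : ∀ x ∈ t, Δ.face d = Δ.face x := fun x hx =>
    (mem_circuit ht (by simp)).1 (List.mem_cons_of_mem _ hx)
  have hms : ∀ x ∈ s, Δ.face (Δ.rev d) = Δ.face x := fun x hx =>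
    (mem_circuit hs (by simp)).1 (List.mem_cons_of_mem _ hx)
  have ht' := List.nodup_cons.1 ht.1
  have hs' := List.nodup_cons.1 hs.1
  refine ⟨List.nodup_append.2 ⟨hs'.2, ht'.2, fun a ha b hb hab => ?_⟩, fun x hx => ?_⟩
  · subst hab
    exact hf ((hmt a hb).trans (hms a ha).symm)
  · rcases List.mem_append.1 hx with hx | hx
    · refine ⟨?_, ?_⟩
      · rintro rfl; exact hf (hms x hx).symm
      · rintro rfl; exact hs'.1 hx
    · refine ⟨?_, ?_⟩
      · rintro rfl; exact ht'.1 hx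
      · rintro rfl; exact hf (hmt _ hx)

end Diagram

/-! ### Collapses exist -/

namespace Diagram

variable {Δ : Diagram}

/-- The ends of a 1-cell stay connected after its deletion, by way of the rest of the cell behind
it. -/
theorem connected_of_face {d : Δ.D} {s : List Δ.D} (hs : IsCircuit Δ.next (Δ.rev d :: s))
    (hkeep : ∀ x ∈ s, x ≠ d ∧ x ≠ Δ.rev d) :
    Relation.ReflTransGen (fun a b => ∃ x : Δ.Kept d, Δ.src x = a ∧ Δ.src (Δ.rev x) = b)
      (Δ.src d) (Δ.src (Δ.rev d)) := by
  have hc := (IsCircuit.cons_iff.1 hs).2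
  have key : ∀ (s : List Δ.D) (c : Δ.D), (c :: (s ++ [Δ.rev d])).IsChain (fun a b => Δ.next a = b) →
      (∀ x ∈ s, x ≠ d ∧ x ≠ Δ.rev d) →
      Relation.ReflTransGen (fun a b => ∃ x : Δ.Kept d, Δ.src x = a ∧ Δ.src (Δ.rev x) = b)
      (Δ.src (Δ.rev c)) (Δ.src (Δ.rev d)) := by
    intro s
    induction s with
    | nil =>
      intro c h _
      simp only [List.nil_append, List.isChain_cons_cons, List.isChain_singleton, and_true] at h
      rw [← src_next, h]
    | cons y s ih =>
      intro c h hk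
      rw [List.cons_append, List.isChain_cons_cons] at h
      refine .head ⟨⟨y, hk y (by simp)⟩, ?_, rfl⟩ (ih y h.2 fun x hx => hk x (by simp [hx]))
      change Δ.src y = _
      rw [← h.1, src_next]
  have := key s (Δ.rev d) hc hkeep
  rwa [Δ.rev_rev] at this

theorem reflTransGen_symm {d : Δ.D} {a b : Δ.V}
    (h : Relation.ReflTransGen (fun a b => ∃ x : Δ.Kept d, Δ.src x = a ∧ Δ.src (Δ.rev x) = b) a b) :
    Relation.ReflTransGen (fun a b => ∃ x : Δ.Kept d, Δ.src x = a ∧ Δ.src (Δ.rev x) = b) b a := by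
  induction h with
  | refl => exact .refl
  | tail _ hab ih =>
    obtain ⟨x, h₁, h₂⟩ := hab
    have hx : Δ.rev x ≠ d ∧ Δ.rev x ≠ Δ.rev d :=
      ⟨fun h => x.2.2 ((Δ.rev_rev x).symm.trans (congrArg Δ.rev h)),
        fun h => x.2.1 (Δ.rev.injective h)⟩
    exact .head ⟨⟨Δ.rev x, hx⟩, h₂, by rw [Δ.rev_rev]; exact h₁⟩ ih

theorem next_kept {β : Type*} {ι : β → Δ.D} {τ : β → β} {d : Δ.D}
    (hτ : ∀ x, ι (τ x) = Δ.skip d (Δ.skip d (Δ.next (ι x)))) {x : β}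
    (h : ¬ (Δ.next (ι x) = d ∨ Δ.next (ι x) = Δ.rev d)) : ι (τ x) = Δ.next (ι x) := by
  rw [hτ, skip_of_ne h, skip_of_ne h]

theorem card_ne {α : Type*} [Finite α] (a : α) : Nat.card {x // x ≠ a} + 1 = Nat.card α := by
  have h := Set.ncard_add_ncard_compl ({a} : Set α)
  rw [Set.ncard_singleton, ← Nat.card_coe_set_eq] at h
  have : Nat.card {x // x ≠ a} = Nat.card ({a}ᶜ : Set α) :=
    Nat.card_congr (Equiv.subtypeEquivRight fun x => by simp)
  omega

open Classical in
/-- The 2-cells other than `f`; the cell `f` becomes part of the exterior. -/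
noncomputable def restrictFace (f : Δ.F) (o : Option Δ.F) : Option {g : Δ.F // g ≠ f} :=
  o.bind fun g => if h : g = f then none else some ⟨g, h⟩

open Classical in
theorem map_restrictFace (f : Δ.F) (o : Option Δ.F) :
    (restrictFace f o).map Subtype.val = if o = some f then none else o := by
  cases o with
  | none => simp [restrictFace]
  | some g =>
    by_cases h : g = f
    · simp [restrictFace, h]
    · simp [restrictFace, h]

theorem restrictFace_eq_none {f : Δ.F} {o : Option Δ.F} :
    restrictFace f o = none ↔ o = none ∨ o = some f := by
  cases o with
  | none => simp [restrictFace]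
  | some g => by_cases h : g = f <;> simp [restrictFace, h]

theorem eq_of_restrictFace {f : Δ.F} {o o' : Option Δ.F} (h : restrictFace f o = restrictFace f o')
    (ho : restrictFace f o ≠ none) : o = o' := by
  have h₁ := ho
  rw [Ne, restrictFace_eq_none, not_or] at h₁
  have h₂ : restrictFace f o' ≠ none := h ▸ ho
  rw [Ne, restrictFace_eq_none, not_or] at h₂
  have := congrArg (Option.map Subtype.val) h
  rwa [map_restrictFace, map_restrictFace, if_neg h₁.2, if_neg h₂.2] at this

/-- A 1-cell between a 2-cell and the exterior can be removed together with the 2-cell. -/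
theorem exists_collapse₂ {d : Δ.D} {f : Δ.F} (hd : Δ.face d = none)
    (he : Δ.face (Δ.rev d) = some f) :
    ∃ (Δ' : Diagram) (ρ : Δ'.V → Δ.V), Collapse₂ Δ Δ' ρ ∧ Nat.card Δ'.D + 2 = Nat.card Δ.D := by
  obtain ⟨t, ht⟩ := exists_circuit d
  obtain ⟨s, hs⟩ := exists_circuit (Δ.rev d)
  obtain ⟨hnd, hkeep⟩ := nodup_of_circuits ht hs (by rw [hd, he]; simp)
  obtain ⟨m, hm⟩ := exists_map_val_eq hkeep
  obtain ⟨rev', next', hrev, hnext, hsrc₁, hsrc₂⟩ := exists_deletion Δ d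
  have hval : Function.Injective (Subtype.val : Δ.Kept d → Δ.D) := Subtype.val_injective
  have hmc : IsCircuit next' m := isCircuit_merge hval hnext ht hs hm (fun x => x.2) hnd
  let face' : Δ.Kept d → Option {g : Δ.F // g ≠ f} := fun x => restrictFace f (Δ.face x)
  have hmem : ∀ x, x ∈ m ↔ face' x = none := by
    intro x
    have h₁ : x ∈ m ↔ (x : Δ.D) ∈ s ++ t := by
      rw [← hm, List.mem_map_of_injective hval]
    have h₂ := mem_circuit ht (y := x) (List.mem_cons_self ..)
    have h₃ := mem_circuit hs (y := x) (List.mem_cons_self ..)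
    rw [List.mem_cons, or_iff_right x.2.1, hd] at h₂
    rw [List.mem_cons, or_iff_right x.2.2, he] at h₃
    rw [h₁, List.mem_append, h₂, h₃, restrictFace_eq_none, or_comm, eq_comm, @eq_comm _ (some f)]
  have hnot : ∀ x : Δ.Kept d, face' x ≠ none →
      ¬ (Δ.next x = d ∨ Δ.next x = Δ.rev d) := by
    rintro x hx (h | h)
    · exact hx (restrictFace_eq_none.2 (Or.inl (by rw [← Δ.face_next, h, hd])))
    · exact hx (restrictFace_eq_none.2 (Or.inr (by rw [← Δ.face_next, h, he])))
  have hface := eq_iff_sameCycle (σ := next') (f := face')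
    (by
      intro x
      by_cases hx : face' x = none
      · rw [hx, ← hmem]
        exact hmc.apply_mem ((hmem x).2 hx)
      · have := next_kept (ι := Subtype.val) (τ := next') hnext (hnot x hx)
        change restrictFace f (Δ.face (next' x)) = _
        rw [this, face_next])
    (by
      intro x y hxy
      by_cases hx : face' x = none
      · exact (hmc.mem_iff ((hmem x).2 hx)).1 ((hmem y).2 (hxy ▸ hx))
      · have hxy' : Δ.face x = Δ.face y := eq_of_restrictFace hxy hx
        obtain ⟨c, hc⟩ := exists_circuit (x : Δ.D)
        have hck : ∀ z ∈ (x : Δ.D) :: c, z ≠ d ∧ z ≠ Δ.rev d := by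
          intro z hz
          have hz' := (mem_circuit hc List.mem_cons_self).1 hz
          have hx' := hx
          rw [restrictFace_eq_none, not_or, hz'] at hx'
          exact ⟨fun h => hx'.1 (h ▸ hd), fun h => hx'.2 (h ▸ he)⟩
        obtain ⟨c', hc'⟩ := exists_map_val_eq hck
        have hcc := isCircuit_keep hval hnext hc hc' (fun x => x.2)
        have hx' : x ∈ c' := by
          rw [← List.mem_map_of_injective hval, hc']; simp
        refine (hcc.mem_iff hx').1 ?_
        rw [← List.mem_map_of_injective hval, hc', mem_circuit hc List.mem_cons_self]
        exact hxy')
  have hlink := connected_of_face hs fun x hx => hkeep x (List.mem_append_left _ hx)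
  have hconn : ∀ u v, Relation.ReflTransGen
      (fun a b => ∃ x : Δ.Kept d, Δ.src x = a ∧ Δ.src (rev' x) = b) u v := by
    intro u v
    simp only [hrev]
    induction Δ.connected u v with
    | refl => exact .refl
    | tail _ hab ih =>
      obtain ⟨x, rfl, rfl⟩ := hab
      refine ih.trans ?_
      by_cases h₁ : x = d
      · subst h₁; exact hlink
      by_cases h₂ : x = Δ.rev d
      · subst h₂; rw [Δ.rev_rev]; exact reflTransGen_symm hlink
      exact .single ⟨⟨x, h₁, h₂⟩, rfl, rfl⟩
  have hcard := Δ.card_kept d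
  have heuler : 2 * Nat.card Δ.V + 2 * (Nat.card {g : Δ.F // g ≠ f} + 1) =
      Nat.card (Δ.Kept d) + 4 := by
    have h₁ := Δ.euler
    have h₂ := card_ne f
    omega
  have hout : Nonempty (Δ.Kept d) → ∃ x, face' x = none := by
    rintro ⟨z⟩
    by_contra hno
    have hm' : m = [] := by
      cases m with
      | nil => rfl
      | cons x m => exact (hno ⟨x, (hmem x).1 (by simp)⟩).elim
    rw [hm', List.map_nil, eq_comm, List.append_eq_nil_iff] at hm
    obtain ⟨rfl, rfl⟩ := hm
    refine Kept.not_eq z (forall_of_closed (S := fun y => y = d ∨ y = Δ.rev d) (Or.inl rfl) ?_ ?_ z)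
    · rintro y (rfl | rfl)
      · exact Or.inr rfl
      · exact Or.inl (Δ.rev_rev _)
    · rintro y (rfl | rfl)
      · exact Or.inl ht.apply_singleton
      · exact Or.inr hs.apply_singleton
  refine ⟨{ V := Δ.V, D := Δ.Kept d, F := {g : Δ.F // g ≠ f}, src := fun x => Δ.src x, rev := rev',
            next := next', face := face',
            rev_rev := fun x => Subtype.ext (by rw [hrev, hrev, Δ.rev_rev])
            rev_ne := fun x h => Δ.rev_ne x (by rw [← hrev, h])
            src_eq_iff := eq_iff_sameCycle (f := fun x : Δ.Kept d => Δ.src x) hsrc₁ hsrc₂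
            face_eq_iff := hface, exists_face_eq := ?_, exists_outer := hout, connected := hconn,
            euler := heuler },
    id, ⟨d, f, Subtype.val, Subtype.val, hd, he, ⟨Function.injective_id, hval, ?_, fun _ => rfl,
      fun x => (hrev x).symm, hnext⟩, Function.surjective_id, Subtype.val_injective, ?_, ?_⟩, hcard⟩
  · rintro ⟨g, hg⟩
    obtain ⟨x, hx⟩ := Δ.exists_face_eq g
    refine ⟨⟨x, ?_, ?_⟩, ?_⟩
    · rintro rfl; simp [hd] at hx
    · rintro rfl; rw [he] at hx; exact hg (Option.some.inj hx).symm
    · simp [face', hx, restrictFace, hg]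
  · ext x
    simp [not_or]
  · ext x
    simp
  · intro x
    exact map_restrictFace f _

theorem exists_circuit_spike {d : Δ.D} (h : Δ.next d = Δ.rev d) :
    ∃ t, IsCircuit Δ.next (d :: Δ.rev d :: t) := by
  obtain ⟨t, ht⟩ := exists_circuit d
  cases t with
  | nil => exact absurd (h ▸ ht.apply_singleton) (Δ.rev_ne d)
  | cons y t =>
    have := ht.apply_cons_cons
    rw [h] at this
    exact ⟨t, this ▸ ht⟩

/-- An exterior spike can be removed. -/
theorem exists_collapse₁ {d : Δ.D} (hd : Δ.face d = none) (hspike : Δ.next d = Δ.rev d) :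
    ∃ (Δ' : Diagram) (ρ : Δ'.V → Δ.V), Collapse₁ Δ Δ' ρ ∧
      Set.range ρ = {Δ.src (Δ.rev d)}ᶜ ∧ Nat.card Δ'.D + 2 = Nat.card Δ.D := by
  obtain ⟨t, ht⟩ := exists_circuit_spike hspike
  have he : Δ.face (Δ.rev d) = none := by rw [← hspike, face_next, hd]
  have hkeep : ∀ x ∈ t, x ≠ d ∧ x ≠ Δ.rev d := by
    have := ht.1
    simp only [List.nodup_cons, List.mem_cons, not_or] at this
    rintro x hx
    exact ⟨fun h => this.1.2 (h ▸ hx), fun h => this.2.1 (h ▸ hx)⟩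
  obtain ⟨m, hm⟩ := exists_map_val_eq hkeep
  obtain ⟨rev', next', hrev, hnext, hsrc₁, hsrc₂⟩ := exists_deletion Δ d
  have hval : Function.Injective (Subtype.val : Δ.Kept d → Δ.D) := Subtype.val_injective
  have hmc : IsCircuit next' m := isCircuit_spike hval hnext ht hm
  let face' : Δ.Kept d → Option Δ.F := fun x => Δ.face x
  have hmem : ∀ x, x ∈ m ↔ face' x = none := by
    intro x
    have h₁ : x ∈ m ↔ (x : Δ.D) ∈ t := by
      rw [← hm, List.mem_map_of_injective hval]
    have h₂ := mem_circuit ht (y := x) (List.mem_cons_self ..)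
    rw [List.mem_cons, or_iff_right x.2.1, List.mem_cons, or_iff_right x.2.2, hd] at h₂
    rw [h₁, h₂, eq_comm]
  have hnot : ∀ x : Δ.Kept d, face' x ≠ none →
      ¬ (Δ.next x = d ∨ Δ.next x = Δ.rev d) := by
    rintro x hx (h | h)
    · exact hx (by change Δ.face x = _; rw [← Δ.face_next, h, hd])
    · exact hx (by change Δ.face x = _; rw [← Δ.face_next, h, he])
  have hface := eq_iff_sameCycle (σ := next') (f := face')
    (by
      intro x
      by_cases hx : face' x = none
      · rw [hx, ← hmem]
        exact hmc.apply_mem ((hmem x).2 hx)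
      · have := next_kept (ι := Subtype.val) (τ := next') hnext (hnot x hx)
        change Δ.face (next' x) = _
        rw [this, face_next])
    (by
      intro x y hxy
      by_cases hx : face' x = none
      · exact (hmc.mem_iff ((hmem x).2 hx)).1 ((hmem y).2 (hxy ▸ hx))
      · obtain ⟨c, hc⟩ := exists_circuit (x : Δ.D)
        have hck : ∀ z ∈ (x : Δ.D) :: c, z ≠ d ∧ z ≠ Δ.rev d := by
          intro z hz
          have hz' := (mem_circuit hc List.mem_cons_self).1 hz
          have hx' : Δ.face x ≠ none := hx
          rw [hz'] at hx'
          exact ⟨fun h => hx' (h ▸ hd), fun h => hx' (h ▸ he)⟩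
        obtain ⟨c', hc'⟩ := exists_map_val_eq hck
        have hcc := isCircuit_keep hval hnext hc hc' (fun x => x.2)
        have hx' : x ∈ c' := by
          rw [← List.mem_map_of_injective hval, hc']; simp
        refine (hcc.mem_iff hx').1 ?_
        rw [← List.mem_map_of_injective hval, hc', mem_circuit hc List.mem_cons_self]
        exact hxy)
  -- the terminal vertex of the spike has no other edge
  have hleaf : ∀ x, Δ.src x = Δ.src (Δ.rev d) → x = Δ.rev d := by
    intro x hx
    refine ((Δ.src_eq_iff _ _).1 hx.symm).induct (C := fun z => z = Δ.rev d) rfl ?_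
    rintro z rfl
    rw [Equiv.Perm.mul_apply, Δ.rev_rev, hspike]
  have hsd : Δ.src d ≠ Δ.src (Δ.rev d) := fun h => Δ.rev_ne d (hleaf d h).symm
  let V' := {v : Δ.V // v ≠ Δ.src (Δ.rev d)}
  let src' : Δ.Kept d → V' := fun x => ⟨Δ.src x, fun h => x.2.2 (hleaf x h)⟩
  have hsrc := eq_iff_sameCycle (σ := next' * rev') (f := src')
    (fun x => Subtype.ext (hsrc₁ x)) (fun x y h => hsrc₂ x y (congrArg Subtype.val h))
  classical
  let r : Δ.V → V' := fun v => if h : v = Δ.src (Δ.rev d) then ⟨Δ.src d, hsd⟩ else ⟨v, h⟩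
  have hr : ∀ v : V', r v = v := fun v => dif_neg v.2
  have hr₁ : r (Δ.src (Δ.rev d)) = ⟨Δ.src d, hsd⟩ := dif_pos rfl
  have hr₂ : r (Δ.src d) = ⟨Δ.src d, hsd⟩ := dif_neg hsd
  have hconn : ∀ u v : V', Relation.ReflTransGen
      (fun a b => ∃ x : Δ.Kept d, src' x = a ∧ src' (rev' x) = b) u v := by
    suffices key : ∀ u v : Δ.V, Relation.ReflTransGen
        (fun a b => ∃ x : Δ.Kept d, src' x = a ∧ src' (rev' x) = b) (r u) (r v) from
      fun u v => by rw [← hr u, ← hr v]; exact key u v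
    intro u v
    induction Δ.connected u v with
    | refl => exact .refl
    | tail _ hab ih =>
      obtain ⟨x, rfl, rfl⟩ := hab
      refine ih.trans ?_
      by_cases h₁ : x = d
      · subst h₁; rw [hr₁, hr₂]
      by_cases h₂ : x = Δ.rev d
      · subst h₂; rw [Δ.rev_rev, hr₁, hr₂]
      refine .single ⟨⟨x, h₁, h₂⟩, (hr (src' ⟨x, h₁, h₂⟩)).symm, ?_⟩
      refine (hr (src' (rev' ⟨x, h₁, h₂⟩))).symm.trans ?_
      change r (Δ.src (rev' ⟨x, h₁, h₂⟩)) = _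
      rw [hrev]
  have hcard := Δ.card_kept d
  have heuler : 2 * Nat.card V' + 2 * (Nat.card Δ.F + 1) = Nat.card (Δ.Kept d) + 4 := by
    have h₁ := Δ.euler
    have h₂ : Nat.card V' + 1 = Nat.card Δ.V := card_ne (Δ.src (Δ.rev d))
    omega
  have hout : Nonempty (Δ.Kept d) → ∃ x, face' x = none := by
    rintro ⟨z⟩
    by_contra hno
    have hm' : m = [] := by
      cases m with
      | nil => rfl
      | cons x m => exact (hno ⟨x, (hmem x).1 (by simp)⟩).elim
    rw [hm', List.map_nil] at hm
    subst hm
    refine Kept.not_eq z (forall_of_closed (S := fun y => y = d ∨ y = Δ.rev d) (Or.inl rfl) ?_ ?_ z)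
    · rintro y (rfl | rfl)
      · exact Or.inr rfl
      · exact Or.inl (Δ.rev_rev _)
    · rintro y (rfl | rfl)
      · exact Or.inr hspike
      · exact Or.inl (IsCircuit.apply_last (t := []) ht)
  refine ⟨{ V := V', D := Δ.Kept d, F := Δ.F, src := src', rev := rev', next := next',
            face := face',
            rev_rev := fun x => Subtype.ext (by rw [hrev, hrev, Δ.rev_rev])
            rev_ne := fun x h => Δ.rev_ne x (by rw [← hrev, h])
            src_eq_iff := hsrc, face_eq_iff := hface, exists_face_eq := ?_, exists_outer := hout,
            connected := hconn, euler := heuler },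
    Subtype.val, ⟨d, Subtype.val, Equiv.refl _, hd, hspike, ⟨Subtype.val_injective, hval, ?_,
      fun _ => rfl, fun x => (hrev x).symm, hnext⟩, ?_, ?_⟩, ?_, hcard⟩
  · intro g
    obtain ⟨x, hx⟩ := Δ.exists_face_eq g
    refine ⟨⟨x, ?_, ?_⟩, hx⟩
    · rintro rfl; simp [hd] at hx
    · rintro rfl; simp [he] at hx
  · ext x
    simp [not_or]
  · ext x
    simp [V']
  · intro x
    simp [face']
  · ext x
    simp [V']

/-- In a diagram without 2-cells, a tree, some leaf is not the base vertex. -/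
theorem exists_spike (hD : Nonempty Δ.D) (hall : ∀ x, Δ.face x = none) (v : Δ.V) :
    ∃ d, Δ.next d = Δ.rev d ∧ Δ.src (Δ.rev d) ≠ v := by
  classical
  have hF : Nat.card Δ.F = 0 := by
    have : IsEmpty Δ.F := ⟨fun f => by
      obtain ⟨x, hx⟩ := Δ.exists_face_eq f
      simp [hall] at hx⟩
    exact Nat.card_of_isEmpty
  have heuler := Δ.euler
  rw [hF] at heuler
  by_contra hno
  push Not at hno
  have := Fintype.ofFinite Δ.V
  have := Fintype.ofFinite Δ.D
  -- a vertex other than `v` is the initial vertex of at least two directed edges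
  have hdeg : ∀ u, u ≠ v → 2 ≤ (Finset.univ.filter fun x => Δ.src x = u).card := by
    intro u hu
    obtain ⟨x, hx⟩ : ∃ x, Δ.src x = u := by
      rcases (Δ.connected u v).cases_head with h | ⟨c, ⟨x, hx, -⟩, -⟩
      · exact (hu h).elim
      · exact ⟨x, hx⟩
    have hne : Δ.next (Δ.rev x) ≠ x := fun h =>
      hu (by
        have := hno (Δ.rev x) (by rw [h, Δ.rev_rev])
        rwa [Δ.rev_rev, hx] at this)
    have hsub : ({Δ.next (Δ.rev x), x} : Finset Δ.D) ⊆ Finset.univ.filter fun x => Δ.src x = u := by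
      intro y hy
      rw [Finset.mem_insert, Finset.mem_singleton] at hy
      rcases hy with rfl | rfl
      · simp [src_rotate, hx]
      · simp [hx]
    calc 2 = ({Δ.next (Δ.rev x), x} : Finset Δ.D).card := (Finset.card_pair hne).symm
      _ ≤ _ := Finset.card_le_card hsub
  have hV : 2 ≤ Nat.card Δ.V := by
    have h₁ : 0 < Nat.card Δ.D := Nat.card_pos
    omega
  -- the base vertex is the initial vertex of at least one
  have hdeg' : 1 ≤ (Finset.univ.filter fun x => Δ.src x = v).card := by
    have : Nontrivial Δ.V := Finite.one_lt_card_iff_nontrivial.1 (by omega)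
    obtain ⟨u, hu⟩ := exists_ne v
    rcases (Δ.connected v u).cases_head with h | ⟨c, ⟨x, hx, -⟩, -⟩
    · exact (hu h.symm).elim
    · exact Finset.card_pos.2 ⟨x, by simp [hx]⟩
  have hsum : Nat.card Δ.D = ∑ u, (Finset.univ.filter fun x => Δ.src x = u).card := by
    rw [Nat.card_eq_fintype_card, ← Finset.card_univ]
    exact Finset.card_eq_sum_card_fiberwise fun x _ => by simp
  rw [← Finset.add_sum_erase _ _ (Finset.mem_univ v)] at hsum
  have hle := Finset.card_nsmul_le_sum (Finset.univ.erase v)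
    (fun u => (Finset.univ.filter fun x => Δ.src x = u).card) 2
    fun u hu => hdeg u (Finset.ne_of_mem_erase hu)
  rw [Finset.card_erase_of_mem (Finset.mem_univ v), Finset.card_univ, ← Nat.card_eq_fintype_card,
    smul_eq_mul] at hle
  omega

end Diagram

/-- A diagram that is not a single vertex admits a collapse that preserves the base vertex: a
2-cell collapse, or else the diagram is a tree and has a leaf away from the base vertex. -/
theorem PointedDiagram.exists_step (Δ : PointedDiagram) (h : ¬ Δ.diag.IsPoint) :
    ∃ Δ' : PointedDiagram, Δ.Step Δ' ∧ Nat.card Δ'.diag.D < Nat.card Δ.diag.D := by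
  have hD : Nonempty Δ.diag.D := not_isEmpty_iff.1 h
  by_cases hex : ∃ d f, Δ.diag.face d = none ∧ Δ.diag.face (Δ.diag.rev d) = some f
  · obtain ⟨d, f, hd, he⟩ := hex
    obtain ⟨Δ', ρ, hc, hcard⟩ := Diagram.exists_collapse₂ hd he
    have hsurj : Function.Surjective ρ := by
      obtain ⟨_, _, _, _, _, _, _, h, _⟩ := hc
      exact h
    obtain ⟨b, hb⟩ := hsurj Δ.base
    exact ⟨⟨Δ', b⟩, ⟨ρ, Or.inr (Or.inl hc), hb⟩, by change Nat.card Δ'.D < _; omega⟩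
  · push Not at hex
    have hrev : ∀ x, Δ.diag.face x = none → Δ.diag.face (Δ.diag.rev x) = none := fun x hx =>
      Option.eq_none_iff_forall_ne_some.2 fun f => hex x f hx
    obtain ⟨x₀, hx₀⟩ := Δ.diag.exists_outer hD
    have hall : ∀ x, Δ.diag.face x = none :=
      Diagram.forall_of_closed hx₀ hrev fun y hy => by rw [Diagram.face_next, hy]
    obtain ⟨d, hd, hne⟩ := Diagram.exists_spike hD hall Δ.base
    obtain ⟨Δ', ρ, hc, hr, hcard⟩ := Diagram.exists_collapse₁ (hall d) hd
    obtain ⟨b, hb⟩ : Δ.base ∈ Set.range ρ := by rw [hr]; exact hne.symm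
    exact ⟨⟨Δ', b⟩, ⟨ρ, Or.inl hc, hb⟩, by change Nat.card Δ'.D < _; omega⟩

/-! ### Lengths of shellings -/

section MinMax

variable {X : Type*} {step : X → X → Prop} {done : X → Prop} {len : X → ℕ}

/-- There is a finite sequence from `x` to a `done` state of states of length at most `L`. -/
def HasSequence (step : X → X → Prop) (done : X → Prop) (len : X → ℕ) (x : X) (L : ℕ) : Prop :=
  ∃ (m : ℕ) (s : ℕ → X), s 0 = x ∧ done (s m) ∧ (∀ i < m, step (s i) (s (i + 1))) ∧
    ∀ i ≤ m, len (s i) ≤ L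

theorem HasSequence.mono {x : X} {L K : ℕ} (h : HasSequence step done len x L) (hLK : L ≤ K) :
    HasSequence step done len x K := by
  obtain ⟨m, s, h₀, h₁, h₂, h₃⟩ := h
  exact ⟨m, s, h₀, h₁, h₂, fun i hi => (h₃ i hi).trans hLK⟩

theorem HasSequence.cons {x y : X} {L : ℕ} (hxy : step x y) (hx : len x ≤ L)
    (h : HasSequence step done len y L) : HasSequence step done len x L := by
  obtain ⟨m, s, rfl, h₁, h₂, h₃⟩ := h
  refine ⟨m + 1, fun i => i.casesOn x s, rfl, h₁, fun i hi => ?_, fun i hi => ?_⟩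
  · cases i with
    | zero => exact hxy
    | succ i => exact h₂ i (by omega)
  · cases i with
    | zero => exact hx
    | succ i => exact h₃ i (by omega)

theorem minMaxLength_le_iff {x : X} {L : ℕ} :
    minMaxLength step done len x ≤ L ↔ HasSequence step done len x L := by
  constructor
  · intro h
    by_contra hno
    have : ((L + 1 : ℕ) : ℕ∞) ≤ minMaxLength step done len x :=
      le_iInf₂ fun K hK => by
        rw [Nat.cast_le]
        by_contra hlt
        exact hno (HasSequence.mono hK (by omega))
    have := this.trans h
    rw [Nat.cast_le] at this
    omega
  · exact fun h => iInf₂_le (f := fun (L : ℕ) (_ : HasSequence step done len x L) => (L : ℕ∞)) L h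

theorem minMaxLength_map_le {Y : Type*} {step' : Y → Y → Prop} {done' : Y → Prop} {len' : Y → ℕ}
    (f : X → Y) (hstep : ∀ a b, step a b → step' (f a) (f b)) (hdone : ∀ a, done a → done' (f a))
    (hlen : ∀ a, len' (f a) = len a) (x : X) :
    minMaxLength step' done' len' (f x) ≤ minMaxLength step done len x := by
  refine le_iInf₂ fun L hL => minMaxLength_le_iff.2 ?_
  obtain ⟨m, s, rfl, h₁, h₂, h₃⟩ := hL
  exact ⟨m, fun i => f (s i), rfl, hdone _ h₁, fun i hi => hstep _ _ (h₂ i hi),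
    fun i hi => (hlen _).trans_le (h₃ i hi)⟩

end MinMax

namespace Diagram

theorem perimeter_le_card (Δ : Diagram) : Δ.perimeter ≤ Nat.card Δ.D :=
  Nat.card_le_card_of_injective _ Subtype.val_injective

/-- Collapses alone shell a diagram, and never increase the number of directed edges. -/
theorem fillingLength_le_card (Δ : PointedDiagram) :
    fillingLength Δ ≤ (Nat.card Δ.diag.D : ℕ∞) := by
  suffices key : ∀ (k : ℕ) (Δ : PointedDiagram), Nat.card Δ.diag.D = k →
      HasSequence PointedDiagram.Step (fun Θ => Θ.diag.IsPoint) (fun Θ => Θ.diag.perimeter) Δ k from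
    minMaxLength_le_iff.2 (key _ Δ rfl)
  intro k
  induction k using Nat.strong_induction_on with
  | _ k ih =>
    intro Δ hk
    have hper := Δ.diag.perimeter_le_card.trans_eq hk
    by_cases h : Δ.diag.IsPoint
    · exact ⟨0, fun _ => Δ, rfl, h, by simp, fun _ _ => hper⟩
    · obtain ⟨Δ', hs, hlt⟩ := Δ.exists_step h
      exact .cons hs hper ((ih _ (hk ▸ hlt) Δ' rfl).mono (by omega))

theorem freeFillingLength_le (Δ : PointedDiagram) :
    freeFillingLength Δ.diag ≤ fillingLength Δ :=
  minMaxLength_map_le (fun Θ : PointedDiagram => Θ.diag)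
    (fun _ _ ⟨ρ, h, _⟩ => ⟨ρ, h⟩) (fun _ h => h) (fun _ => rfl) Δ

theorem fragFreeFillingLength_le (Δ : Diagram) :
    fragFreeFillingLength Δ ≤ freeFillingLength Δ :=
  minMaxLength_map_le (fun Θ : Diagram => [Θ])
    (fun a b h => ⟨[], [], a, rfl, Or.inl ⟨b, h, rfl⟩⟩) (by simp) (by simp) Δ

theorem card_face_eq {Δ : Diagram} {l : List Δ.D} {o : Option Δ.F} (hl : l.Nodup)
    (hmem : ∀ x, x ∈ l ↔ Δ.face x = o) : Nat.card {x // Δ.face x = o} = l.length := by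
  classical
  have := Fintype.ofFinite Δ.D
  rw [Nat.card_eq_fintype_card, Fintype.card_subtype, ← List.toFinset_card_of_nodup hl]
  congr 1
  ext x
  simp [hmem]

/-- Each directed edge lies on the boundary of exactly one 2-cell or on that of the diagram. -/
theorem card_edges_le {Δ : Diagram} {C : ℕ}
    (h : ∀ f : Δ.F, Nat.card {x // Δ.face x = some f} ≤ C) :
    Nat.card Δ.D ≤ C * Δ.area + Δ.perimeter := by
  classical
  have := Fintype.ofFinite Δ.F
  have hsum : Nat.card Δ.D = ∑ o : Option Δ.F, Nat.card {x // Δ.face x = o} := by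
    rw [← Nat.card_sigma]
    exact Nat.card_congr (Equiv.sigmaFiberEquiv Δ.face).symm
  rw [hsum, Fintype.sum_option, add_comm]
  refine Nat.add_le_add ?_ le_rfl
  calc ∑ f : Δ.F, Nat.card {x // Δ.face x = some f} ≤ ∑ _f : Δ.F, C :=
        Finset.sum_le_sum fun f _ => h f
    _ = C * Δ.area := by
        rw [Finset.sum_const, smul_eq_mul, Finset.card_univ, area, Nat.card_eq_fintype_card,
          mul_comm]

/-- The diagram has a labelling with which the word `w` is read around its boundary. -/
def Reads {A : Type*} (P : FinPresentation A) (Δ : Diagram) (w : List (A × Bool)) : Prop :=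
  ∃ (lab : Δ.D → A × Bool) (l : List Δ.D), IsLabelling P Δ lab ∧ IsCircuit Δ.next l ∧
    (∀ x, x ∈ l ↔ Δ.face x = none) ∧ l.map lab = w

theorem Reads.length_eq {A : Type*} {P : FinPresentation A} {Δ : Diagram} {w : List (A × Bool)}
    (h : Reads P Δ w) : w.length = Δ.perimeter := by
  obtain ⟨lab, l, -, hl, hout, rfl⟩ := h
  rw [List.length_map, perimeter, card_face_eq hl.1 hout]

end Diagram

namespace FinPresentation

variable {A : Type*} (P : FinPresentation A)

theorem VanKampenDiagram.isLabelling {P : FinPresentation A} {w : List (A × Bool)}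
    (Δ : P.VanKampenDiagram w) : Diagram.IsLabelling P Δ.diag Δ.label :=
  ⟨Δ.label_rev, fun x f hf => ⟨Δ.diag.circuit x, by
      obtain ⟨t, ht⟩ := self_mem_iterate Δ.diag.next x
      rw [Diagram.circuit, ht]; simp, isCircuit_iterate _ _, Δ.cell_label x f hf⟩⟩

theorem VanKampenDiagram.reads {P : FinPresentation A} {w : List (A × Bool)}
    (Δ : P.VanKampenDiagram w) : Diagram.Reads P Δ.diag w := by
  rcases Δ.boundary_label with ⟨hp, rfl⟩ | ⟨x, hx, -, hw⟩
  · exact ⟨Δ.label, [], Δ.isLabelling, IsCircuit.nil, fun x => (hp.false x).elim, rfl⟩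
  · obtain ⟨t, ht⟩ := self_mem_iterate Δ.diag.next x
    have hc := isCircuit_iterate Δ.diag.next x
    rw [ht] at hc
    refine ⟨Δ.label, x :: t, Δ.isLabelling, hc, fun y => ?_, ?_⟩
    · rw [Diagram.mem_circuit hc List.mem_cons_self, hx, eq_comm]
    · rw [← ht]; exact hw

/-- A bound for the lengths of the relators. -/
def maxRelLength : ℕ := P.rels.sup List.length

theorem IsCell.length_le {P : FinPresentation A} {l : List (A × Bool)} (h : P.IsCell l) :
    l.length ≤ P.maxRelLength := by
  obtain ⟨r, hr, h | h⟩ := h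
  · rw [h.perm.length_eq]
    exact Finset.le_sup (f := List.length) hr
  · rw [h.perm.length_eq, FreeGroup.invRev_length]
    exact Finset.le_sup (f := List.length) hr

theorem VanKampenDiagram.card_le {P : FinPresentation A} {w : List (A × Bool)}
    (Δ : P.VanKampenDiagram w) :
    Nat.card Δ.diag.D ≤ P.maxRelLength * Δ.diag.area + w.length := by
  rw [Δ.reads.length_eq]
  refine Diagram.card_edges_le fun f => ?_
  obtain ⟨x, hx⟩ := Δ.diag.exists_face_eq f
  obtain ⟨c, hxc, hc, hcell⟩ := Δ.isLabelling.cell x f hx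
  rw [Diagram.card_face_eq hc.1 fun y => by rw [Diagram.mem_circuit hc hxc, hx, eq_comm],
    ← List.length_map Δ.label]
  exact hcell.length_le

theorem wordFL_le {w : List (A × Bool)} {n : ℕ} (h : P.wordArea w ≤ n) :
    P.wordFL w ≤ (P.maxRelLength * n + w.length : ℕ) := by
  obtain ⟨Δ, hΔ⟩ : ∃ Δ : P.VanKampenDiagram w, Δ.diag.area ≤ n := by
    by_contra! hno
    have : ((n + 1 : ℕ) : ℕ∞) ≤ P.wordArea w :=
      le_iInf fun Δ => Nat.cast_le.2 (hno Δ)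
    have := this.trans h
    rw [Nat.cast_le] at this
    omega
  refine (iInf_le _ Δ).trans ((Diagram.fillingLength_le_card _).trans (Nat.cast_le.2 ?_))
  exact Δ.card_le.trans (Nat.add_le_add_right (Nat.mul_le_mul_left _ hΔ) _)

theorem wordFFL_le_wordFL (w : List (A × Bool)) : P.wordFFL w ≤ P.wordFL w :=
  iInf_mono fun Δ => Diagram.freeFillingLength_le Δ.toPointedDiagram

theorem wordFFFL_le_wordFFL (w : List (A × Bool)) : P.wordFFFL w ≤ P.wordFFL w :=
  iInf_mono fun Δ => Diagram.fragFreeFillingLength_le Δ.diag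

end FinPresentation

/-! ### Boundary words along shelling moves -/

theorem IsCircuit.isChain {α : Type*} {σ : Equiv.Perm α} {l : List α} (h : IsCircuit σ l) :
    l.IsChain (fun a b => σ a = b) := by
  cases l with
  | nil => exact List.isChain_nil
  | cons x t =>
    have := (IsCircuit.cons_iff.1 h).2
    rw [← List.cons_append] at this
    exact (List.isChain_append.1 this).1

theorem exists_map_eq_of_isChain {α : Type*} {f : α → α} {x : α} {t : List α}
    (h : (x :: t).IsChain (fun a b => f a = b)) : ∃ y, (x :: t).map f = t ++ [y] := by
  induction t generalizing x with
  | nil => exact ⟨f x, rfl⟩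
  | cons a t ih =>
    rw [List.isChain_cons_cons] at h
    obtain ⟨y, hy⟩ := ih h.2
    exact ⟨y, by rw [List.map_cons, hy, h.1]; rfl⟩

/-- An invariant stretch is a whole circuit. -/
theorem isCircuit_of_isChain {α : Type*} {σ : Equiv.Perm α} {l : List α} (hl : l.Nodup)
    (h : l.IsChain (fun a b => σ a = b)) (hc : ∀ x ∈ l, σ x ∈ l) : IsCircuit σ l := by
  refine ⟨hl, ?_⟩
  cases l with
  | nil => rfl
  | cons x t =>
    obtain ⟨y, hy⟩ := exists_map_eq_of_isChain h
    have hnd : ((x :: t).map σ).Nodup := hl.map σ.injective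
    have hym : y ∈ (x :: t).map σ := by rw [hy]; simp
    obtain ⟨z, hz, rfl⟩ := List.mem_map.1 hym
    have hyt : σ z ∉ t := by
      rw [hy] at hnd
      exact fun hmem => (List.nodup_append.1 hnd).2.2 _ hmem _ (List.mem_singleton_self _) rfl
    rw [hy, (List.mem_cons.1 (hc z hz)).resolve_right hyt]
    simp

theorem exists_map_eq_of_mem_range {α β : Type*} {f : α → β} {l : List β}
    (h : ∀ x ∈ l, x ∈ Set.range f) : ∃ m : List α, m.map f = l :=
  (Set.range_list_map f).ge h

namespace Diagram

variable {A : Type*} {P : FinPresentation A} {Δ Δ' : Diagram}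

theorem DeletesEdge.kept {d : Δ.D} {ρ : Δ'.V → Δ.V} {ι : Δ'.D → Δ.D}
    (h : DeletesEdge Δ Δ' d ρ ι) (x : Δ'.D) : ι x ≠ d ∧ ι x ≠ Δ.rev d := by
  have : ι x ∈ ({d, Δ.rev d}ᶜ : Set Δ.D) := h.range_edge ▸ ⟨x, rfl⟩
  simpa [not_or] using this

theorem DeletesEdge.exists_map_eq {d : Δ.D} {ρ : Δ'.V → Δ.V} {ι : Δ'.D → Δ.D}
    (h : DeletesEdge Δ Δ' d ρ ι) {l : List Δ.D} (hl : ∀ x ∈ l, x ≠ d ∧ x ≠ Δ.rev d) :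
    ∃ m : List Δ'.D, m.map ι = l :=
  exists_map_eq_of_mem_range fun x hx => by
    rw [h.range_edge]
    simpa [not_or] using hl x hx

theorem DeletesEdge.isLabelling {d : Δ.D} {ρ : Δ'.V → Δ.V} {ι : Δ'.D → Δ.D}
    (h : DeletesEdge Δ Δ' d ρ ι) {lab : Δ.D → A × Bool} (hlab : IsLabelling P Δ lab)
    (hface : ∀ x f', Δ'.face x = some f' → ∃ f, Δ.face (ι x) = some f ∧
      Δ.face d ≠ some f ∧ Δ.face (Δ.rev d) ≠ some f) : IsLabelling P Δ' (lab ∘ ι) := by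
  refine ⟨fun x => ?_, fun x f' hx => ?_⟩
  · rw [Function.comp_apply, ← h.rev_eq, hlab.rev_eq]; rfl
  · obtain ⟨f, hf, hd, he⟩ := hface x f' hx
    obtain ⟨c, hxc, hc, hcell⟩ := hlab.cell _ f hf
    have hf' : ∀ y ∈ c, Δ.face y = some f := fun y hy => by
      rw [← hf, (mem_circuit hc hxc).1 hy]
    obtain ⟨m, rfl⟩ := h.exists_map_eq (l := c) fun y hy =>
      ⟨fun hyd => hd (hyd ▸ hf' y hy), fun hyd => he (hyd ▸ hf' y hy)⟩
    exact ⟨m, (List.mem_map_of_injective h.inj_edge).1 hxc,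
      isCircuit_keep h.inj_edge h.next_eq hc rfl h.kept, by rwa [List.map_map] at hcell⟩

/-- A 1-cell collapse cancels a pair of inverse letters of the boundary word. -/
theorem Reads.collapse₁ {w : List (A × Bool)} {ρ : Δ'.V → Δ.V} (h : Reads P Δ w)
    (hc : Collapse₁ Δ Δ' ρ) :
    ∃ w', Reads P Δ' w' ∧ ∀ n, P.Fill w' n → P.Fill w n := by
  obtain ⟨lab, l, hlab, hl, hout, rfl⟩ := h
  obtain ⟨d, ι, φ, hd, hspike, hdel, -, hface⟩ := hc
  obtain ⟨t, ht⟩ := exists_circuit_spike hspike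
  have he : Δ.face (Δ.rev d) = none := by rw [← hspike, face_next, hd]
  have hnd := ht.1
  simp only [List.nodup_cons, List.mem_cons, not_or] at hnd
  obtain ⟨m, rfl⟩ := hdel.exists_map_eq (l := t) fun x hx =>
    ⟨fun h => hnd.1.2 (h ▸ hx), fun h => hnd.2.1 (h ▸ hx)⟩
  refine ⟨m.map (lab ∘ ι), ⟨lab ∘ ι, m, hdel.isLabelling hlab fun x f' hx => ?_,
    isCircuit_spike hdel.inj_edge hdel.next_eq ht rfl, fun x => ?_, rfl⟩, fun n hn => ?_⟩
  · exact ⟨φ f', by rw [hface, hx]; rfl, by simp [hd], by simp [he]⟩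
  · have h₁ := mem_circuit ht (y := ι x) List.mem_cons_self
    rw [List.mem_cons, or_iff_right (hdel.kept x).1, List.mem_cons, or_iff_right (hdel.kept x).2,
      hd, List.mem_map_of_injective hdel.inj_edge, hface] at h₁
    rw [h₁, eq_comm, Option.map_eq_none_iff]
  · have h₁ := FinPresentation.Fill.pair (u := []) (lab d) hn
    refine h₁.of_isRotated ?_
    have h₂ := (ht.isRotated hl List.mem_cons_self ((hout d).2 hd)).map lab
    rw [List.map_cons, List.map_cons, hlab.rev_eq, List.map_map] at h₂
    exact h₂

/-- A 2-cell collapse replaces a letter of the boundary word by the rest of a relator, so that a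
filling of the new word gives a filling of the old one with one cell more. -/
theorem Reads.collapse₂ {w : List (A × Bool)} {ρ : Δ'.V → Δ.V} (h : Reads P Δ w)
    (hc : Collapse₂ Δ Δ' ρ) :
    ∃ w', Reads P Δ' w' ∧ ∀ n, P.Fill w' n → P.Fill w (n + 1) := by
  obtain ⟨lab, l, hlab, hl, hout, rfl⟩ := h
  obtain ⟨d, f, ι, φ, hd, he, hdel, -, -, hrange, hface⟩ := hc
  obtain ⟨t, ht⟩ := exists_circuit d
  obtain ⟨s, hs⟩ := exists_circuit (Δ.rev d)
  obtain ⟨hnd, hkeep⟩ := nodup_of_circuits ht hs (by rw [hd, he]; simp)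
  obtain ⟨m, hm⟩ := hdel.exists_map_eq hkeep
  refine ⟨m.map (lab ∘ ι), ⟨lab ∘ ι, m, hdel.isLabelling hlab fun x f' hx => ?_,
    isCircuit_merge hdel.inj_edge hdel.next_eq ht hs hm hdel.kept hnd, fun x => ?_, rfl⟩,
    fun n hn => ?_⟩
  · have h₁ := hface x
    have hφ : φ f' ≠ f := by
      have : φ f' ∈ ({f}ᶜ : Set Δ.F) := hrange ▸ ⟨f', rfl⟩
      simpa using this
    rw [hx, Option.map_some] at h₁
    split_ifs at h₁
    exact ⟨φ f', h₁.symm, by simp [hd], by rw [he]; simpa using hφ.symm⟩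
  · have h₁ := mem_circuit ht (y := ι x) List.mem_cons_self
    have h₂ := mem_circuit hs (y := ι x) List.mem_cons_self
    rw [List.mem_cons, or_iff_right (hdel.kept x).1, hd] at h₁
    rw [List.mem_cons, or_iff_right (hdel.kept x).2, he] at h₂
    have h₃ := hface x
    rw [← List.mem_map_of_injective hdel.inj_edge, hm, List.mem_append, h₁, h₂,
      ← Option.map_eq_none_iff (f := φ), h₃]
    split_ifs with h
    · simp [h]
    · exact ⟨fun h' => (h'.resolve_left fun e => h e.symm).symm, fun h' => Or.inr h'.symm⟩
  · have hcell := hlab.isCell he List.mem_cons_self hs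
    rw [List.map_cons, hlab.rev_eq] at hcell
    have h₁ : P.Fill (s.map lab ++ t.map lab) n := by
      rw [← List.map_append, ← hm, List.map_map]; exact hn
    have h₂ := FinPresentation.Fill.cell (lab d)
      (hcell.rotate (List.isRotated_append (l := [_]))) h₁
    exact h₂.of_isRotated ((ht.isRotated hl List.mem_cons_self ((hout d).2 hd)).map lab)

open Classical in
/-- A 1-cell expansion inserts a pair of inverse letters into the boundary word; by `Fill.cancel`
this does not change the fillings. -/
theorem Reads.expansion₁ {w : List (A × Bool)} {ρ : Δ'.V → Δ.V} (h : Reads P Δ w)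
    (hc : Expansion₁ Δ Δ' ρ) :
    ∃ w', Reads P Δ' w' ∧ ∀ n, P.Fill w' n → P.Fill w n := by
  obtain ⟨lab, l, hlab, hl, hout, rfl⟩ := h
  obtain ⟨y, d, ι, p, q, φ, hy, -, hι, hpq, hrange, hrd, hrq, hrev, hnext, hnq, hnp, hface, hfq,
    hfp, -⟩ := hc
  obtain ⟨t, ht⟩ := exists_circuit y
  have hpn : p ∉ Set.range ι := by simp [hrange]
  have hqn : q ∉ Set.range ι := by simp [hrange]
  have hcases : ∀ z, z = p ∨ z = q ∨ ∃ x, z = ι x := by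
    intro z
    by_cases hz : z ∈ Set.range ι
    · obtain ⟨x, rfl⟩ := hz
      exact Or.inr (Or.inr ⟨x, rfl⟩)
    · rw [hrange, Set.mem_compl_iff, not_not] at hz
      rcases hz with rfl | rfl
      · exact Or.inl rfl
      · exact Or.inr (Or.inl rfl)
  obtain ⟨lab', hlι, hlp, hlq⟩ : ∃ lab' : Δ'.D → A × Bool, (∀ x, lab' (ι x) = lab x) ∧
      lab' p = invLetter (lab d) ∧ lab' q = lab d := by
    refine ⟨Function.extend ι lab fun z => if z = p then invLetter (lab d) else lab d,
      fun x => hι.extend_apply _ _ x, ?_, ?_⟩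
    · rw [Function.extend_apply' _ _ _ hpn, if_pos rfl]
    · rw [Function.extend_apply' _ _ _ hqn, if_neg hpq.symm]
  have hcomp : lab' ∘ ι = lab := funext hlι
  have hcirc : IsCircuit Δ'.next (q :: p :: (y :: t).map ι) := by
    have hnt := List.nodup_cons.1 ht.1
    constructor
    · rw [List.nodup_cons, List.nodup_cons, List.mem_cons, not_or]
      refine ⟨⟨hpq.symm, fun h => hqn ?_⟩, fun h => hpn ?_, ht.1.map hι⟩
      · obtain ⟨x, -, hx⟩ := List.mem_map.1 h
        exact ⟨x, hx⟩
      · obtain ⟨x, -, hx⟩ := List.mem_map.1 h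
        exact ⟨x, hx⟩
    · have h₁ : ((y :: t).map ι).map Δ'.next =
          ((y :: t).map Δ.next).map (fun x => if x = y then q else ι x) := by
        rw [List.map_map, List.map_map]
        exact List.map_congr_left fun x _ => hnext x
      have h₂ : t.map (fun x => if x = y then q else ι x) = t.map ι :=
        List.map_congr_left fun x hx => if_neg (by rintro rfl; exact hnt.1 hx)
      have h₃ : (y :: t).map Δ.next = t ++ [y] := by simpa using ht.2
      rw [List.map_cons, List.map_cons, hnq, hnp, h₁, h₃, List.map_append, h₂]
      simp
  refine ⟨(q :: p :: (y :: t).map ι).map lab', ⟨lab', _, ⟨?_, ?_⟩, hcirc, ?_, rfl⟩,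
    fun n hn => ?_⟩
  · intro z
    rcases hcases z with rfl | rfl | ⟨x, rfl⟩
    · rw [← hrd, Δ'.rev_rev, hlι, hrd, hlp, invLetter_invLetter]
    · rw [hrq, hlι, hlab.rev_eq, hlq]
    · by_cases hx : x = d
      · rw [hx, hrd, hlp, hlι]
      by_cases hx' : x = Δ.rev d
      · rw [hx', ← hrq, Δ'.rev_rev, hrq, hlι, hlq, hlab.rev_eq, invLetter_invLetter]
      · rw [hrev x hx hx', hlι, hlι, hlab.rev_eq]
  · intro z f' hz
    rcases hcases z with rfl | rfl | ⟨x, rfl⟩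
    · simp [hfp] at hz
    · simp [hfq] at hz
    · rw [hface, Option.map_eq_some_iff] at hz
      obtain ⟨f, hf, -⟩ := hz
      obtain ⟨c, hxc, hcc, hcell⟩ := hlab.cell x f hf
      refine ⟨c.map ι, List.mem_map_of_mem hxc, hcc.map hι fun z hz => ?_, ?_⟩
      · refine (hnext z).trans (if_neg fun h => ?_)
        have := (mem_circuit hcc hxc).1 hz
        rw [← Δ.face_next z, h, hy, hf] at this
        simp at this
      · rwa [List.map_map, hcomp]
  · intro z
    rcases hcases z with rfl | rfl | ⟨x, rfl⟩
    · simp [hfp]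
    · simp [hfq]
    · have hx : ι x ∉ [q, p] := by
        intro h
        simp only [List.mem_cons, List.not_mem_nil, or_false] at h
        rcases h with h | h
        · exact hqn ⟨x, h⟩
        · exact hpn ⟨x, h⟩
      have h₁ : ι x ∈ [q, p] ++ (y :: t).map ι ↔ x ∈ y :: t := by
        rw [List.mem_append, or_iff_right hx, List.mem_map_of_injective hι]
      refine h₁.trans ?_
      rw [mem_circuit ht List.mem_cons_self, hy, hface, Option.map_eq_none_iff, eq_comm]
  · rw [List.map_cons, List.map_cons, hlp, hlq, List.map_map, hcomp] at hn
    exact (FinPresentation.Fill.cancel (u := []) hn).of_isRotated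
      ((ht.isRotated hl List.mem_cons_self ((hout y).2 hy)).map lab)

/-- The 2-cells of a piece keep their boundary circuits. -/
theorem IsPiece.next_comm {Δ₁ Δ₂ : Diagram} {ρ₁ : Δ₁.V → Δ.V} {ι₁ : Δ₁.D → Δ.D} {φ₁ : Δ₁.F → Δ.F}
    {ρ₂ : Δ₂.V → Δ.V} {ι₂ : Δ₂.D → Δ.D} {φ₂ : Δ₂.F → Δ.F} (h₁ : IsPiece Δ₁ Δ ρ₁ ι₁ φ₁)
    (h₂ : IsPiece Δ₂ Δ ρ₂ ι₂ φ₂) (hι : IsCompl (Set.range ι₁) (Set.range ι₂))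
    (hφ : IsCompl (Set.range φ₁) (Set.range φ₂)) {x : Δ₁.D} {f : Δ₁.F}
    (hx : Δ₁.face x = some f) : Δ.next (ι₁ x) = ι₁ (Δ₁.next x) := by
  have hf : Δ.face (Δ.next (ι₁ x)) = some (φ₁ f) := by rw [face_next, h₁.face_eq, hx]; rfl
  have hmem : Δ.next (ι₁ x) ∈ Set.range ι₁ ∨ Δ.next (ι₁ x) ∈ Set.range ι₂ := by
    rw [← hι.compl_eq]; exact em _
  rcases hmem with ⟨z, hz⟩ | ⟨z, hz⟩
  · rw [← hz, h₁.next_eq x z hz.symm]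
  · rw [← hz, h₂.face_eq, Option.map_eq_some_iff] at hf
    obtain ⟨g, -, hg⟩ := hf
    exact (Set.disjoint_left.1 hφ.disjoint ⟨f, rfl⟩ ⟨g, hg⟩).elim

theorem IsPiece.isLabelling {Δ₁ Δ₂ : Diagram} {ρ₁ : Δ₁.V → Δ.V} {ι₁ : Δ₁.D → Δ.D}
    {φ₁ : Δ₁.F → Δ.F} {ρ₂ : Δ₂.V → Δ.V} {ι₂ : Δ₂.D → Δ.D} {φ₂ : Δ₂.F → Δ.F}
    (h₁ : IsPiece Δ₁ Δ ρ₁ ι₁ φ₁) (h₂ : IsPiece Δ₂ Δ ρ₂ ι₂ φ₂)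
    (hι : IsCompl (Set.range ι₁) (Set.range ι₂)) (hφ : IsCompl (Set.range φ₁) (Set.range φ₂))
    {lab : Δ.D → A × Bool} (hlab : IsLabelling P Δ lab) : IsLabelling P Δ₁ (lab ∘ ι₁) := by
  refine ⟨fun x => ?_, fun x f hx => ?_⟩
  · rw [Function.comp_apply, ← h₁.rev_eq, hlab.rev_eq]; rfl
  · obtain ⟨t, ht⟩ := exists_circuit x
    have hc : IsCircuit Δ.next ((x :: t).map ι₁) := ht.map h₁.inj_edge fun z hz =>
      IsPiece.next_comm h₁ h₂ hι hφ (((mem_circuit ht List.mem_cons_self).1 hz).symm.trans hx)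
    refine ⟨x :: t, List.mem_cons_self, ht, ?_⟩
    have := hlab.isCell (x := ι₁ x) (f := φ₁ f) (by rw [h₁.face_eq, hx]; rfl)
      (List.mem_map_of_mem List.mem_cons_self) hc
    rwa [List.map_map] at this

/-- The boundary circuit of a piece. -/
theorem IsPiece.isCircuit {Δ₁ : Diagram} {ρ₁ : Δ₁.V → Δ.V} {ι₁ : Δ₁.D → Δ.D} {φ₁ : Δ₁.F → Δ.F}
    (h₁ : IsPiece Δ₁ Δ ρ₁ ι₁ φ₁) {m : List Δ₁.D} (hm : (m.map ι₁).Nodup)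
    (hc : (m.map ι₁).IsChain (fun a b => Δ.next a = b)) (hmem : ∀ x, x ∈ m ↔ Δ₁.face x = none) :
    IsCircuit Δ₁.next m := by
  refine isCircuit_of_isChain (List.Nodup.of_map _ hm) ?_ fun x hx => ?_
  · rw [List.isChain_map] at hc
    exact hc.imp fun a b hab => h₁.next_eq a b hab
  · rw [hmem, face_next, ← hmem]; exact hx

/-- The boundary circuit of a union of two pieces is the concatenation of two stretches, one in each
piece. -/
theorem exists_split {Δ₁ Δ₂ : Diagram} {ρ₁ : Δ₁.V → Δ.V} {ι₁ : Δ₁.D → Δ.D} {φ₁ : Δ₁.F → Δ.F}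
    {ι₂ : Δ₂.D → Δ.D} (h₁ : IsPiece Δ₁ Δ ρ₁ ι₁ φ₁) (hι : IsCompl (Set.range ι₁) (Set.range ι₂)) :
    ∃ l₁ l₂, IsCircuit Δ.next (l₁ ++ l₂) ∧ (∀ x, x ∈ l₁ ++ l₂ ↔ Δ.face x = none) ∧
      (∀ x ∈ l₁, x ∈ Set.range ι₁) ∧ ∀ x ∈ l₂, x ∈ Set.range ι₂ := by
  classical
  have hnot : ∀ x, x ∉ Set.range ι₁ → x ∈ Set.range ι₂ := fun x hx => by
    rw [← hι.compl_eq]; exact hx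
  by_cases hD : Nonempty Δ.D
  swap
  · exact ⟨[], [], IsCircuit.nil, fun x => (hD ⟨x⟩).elim, by simp, by simp⟩
  by_cases hexit : ∃ a, Δ.face (ι₁ a) = none ∧ Δ.next (ι₁ a) ∉ Set.range ι₁
  · obtain ⟨a, ha, hz⟩ := hexit
    obtain ⟨t, ht⟩ := exists_circuit (Δ.next (ι₁ a))
    have hmem : ∀ x, x ∈ Δ.next (ι₁ a) :: t ↔ Δ.face x = none := fun x => by
      rw [mem_circuit ht List.mem_cons_self, face_next, ha, eq_comm]
    -- the circuit that starts after the exit from the first piece ends with this exit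
    obtain ⟨u, hu⟩ : ∃ u, t = u ++ [ι₁ a] := by
      rcases List.eq_nil_or_concat' t with rfl | ⟨u, b, rfl⟩
      · have := (hmem (ι₁ a)).2 ha
        rw [List.mem_singleton] at this
        exact (hz ⟨a, this⟩).elim
      · exact ⟨u, by rw [Δ.next.injective ht.apply_last]⟩
    subst hu
    have hnd : ι₁ a ∉ Δ.next (ι₁ a) :: u := by
      have := ht.1
      rw [← List.cons_append] at this
      exact fun h => (List.nodup_append.1 this).2.2 _ h _ (List.mem_singleton_self _) rfl
    have hch := ht.isChain
    rw [← List.cons_append] at hch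
    obtain ⟨v, hv⟩ : ∃ v, Δ.next (ι₁ a) :: u = v := ⟨_, rfl⟩
    have ht' : IsCircuit Δ.next (v ++ [ι₁ a]) := hv ▸ ht
    have hmem' : ∀ x, x ∈ v ++ [ι₁ a] ↔ Δ.face x = none := fun x => by
      rw [← hv]; exact hmem x
    rw [hv] at hch hnd
    have hchv := (List.isChain_append.1 hch).1
    -- after the first edge of the first piece the circuit stays in this piece
    have stay : ∀ (L : List Δ.D) (c : Δ.D), (c :: L).IsChain (fun a b => Δ.next a = b) →
        c ∈ Set.range ι₁ → ι₁ a ∉ c :: L → ∀ x ∈ c :: L, x ∈ Set.range ι₁ := by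
      intro L
      induction L with
      | nil => intro c _ hc _ x hx; rw [List.mem_singleton.1 hx]; exact hc
      | cons y L ih =>
        intro c hcL hc hac x hx
        rw [List.isChain_cons_cons] at hcL
        rcases List.mem_cons.1 hx with rfl | hx
        · exact hc
        refine ih y hcL.2 ?_ (fun h => hac (List.mem_cons_of_mem _ h)) x hx
        obtain ⟨b, rfl⟩ := hc
        by_contra hy
        have := h₁.leave_once b a (by rw [hcL.1]; exact hy) hz
        subst this
        exact hac List.mem_cons_self
    let p : Δ.D → Bool := fun x => decide (x ∈ Set.range ι₂)
    have hsplit : v.takeWhile p ++ v.dropWhile p = v := List.takeWhile_append_dropWhile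
    have hdrop : ∀ x ∈ v.dropWhile p, x ∈ Set.range ι₁ := by
      cases hdw : v.dropWhile p with
      | nil => simp
      | cons c L =>
        have hchd : (v.dropWhile p).IsChain (fun a b => Δ.next a = b) := by
          rw [← hsplit] at hchv
          exact (List.isChain_append.1 hchv).2.1
        rw [hdw] at hchd
        refine stay L c hchd ?_ fun h => hnd ?_
        · have := List.head_dropWhile_not p (w := by rw [hdw]; simp)
          simp only [hdw, List.head_cons] at this
          by_contra hc
          obtain ⟨b, hb⟩ := hnot c hc
          simp only [p, decide_eq_false_iff_not] at this
          exact this ⟨b, hb⟩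
        · rw [← hsplit, hdw]; exact List.mem_append_right _ h
    refine ⟨v.dropWhile p ++ [ι₁ a], v.takeWhile p, ?_, fun x => ?_, fun x hx => ?_, fun x hx => ?_⟩
    · refine IsCircuit.swap ?_
      rw [← List.append_assoc, hsplit]
      exact ht'
    · rw [← hmem' x]
      conv_rhs => rw [← hsplit]
      simp only [List.mem_append]
      tauto
    · rcases List.mem_append.1 hx with hx | hx
      · exact hdrop x hx
      · rw [List.mem_singleton.1 hx]; exact ⟨a, rfl⟩
    · simpa [p] using List.mem_takeWhile_imp hx
  · push Not at hexit
    obtain ⟨x₀, hx₀⟩ := Δ.exists_outer hD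
    obtain ⟨t, ht⟩ := exists_circuit x₀
    have hmem : ∀ x, x ∈ x₀ :: t ↔ Δ.face x = none := fun x => by
      rw [mem_circuit ht List.mem_cons_self, hx₀, eq_comm]
    by_cases hex : ∃ a, Δ.face (ι₁ a) = none
    · obtain ⟨a, ha⟩ := hex
      refine ⟨x₀ :: t, [], by simpa using ht, by simpa using hmem, fun x hx => ?_, by simp⟩
      have hax : Δ.next.SameCycle (ι₁ a) x :=
        (Δ.face_eq_iff _ _).1 (ha.trans ((hmem x).1 hx).symm)
      refine (hax.induct (C := fun z => z ∈ Set.range ι₁ ∧ Δ.face z = none) ⟨⟨a, rfl⟩, ha⟩ ?_).1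
      rintro _ ⟨⟨b, rfl⟩, hb⟩
      exact ⟨hexit b hb, by rw [face_next, hb]⟩
    · push Not at hex
      refine ⟨[], x₀ :: t, by simpa using ht, by simpa using hmem, by simp, fun x hx => ?_⟩
      refine hnot x ?_
      rintro ⟨b, rfl⟩
      exact hex b ((hmem _).1 hx)

/-- A fragmentation cuts the boundary word, up to rotation, into those of the two pieces. -/
theorem Reads.fragments {Δ₁ Δ₂ : Diagram} {w : List (A × Bool)} (h : Reads P Δ w)
    (hf : Fragments Δ Δ₁ Δ₂) :
    ∃ w₁ w₂, Reads P Δ₁ w₁ ∧ Reads P Δ₂ w₂ ∧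
      ∀ n₁ n₂, P.Fill w₁ n₁ → P.Fill w₂ n₂ → P.Fill w (n₁ + n₂) := by
  obtain ⟨lab, l, hlab, hl, hout, rfl⟩ := h
  obtain ⟨ρ₁, ι₁, φ₁, ρ₂, ι₂, φ₂, h₁, h₂, -, -, hι, hφ⟩ := hf
  obtain ⟨l₁, l₂, hc, hmem, hr₁, hr₂⟩ := exists_split h₁ hι
  obtain ⟨m₁, rfl⟩ := exists_map_eq_of_mem_range hr₁
  obtain ⟨m₂, rfl⟩ := exists_map_eq_of_mem_range hr₂
  have hch := List.isChain_append.1 hc.isChain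
  have hnd := List.nodup_append.1 hc.1
  have hdis := Set.disjoint_left.1 hι.disjoint
  have hm₁ : ∀ x, x ∈ m₁ ↔ Δ₁.face x = none := fun x => by
    have h := hmem (ι₁ x)
    have h' : ι₁ x ∉ m₂.map ι₂ := fun h => hdis ⟨x, rfl⟩ (hr₂ _ h)
    rwa [List.mem_append, or_iff_left h', List.mem_map_of_injective h₁.inj_edge, h₁.face_eq,
      Option.map_eq_none_iff] at h
  have hm₂ : ∀ x, x ∈ m₂ ↔ Δ₂.face x = none := fun x => by
    have h := hmem (ι₂ x)
    have h' : ι₂ x ∉ m₁.map ι₁ := fun h => hdis (hr₁ _ h) ⟨x, rfl⟩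
    rwa [List.mem_append, or_iff_right h', List.mem_map_of_injective h₂.inj_edge, h₂.face_eq,
      Option.map_eq_none_iff] at h
  refine ⟨m₁.map (lab ∘ ι₁), m₂.map (lab ∘ ι₂),
    ⟨_, m₁, h₁.isLabelling h₂ hι hφ hlab, h₁.isCircuit hnd.1 hch.1 hm₁, hm₁, rfl⟩,
    ⟨_, m₂, h₂.isLabelling h₁ hι.symm hφ.symm hlab, h₂.isCircuit hnd.2.1 hch.2.1 hm₂, hm₂, rfl⟩,
    fun n₁ n₂ hn₁ hn₂ => ?_⟩
  refine (hn₁.append hn₂).of_isRotated ?_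
  rw [← List.map_map, ← List.map_map, ← List.map_append]
  refine List.IsRotated.map ?_ lab
  cases hl' : l with
  | nil =>
    have : m₁.map ι₁ ++ m₂.map ι₂ = [] := List.eq_nil_iff_forall_not_mem.2 fun x hx => by
      have := (hout x).2 ((hmem x).1 hx)
      simp [hl'] at this
    rw [this]
  | cons x t =>
    have hx : x ∈ l := by simp [hl']
    exact hl' ▸ hc.isRotated hl ((hmem x).2 ((hout x).1 hx)) hx

end Diagram

/-! ### Counting configurations of boundary words -/

/-- Cuts a list of flagged letters into words; a flag marks the last letter of a word. -/
def cutWords {X : Type*} : List (X × Bool) → List (List X)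
  | [] => []
  | (x, true) :: t => [x] :: cutWords t
  | (x, false) :: t =>
    match cutWords t with
    | [] => [[x]]
    | w :: ws => (x :: w) :: ws

theorem exists_cutWords_append {X : Type*} (x : X) (w : List X) :
    ∃ e : List (X × Bool), e.length = (x :: w).length ∧
      ∀ c, cutWords (e ++ c) = (x :: w) :: cutWords c := by
  induction w generalizing x with
  | nil => exact ⟨[(x, true)], rfl, fun c => rfl⟩
  | cons y w ih =>
    obtain ⟨e, he, hc⟩ := ih y
    exact ⟨(x, false) :: e, by simp [he], fun c => by simp [cutWords, hc]⟩

namespace FinPresentation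

variable {A : Type*} (P : FinPresentation A)

/-- The least area of a filling of `w`. -/
noncomputable def minFill (w : List (A × Bool)) : ℕ∞ :=
  ⨅ (n : ℕ) (_ : P.Fill w n), (n : ℕ∞)

variable {P}

theorem minFill_le_iff {w : List (A × Bool)} {n : ℕ} : P.minFill w ≤ n ↔ P.Fill w n := by
  constructor
  · intro h
    by_contra hno
    have : ((n + 1 : ℕ) : ℕ∞) ≤ P.minFill w :=
      le_iInf₂ fun k hk => by
        rw [Nat.cast_le]
        by_contra hlt
        exact hno (hk.mono (by omega))
    have := this.trans h
    rw [Nat.cast_le] at this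
    omega
  · exact fun h => iInf₂_le (f := fun (n : ℕ) (_ : P.Fill w n) => (n : ℕ∞)) n h

theorem minFill_nil : P.minFill [] = 0 :=
  le_antisymm (by simpa using minFill_le_iff.2 (Fill.nil (P := P) 0)) zero_le

theorem minFill_le_add {w w' : List (A × Bool)} {k : ℕ}
    (h : ∀ n, P.Fill w' n → P.Fill w (n + k)) : P.minFill w ≤ P.minFill w' + k := by
  induction hw : P.minFill w' using ENat.recTopCoe with
  | top => simp
  | coe n => exact_mod_cast minFill_le_iff.2 (h n (minFill_le_iff.1 hw.le))

theorem minFill_le_add₂ {w w₁ w₂ : List (A × Bool)}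
    (h : ∀ n₁ n₂, P.Fill w₁ n₁ → P.Fill w₂ n₂ → P.Fill w (n₁ + n₂)) :
    P.minFill w ≤ P.minFill w₁ + P.minFill w₂ := by
  induction h₁ : P.minFill w₁ using ENat.recTopCoe with
  | top => simp
  | coe n₁ =>
    rw [add_comm]
    have := minFill_le_add (k := n₁) (w := w) (w' := w₂) (P := P) fun n hn => by
      rw [add_comm]; exact h _ _ (minFill_le_iff.1 h₁.le) hn
    exact this

variable (P) in
/-- The least total area of fillings of the words of a configuration. -/
noncomputable def cost (W : List (List (A × Bool))) : ℕ∞ := (W.map P.minFill).sum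

/-- A move of a fragmenting shelling lowers the cost of the configuration of boundary words by at
most one: only a 2-cell collapse uses a relator. -/
theorem exists_cost_le_of_fragStep {S T : List Diagram} {W : List (List (A × Bool))}
    (h : Diagram.FragStep S T) (hS : List.Forall₂ (Diagram.Reads P) S W) :
    ∃ W', List.Forall₂ (Diagram.Reads P) T W' ∧ P.cost W ≤ P.cost W' + 1 := by
  obtain ⟨l, r, Δ, rfl, h⟩ := h
  obtain ⟨Wl, W', hl, hW', rfl⟩ : ∃ Wl W', List.Forall₂ (Diagram.Reads P) l Wl ∧
      List.Forall₂ (Diagram.Reads P) (Δ :: r) W' ∧ W = Wl ++ W' := by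
    refine ⟨W.take l.length, W.drop l.length, ?_, ?_, (List.take_append_drop _ _).symm⟩
    · simpa using List.forall₂_take l.length hS
    · simpa using List.forall₂_drop l.length hS
  obtain ⟨w, Wr, hw, hr, rfl⟩ : ∃ w Wr, Diagram.Reads P Δ w ∧
      List.Forall₂ (Diagram.Reads P) r Wr ∧ W' = w :: Wr := by
    cases hW' with
    | cons h₁ h₂ => exact ⟨_, _, h₁, h₂, rfl⟩
  have hcost : P.cost (Wl ++ w :: Wr) = P.minFill w + (P.cost Wl + P.cost Wr) := by
    simp only [cost, List.map_append, List.map_cons, List.sum_append, List.sum_cons]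
    exact add_left_comm _ _ _
  rcases h with ⟨Δ', ⟨ρ, hmove⟩, rfl⟩ | ⟨Δ₁, Δ₂, hf, rfl⟩
  · obtain ⟨w', hw', hle⟩ : ∃ w', Diagram.Reads P Δ' w' ∧ P.minFill w ≤ P.minFill w' + 1 := by
      rcases hmove with hc | hc | hc
      · obtain ⟨w', h₁, h₂⟩ := hw.collapse₁ hc
        exact ⟨w', h₁, minFill_le_add (k := 1) fun n hn => (h₂ n hn).mono (by omega)⟩
      · obtain ⟨w', h₁, h₂⟩ := hw.collapse₂ hc
        exact ⟨w', h₁, minFill_le_add (k := 1) h₂⟩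
      · obtain ⟨w', h₁, h₂⟩ := hw.expansion₁ hc
        exact ⟨w', h₁, minFill_le_add (k := 1) fun n hn => (h₂ n hn).mono (by omega)⟩
    refine ⟨Wl ++ w' :: Wr, List.rel_append hl (.cons hw' hr), ?_⟩
    have hcost' : P.cost (Wl ++ w' :: Wr) = P.minFill w' + (P.cost Wl + P.cost Wr) := by
      simp only [cost, List.map_append, List.map_cons, List.sum_append, List.sum_cons]
      exact add_left_comm _ _ _
    rw [hcost, hcost', add_right_comm]
    gcongr
  · obtain ⟨w₁, w₂, h₁, h₂, hle⟩ := hw.fragments hf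
    refine ⟨Wl ++ w₁ :: w₂ :: Wr, List.rel_append hl (.cons h₁ (.cons h₂ hr)), ?_⟩
    have hcost' : P.cost (Wl ++ w₁ :: w₂ :: Wr) =
        (P.minFill w₁ + P.minFill w₂) + (P.cost Wl + P.cost Wr) := by
      simp only [cost, List.map_append, List.map_cons, List.sum_append, List.sum_cons]
      rw [← add_assoc (P.minFill w₁), add_left_comm]
    rw [hcost, hcost']
    refine le_trans ?_ (le_add_right le_rfl)
    gcongr
    exact minFill_le_add₂ hle

theorem sum_length_eq {S : List Diagram} {W : List (List (A × Bool))}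
    (h : List.Forall₂ (Diagram.Reads P) S W) :
    (W.map List.length).sum = (S.map Diagram.perimeter).sum := by
  induction h with
  | nil => rfl
  | cons h _ ih => rw [List.map_cons, List.map_cons, List.sum_cons, List.sum_cons, ih, h.length_eq]

theorem cost_eq_zero_of_isPoint {S : List Diagram} {W : List (List (A × Bool))}
    (h : List.Forall₂ (Diagram.Reads P) S W) (hS : ∀ Θ ∈ S, Θ.IsPoint) : P.cost W = 0 := by
  induction h with
  | nil => rfl
  | @cons Δ w S W h _ ih =>
    obtain ⟨lab, l, -, -, -, rfl⟩ := h
    have hl : l = [] := List.eq_nil_iff_forall_not_mem.2 fun x =>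
      ((hS Δ List.mem_cons_self).false x).elim
    have := ih fun Θ hΘ => hS Θ (List.mem_cons_of_mem _ hΘ)
    rw [cost] at this
    rw [cost, List.map_cons, List.sum_cons, this, hl, List.map_nil, minFill_nil, add_zero]

/-- Along a fragmenting shelling the cost drops to `0` by steps of at most one, so that it takes
every value below the initial one. -/
theorem exists_cost_eq {S : List Diagram} {W : List (List (A × Bool))} {L k : ℕ}
    (hS : List.Forall₂ (Diagram.Reads P) S W)
    (h : HasSequence Diagram.FragStep (fun S => ∀ Θ ∈ S, Θ.IsPoint)
      (fun S => (S.map Diagram.perimeter).sum) S L)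
    (hk : (k : ℕ∞) ≤ P.cost W) :
    ∃ W', P.cost W' = k ∧ (W'.map List.length).sum ≤ L := by
  obtain ⟨m, s, rfl, h₁, h₂, h₃⟩ := h
  induction m generalizing s W with
  | zero =>
    refine ⟨W, le_antisymm ?_ hk, (sum_length_eq hS).trans_le (h₃ 0 le_rfl)⟩
    rw [cost_eq_zero_of_isPoint hS h₁]
    exact zero_le
  | succ m ih =>
    obtain ⟨W', hW', hle⟩ := exists_cost_le_of_fragStep (h₂ 0 (by omega)) hS
    by_cases hk' : (k : ℕ∞) ≤ P.cost W'
    · exact ih hk' (fun i => s (i + 1)) hW' h₁ (fun i hi => h₂ (i + 1) (by omega))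
        fun i hi => h₃ (i + 1) (by omega)
    · refine ⟨W, le_antisymm (hle.trans ?_) hk, (sum_length_eq hS).trans_le (h₃ 0 (by omega))⟩
      exact Order.add_one_le_of_lt (not_le.1 hk')

/-- Every configuration of words is coded, up to its empty words, by flagged letters, one for each
letter. -/
theorem exists_code (W : List (List (A × Bool))) :
    ∃ c : List ((A × Bool) × Bool), c.length = (W.map List.length).sum ∧
      P.cost (cutWords c) = P.cost W := by
  induction W with
  | nil => exact ⟨[], rfl, rfl⟩
  | cons w W ih =>
    obtain ⟨c, hc, hcost⟩ := ih
    cases w with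
    | nil => exact ⟨c, by simp [hc], by rw [hcost]; simp [cost, minFill_nil]⟩
    | cons x w =>
      obtain ⟨e, he, hcut⟩ := exists_cutWords_append x w
      refine ⟨e ++ c, by simp [he, hc], ?_⟩
      rw [hcut]
      rw [cost] at hcost
      rw [cost, cost, List.map_cons, List.sum_cons, hcost, List.map_cons, List.sum_cons]
      rfl

/-- The number of symbols that are used to write down configurations of words: the letters with or
without a flag, and a blank. -/
noncomputable def numSymbols (_ : FinPresentation A) : ℕ := Nat.card (Option ((A × Bool) × Bool))

/-- A word whose diagram has a fragmenting shelling of length at most `L` has a filling of area at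
most the number of strings of `L` symbols: otherwise all costs from `0` to this number occur, and
they need different configurations of words of total length at most `L`. -/
theorem fill_of_hasSequence [Finite A] {Δ : Diagram} {w : List (A × Bool)} {L : ℕ}
    (hΔ : Diagram.Reads P Δ w)
    (h : HasSequence Diagram.FragStep (fun S => ∀ Θ ∈ S, Θ.IsPoint)
      (fun S => (S.map Diagram.perimeter).sum) [Δ] L) :
    P.Fill w (P.numSymbols ^ L) := by
  have := Fintype.ofFinite (Option ((A × Bool) × Bool))
  by_contra hno
  rw [← minFill_le_iff, not_le] at hno
  have hcost : P.cost [w] = P.minFill w := by simp [cost]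
  have key : ∀ k : Fin (P.numSymbols ^ L + 1), ∃ v : List.Vector (Option ((A × Bool) × Bool)) L,
      P.cost (cutWords v.1.reduceOption) = ((k : ℕ) : ℕ∞) := by
    intro k
    obtain ⟨W, hW, hlen⟩ := exists_cost_eq (k := k) (.cons hΔ .nil) h (by
      rw [hcost]
      exact (Nat.cast_le.2 (Nat.lt_succ_iff.1 k.2)).trans hno.le)
    obtain ⟨c, hc, hcc⟩ := exists_code (P := P) W
    refine ⟨⟨c.map some ++ List.replicate (L - c.length) none, by simp; omega⟩, ?_⟩
    have : (c.map some ++ List.replicate (L - c.length) none).reduceOption = c := by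
      simp [List.reduceOption, List.filterMap_map]
    rw [this, hcc, hW]
  choose v hv using key
  have hinj : Function.Injective v := fun i j hij => by
    have := hv i
    rw [hij, hv j] at this
    exact Fin.ext (by exact_mod_cast this.symm)
  have := Fintype.card_le_of_injective v hinj
  rw [Fintype.card_fin, card_vector, numSymbols, Nat.card_eq_fintype_card] at this
  omega

/-- A syntactic filling is realized by a van Kampen diagram. -/
theorem wordArea_le_of_fill {w : List (A × Bool)} {n : ℕ} (h : P.Fill w n) :
    P.wordArea w ≤ n := by
  obtain ⟨Δ, hΔ⟩ := (h.gen.bounds).exists_vanKampen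
  exact (iInf_le _ Δ).trans (Nat.cast_le.2 hΔ)

theorem wordArea_le_pow [Finite A] {w : List (A × Bool)} {L : ℕ} (h : P.wordFFFL w ≤ L) :
    P.wordArea w ≤ (P.numSymbols ^ L : ℕ) := by
  obtain ⟨Δ, hΔ⟩ : ∃ Δ : P.VanKampenDiagram w, Diagram.fragFreeFillingLength Δ.diag ≤ L := by
    by_contra! hno
    have : ((L + 1 : ℕ) : ℕ∞) ≤ P.wordFFFL w :=
      le_iInf fun Δ => by
        rw [Nat.cast_add, Nat.cast_one]
        exact Order.add_one_le_of_lt (hno Δ)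
    have := this.trans h
    rw [Nat.cast_le] at this
    omega
  exact wordArea_le_of_fill (fill_of_hasSequence Δ.reads (minMaxLength_le_iff.1 hΔ))

/-! ### Filling functions -/

variable (P)

theorem fillingFunction_mono {M N : List (A × Bool) → ℕ∞} (h : ∀ w, M w ≤ N w) (n : ℕ) :
    P.fillingFunction M n ≤ P.fillingFunction N n :=
  iSup₂_mono fun w _ => h w

theorem Area_ne_top [Finite A] (n : ℕ) : P.Area n ≠ ⊤ := by
  have hfin : {w : List (A × Bool) | P.NullHomotopic w ∧ w.length ≤ n}.Finite :=
    (List.finite_length_le (A × Bool) n).subset fun w hw => hw.2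
  obtain ⟨B, hB⟩ := (hfin.image fun w => (P.wordArea w).toNat).bddAbove
  refine ne_top_of_le_ne_top (ENat.natCast_ne_top B) (iSup₂_le fun w hw => ?_)
  obtain ⟨k, hk⟩ := NullHomotopic.exists_fill hw.1
  have hne : P.wordArea w ≠ ⊤ :=
    ne_top_of_le_ne_top (ENat.natCast_ne_top k) (wordArea_le_of_fill hk)
  rw [← ENat.natCast_toNat hne]
  exact Nat.cast_le.2 (hB ⟨w, hw, rfl⟩)

theorem FL_le {n k : ℕ} (h : P.Area n ≤ k) : P.FL n ≤ (P.maxRelLength * k + n : ℕ) :=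
  iSup₂_le fun w hw => (P.wordFL_le ((le_iSup₂ (f := fun w (_ : P.NullHomotopic w ∧ w.length ≤ n) =>
    P.wordArea w) w hw).trans h)).trans (Nat.cast_le.2 (Nat.add_le_add_left hw.2 _))

theorem Area_le_pow [Finite A] {n L : ℕ} (h : P.FFFL n ≤ L) :
    P.Area n ≤ (P.numSymbols ^ L : ℕ) :=
  iSup₂_le fun w hw => wordArea_le_pow
    ((le_iSup₂ (f := fun w (_ : P.NullHomotopic w ∧ w.length ≤ n) => P.wordFFFL w) w hw).trans h)

end FinPresentation

/-- The invariants take values in `ℕ∞`; that they are finite is the first part of the claim. -/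
theorem theorem3 {A : Type*} [Finite A] (P : FinPresentation A) :
    ∃ C : ℕ, ∃ area fl ffl fffl : ℕ → ℕ,
      (∀ n, P.Area n = area n) ∧ (∀ n, P.FL n = fl n) ∧
      (∀ n, P.FFL n = ffl n) ∧ (∀ n, P.FFFL n = fffl n) ∧
      ∀ n, area n ≤ C ^ fffl n ∧
        fffl n ≤ ffl n ∧ ffl n ≤ fl n ∧ fl n ≤ C * area n + n := by
  have harea : ∀ n, P.Area n = (P.Area n).toNat := fun n =>
    (ENat.natCast_toNat (P.Area_ne_top n)).symm
  have hFL : ∀ n, P.FL n ≤ (P.maxRelLength * (P.Area n).toNat + n : ℕ) := fun n =>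
    P.FL_le (harea n).le
  have hfl : ∀ n, P.FL n = (P.FL n).toNat := fun n =>
    (ENat.natCast_toNat (ne_top_of_le_ne_top (ENat.natCast_ne_top _) (hFL n))).symm
  have hFFL : ∀ n, P.FFL n ≤ P.FL n := P.fillingFunction_mono P.wordFFL_le_wordFL
  have hffl : ∀ n, P.FFL n = (P.FFL n).toNat := fun n =>
    (ENat.natCast_toNat (ne_top_of_le_ne_top (hfl n ▸ ENat.natCast_ne_top _) (hFFL n))).symm
  have hFFFL : ∀ n, P.FFFL n ≤ P.FFL n := P.fillingFunction_mono P.wordFFFL_le_wordFFL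
  have hfffl : ∀ n, P.FFFL n = (P.FFFL n).toNat := fun n =>
    (ENat.natCast_toNat (ne_top_of_le_ne_top (hffl n ▸ ENat.natCast_ne_top _) (hFFFL n))).symm
  refine ⟨max P.numSymbols P.maxRelLength, _, _, _, _, harea, hfl, hffl, hfffl, fun n =>
    ⟨?_, ?_, ?_, ?_⟩⟩
  · have h := P.Area_le_pow (hfffl n).le
    rw [harea n, Nat.cast_le] at h
    exact h.trans (Nat.pow_le_pow_left (le_max_left _ _) _)
  · have h := hFFFL n
    rwa [hffl n, hfffl n, Nat.cast_le] at h
  · have h := hFFL n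
    rwa [hffl n, hfl n, Nat.cast_le] at h
  · have h := hFL n
    rw [hfl n, Nat.cast_le] at h
    exact h.trans (Nat.add_le_add_right (Nat.mul_le_mul_right _ (le_max_right _ _)) _)
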